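/- **Setting.** Fix a tree type whose nodes are built by finitely many constructors, each with an optional value and a fixed number of children, and a fixed finite set of operations $\mathrm{Op}_0,\dots,\mathrm{Op}_{k-1}$ on it. Each operation takes an argument of a non-node type and at least one node, and has a purely functional sequential definition: its code may inspect nodes, construct nodes and call operations, and every code path ends by returning a newly constructed node or a node already read (no call in tail position). **Transformation.** In the concurrent version, a memory cell holds either an immediate node or a deferred node, i.e. a suspended call $\mathrm{Op}_i(\mathrm{arg},\mathrm{children})$ or a suspended snapshot. In the code of $\mathrm{Op}_i$, every access to a node is replaced by a strict read (LLX the cell; if it holds a deferred node, force that node first and read again), and every call of an operation by the allocation of a new cell that holds a deferred node. To *force* a deferred node $d$ in a cell $n$: LLX $n$; if $n$ is finalized or no longer holds $d$, stop, and the caller (if any) retries; otherwise run the transformed code and store its result in $n$ by an SCX. If an LLX returns *Failed* or the SCX returns false, retry from the beginning with a fresh read-set. Forcing a snapshot copies the immediate node of its child, wraps every child that is not yet a snapshot into a deferred snapshot, and finalizes $n$ in the SCX. An LLX occupies an interval of time and may return *Failed* only if the cell was modified during it; an SCX is atomic and succeeds if and only if no cell of its read-set was modified since it was read. **System.** $P$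 threads ($P$ finite), scheduled arbitrarily, start with an empty memory. An idle thread may at any time publish a new cell (an immediate node, a deferred operation or a deferred snapshot) whose children are reachable from published cells, or start forcing any deferred node that is reachable from a published cell. **Theorem.** For every such tree type, operation set and number $P$ of threads there is a function $f:\mathbb N\to\mathbb N$ such that the following holds. Suppose that in some reachable state a thread $p$ starts to force a deferred node in a cell $n$, and that the sequential program that the node stands for terminates: evaluating by their sequential definitions the deferred operation and all operations still deferred in its subtrees returns a tree, after $T$ sequential steps altogether. Then, whatever the other threads do and however the threads are scheduled, 1. $p$ takes at most $f(T)$ steps of its own in this execution of force, those of nested forcing and of retries included; 2. in particular $p$ meets at most $f(T)$ failures during it (an LLX on a node to be forced that returns *Failed* or *Finalized*; such a node no longer holding the deferred operation; an LLX on a child that returns *Failed* or finds it finalized and deferred; an unsuccessful SCX on a node to be forced); 3. as long as the execution of force is not finished, $p$ has an enabled step (it is never blocked); 4. when it is finished, the cell $n$ holds an immediate node. That is, forcing a deferred operation is wait-free (hence lock-free). -/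

import Mathlib

universe u v

/-! ### Tree types, operations and their sequential definitions -/

/-- A tree type and a fixed set of operations on it.  A node is built by one of finitely many
constructors ("cases"), with an optional value of type `Elem` and a fixed number of children.  Each
of the finitely many operations takes an argument of a non-node type and one or more nodes, and
returns a node. -/
structure TreeSig where
  Elem : Type u
  numCases : ℕ
  arity : Fin numCases → ℕ
  numOps : ℕ
  Arg : Fin numOps → Type v
  opArity : Fin numOps → ℕ
  one_le_opArity : ∀ j, 1 ≤ opArity j

/-- An immediate node whose children are given by elements of `α` (variables or addresses). -/
structure Imm (S : TreeSig.{u, v}) (α : Type) where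
  tag : Fin S.numCases
  value : Option S.Elem
  children : Fin (S.arity tag) → α

def Imm.map {S : TreeSig.{u, v}} {α β : Type} (g : α → β) (x : Imm S α) : Imm S β :=
  ⟨x.tag, x.value, fun i => g (x.children i)⟩

/-- A deferred node: a suspended call of an operation, or a suspended snapshot. -/
inductive Deferred (S : TreeSig.{u, v}) (α : Type) where
  | op (j : Fin S.numOps) (arg : S.Arg j) (children : Fin (S.opArity j) → α)
  | snapshot (child : α)

def Deferred.map {S : TreeSig.{u, v}} {α β : Type} (g : α → β) : Deferred S α → Deferred S β
  | .op j arg children => .op j arg fun i => g (children i)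
  | .snapshot child => .snapshot (g child)

def Deferred.isSnapshot {S : TreeSig.{u, v}} {α : Type} : Deferred S α → Bool
  | .op _ _ _ => false
  | .snapshot _ => true

/-- The data stored in a node of the concurrent tree: `Deferred | Immediate`. -/
inductive Content (S : TreeSig.{u, v}) (α : Type) where
  | imm (x : Imm S α)
  | deferred (d : Deferred S α)

def Content.map {S : TreeSig.{u, v}} {α β : Type} (g : α → β) : Content S α → Content S β
  | .imm x => .imm (x.map g)
  | .deferred d => .deferred (d.map g)

def Content.refs {S : TreeSig.{u, v}} {α : Type} : Content S α → Set α
  | .imm x => Set.range x.children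
  | .deferred (.op _ _ children) => Set.range children
  | .deferred (.snapshot child) => {child}

/-- The code of a purely functional operation in which `m` node variables are in scope.
`read x k` inspects the node `x` (a pattern match) and brings its children into scope, `call` calls
an operation and binds the resulting node, `build` constructs a node and binds it.  Every code path
ends in `ret`, which constructs the returned node, so that no call is in tail position; returning
a node that was already read is `ret` with the constructor, value and children that the read gave.
There is no instruction that mutates anything, and code cannot inspect the identity of a node.  It is
not required that a node be passed to at most one call (affine access): the code is arbitrary. -/
inductive Body (S : TreeSig.{u, v}) : ℕ → Type (max u v) where
  | read {m : ℕ} (x : Fin m)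
      (k : (c : Fin S.numCases) → Option S.Elem → Body S (m + S.arity c)) : Body S m
  | call {m : ℕ} (j : Fin S.numOps) (arg : S.Arg j) (xs : Fin (S.opArity j) → Fin m)
      (k : Body S (m + 1)) : Body S m
  | build {m : ℕ} (x : Imm S (Fin m)) (k : Body S (m + 1)) : Body S m
  | ret {m : ℕ} (x : Imm S (Fin m)) : Body S m

/-- The sequential definitions of all operations, as functions of their non-node argument. -/
abbrev SeqDef (S : TreeSig.{u, v}) : Type (max u v) :=
  (j : Fin S.numOps) → S.Arg j → Body S (S.opArity j)

/-- The (finite, immutable) trees on which the sequential definitions operate. -/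
inductive SeqTree (S : TreeSig.{u, v}) : Type (max u v) where
  | node (c : Fin S.numCases) (value : Option S.Elem) (children : Fin (S.arity c) → SeqTree S)

/-- Ordinary (call-by-value) sequential execution.  `SeqRun D env b r t`: with the node variables
bound to the trees `env`, the code `b` terminates after exactly `t` steps, those of all calls
included, and returns the tree `r`. -/
inductive SeqRun {S : TreeSig.{u, v}} (D : SeqDef S) :
    {m : ℕ} → (Fin m → SeqTree S) → Body S m → SeqTree S → ℕ → Prop where
  | read {m : ℕ} {env : Fin m → SeqTree S} {x : Fin m}
      {k : (c : Fin S.numCases) → Option S.Elem → Body S (m + S.arity c)}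
      {c : Fin S.numCases} {val : Option S.Elem} {ts : Fin (S.arity c) → SeqTree S}
      {r : SeqTree S} {t : ℕ} (hx : env x = .node c val ts)
      (hk : SeqRun D (Fin.append env ts) (k c val) r t) :
      SeqRun D env (.read x k) r (t + 1)
  | call {m : ℕ} {env : Fin m → SeqTree S} {j : Fin S.numOps} {arg : S.Arg j}
      {xs : Fin (S.opArity j) → Fin m} {k : Body S (m + 1)} {r₁ r : SeqTree S} {t₁ t : ℕ}
      (hj : SeqRun D (fun i => env (xs i)) (D j arg) r₁ t₁)
      (hk : SeqRun D (Fin.snoc (α := fun _ => SeqTree S) env r₁) k r t) :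
      SeqRun D env (.call j arg xs k) r (t₁ + t + 1)
  | build {m : ℕ} {env : Fin m → SeqTree S} {x : Imm S (Fin m)} {k : Body S (m + 1)}
      {r : SeqTree S} {t : ℕ}
      (hk : SeqRun D (Fin.snoc (α := fun _ => SeqTree S) env
        (.node x.tag x.value fun i => env (x.children i))) k r t) :
      SeqRun D env (.build x k) r (t + 1)
  | ret {m : ℕ} {env : Fin m → SeqTree S} {x : Imm S (Fin m)} :
      SeqRun D env (.ret x) (.node x.tag x.value fun i => env (x.children i)) 1

/-! ### The transformation -/

/-- The code of the `apply` methods.  `readStrict x k` is a forced read; it also reports whether the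
node is finalized.  `readLazy x k` reads without forcing, and reports whether the node is already
a snapshot, that is, a deferred snapshot or a finalized immediate node.  `alloc` creates a new
memory cell.  `ret` returns the immediate data to be assigned to the forced node. -/
inductive Code (S : TreeSig.{u, v}) : ℕ → Type (max u v) where
  | readStrict {m : ℕ} (x : Fin m)
      (k : (c : Fin S.numCases) → Option S.Elem → Bool → Code S (m + S.arity c)) : Code S m
  | readLazy {m : ℕ} (x : Fin m) (k : Bool → Code S m) : Code S m
  | alloc {m : ℕ} (x : Content S (Fin m)) (k : Code S (m + 1)) : Code S m
  | ret {m : ℕ} (x : Imm S (Fin m)) : Code S m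

/-- The transformation rules: every access to a node becomes a strict read, and every call of an
operation becomes the creation of a deferred node. -/
def Body.transform {S : TreeSig.{u, v}} : {m : ℕ} → Body S m → Code S m
  | _, .read x k => .readStrict x fun c val _ => (k c val).transform
  | _, .call j arg xs k => .alloc (.deferred (.op j arg xs)) k.transform
  | _, .build x k => .alloc (.imm x) k.transform
  | _, .ret x => .ret x

/-- The second half of a snapshot: each child listed in `is` that is not yet a snapshot is replaced
by a new deferred snapshot of it. -/
def snapshotChildren {S : TreeSig.{u, v}} (c : Fin S.numCases) (val : Option S.Elem) :
    (is : List (Fin (S.arity c))) → {m : ℕ} → (xs : Fin (S.arity c) → Fin m) → Code S m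
  | [], _, xs => .ret ⟨c, val, xs⟩
  | i :: is, m, xs => .readLazy (xs i) fun already =>
      if already then snapshotChildren c val is xs
      else .alloc (.deferred (.snapshot (xs i)))
        (snapshotChildren c val is
          (Function.update (fun l => (xs l).castSucc) i (Fin.last m)))

/-- `Snapshot::apply`, for an arbitrary tree type. -/
def snapshotCode (S : TreeSig.{u, v}) : Code S 1 :=
  .readStrict 0 fun c val final =>
    if final then .ret ⟨c, val, fun i => Fin.natAdd 1 i⟩
    else snapshotChildren c val (List.finRange (S.arity c)) fun i => Fin.natAdd 1 i

/-! ### The shared-memory machine -/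

abbrev Addr : Type := ℕ

/-- A memory cell supporting LLX and SCX: its data, the finalized mark, and the number of
successful SCXs on it (which tells whether it was modified between two moments). -/
structure Cell (S : TreeSig.{u, v}) where
  content : Content S Addr
  final : Bool
  version : ℕ

/-- The cell at address `a` is the entry with index `a`; a new cell is appended. -/
abbrev Heap (S : TreeSig.{u, v}) : Type (max u v) := List (Cell S)

def Cell.fresh {S : TreeSig.{u, v}} (x : Content S Addr) : Cell S := ⟨x, false, 0⟩

/-- What `readLazy` reports. -/
def Cell.alreadySnapshot {S : TreeSig.{u, v}} (cell : Cell S) : Bool :=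
  match cell.content with
  | .imm _ => cell.final
  | .deferred d => d.isSnapshot

/-- The read-set of a simple linearizable operation: the cells on which an LLX was successful, with
the version seen. -/
abbrev ReadSet : Type := List (Addr × ℕ)

/-- No cell of the read-set was modified since it was read. -/
def ReadSet.Valid {S : TreeSig.{u, v}} (R : ReadSet) (h : Heap S) : Prop :=
  ∀ e ∈ R, ∃ cell, h[e.1]? = some cell ∧ cell.version = e.2

/-- A finalized cell cannot change any more and is not entered in the read-set. -/
def ReadSet.add {S : TreeSig.{u, v}} (R : ReadSet) (a : Addr) (cell : Cell S) : ReadSet :=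
  if cell.final then R else (a, cell.version) :: R

/-- Where an activation of `force` stands. -/
inductive Phase (S : TreeSig.{u, v}) : Type (max u v) where
  /-- about to start (or restart) with a fresh context -/
  | start
  /-- in the middle of the LLX on the node to be forced; `w` is its version when the LLX began -/
  | rootLLX (w : ℕ)
  /-- executing `apply` -/
  | run {m : ℕ} (R : ReadSet) (env : Fin m → Addr) (code : Code S m)
  /-- in the middle of the LLX of the read instruction at the head of `code` -/
  | childLLX {m : ℕ} (R : ReadSet) (env : Fin m → Addr) (code : Code S m) (w : ℕ)

/-- An activation of `force`: the node at `addr` is to be forced, which contained `task`. -/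
structure Frame (S : TreeSig.{u, v}) where
  addr : Addr
  task : Deferred S Addr
  phase : Phase S

/-- The call stack of a thread, innermost activation first; an idle thread has the empty stack. -/
abbrev Stack (S : TreeSig.{u, v}) : Type (max u v) := List (Frame S)

/-- Escaping from an activation makes the calling activation, if there is one, retry. -/
def Stack.escape {S : TreeSig.{u, v}} : Stack S → Stack S
  | [] => []
  | fr :: rest => ⟨fr.addr, fr.task, .start⟩ :: rest

/-- The state in which `apply` starts: its variables are the children of the deferred node. -/
def Deferred.begin {S : TreeSig.{u, v}} (D : SeqDef S) (R : ReadSet) :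
    Deferred S Addr → Phase S
  | .op j arg children => .run R children (D j arg).transform
  | .snapshot child => .run R (fun _ => child) (snapshotCode S)

/-- What a step of a thread did. -/
inductive Event where
  /-- a client action: start forcing the deferred node at `a` -/
  | invoke (a : Addr)
  /-- a client action: publish a new node -/
  | post
  /-- a step of `force` in which nothing fails -/
  | progress
  /-- the LLX on the node to be forced returned `Failed` -/
  | rootFailed
  /-- the LLX on the node to be forced returned `Finalized` -/
  | rootFinalized
  /-- the LLX succeeded, but the node no longer contains the deferred operation -/
  | rootMismatch
  /-- an LLX on a child returned `Failed` -/
  | childFailed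
  /-- a child was found finalized and deferred -/
  | childSubsumed
  /-- the SCX on the node to be forced returned false -/
  | scxFailed

def Event.isClient : Event → Bool
  | .invoke _ => true
  | .post => true
  | _ => false

def Event.isFailure : Event → Bool
  | .rootFailed => true
  | .rootFinalized => true
  | .rootMismatch => true
  | .childFailed => true
  | .childSubsumed => true
  | .scxFailed => true
  | _ => false

/-- One step of a thread that executes `force`, acting on the heap and on its own call stack.
An LLX takes an interval of time (one step to begin, one to end): at its end it may return `Failed`
only if the cell was modified in the meantime, and otherwise returns `Finalized` or a snapshot of
the cell.  An SCX is atomic: it succeeds if and only if the read-set is still valid. -/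
inductive ForceStep {S : TreeSig.{u, v}} (D : SeqDef S) :
    Heap S → Stack S → Event → Heap S → Stack S → Prop where
  | rootBegin {h : Heap S} {a : Addr} {d : Deferred S Addr} {rest : Stack S} {cell : Cell S}
      (ha : h[a]? = some cell) :
      ForceStep D h (⟨a, d, .start⟩ :: rest) .progress h
        (⟨a, d, .rootLLX cell.version⟩ :: rest)
  | rootFailed {h : Heap S} {a : Addr} {d : Deferred S Addr} {rest : Stack S} {cell : Cell S}
      {w : ℕ} (ha : h[a]? = some cell) (hw : cell.version ≠ w) :
      ForceStep D h (⟨a, d, .rootLLX w⟩ :: rest) .rootFailed h (⟨a, d, .start⟩ :: rest)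
  | rootFinalized {h : Heap S} {a : Addr} {d : Deferred S Addr} {rest : Stack S} {cell : Cell S}
      {w : ℕ} (ha : h[a]? = some cell) (hf : cell.final = true) :
      ForceStep D h (⟨a, d, .rootLLX w⟩ :: rest) .rootFinalized h rest.escape
  | rootMismatch {h : Heap S} {a : Addr} {d : Deferred S Addr} {rest : Stack S} {cell : Cell S}
      {w : ℕ} (ha : h[a]? = some cell) (hf : cell.final = false)
      (hd : cell.content ≠ .deferred d) :
      ForceStep D h (⟨a, d, .rootLLX w⟩ :: rest) .rootMismatch h rest.escape
  | rootSuccess {h : Heap S} {a : Addr} {d : Deferred S Addr} {rest : Stack S} {cell : Cell S}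
      {w : ℕ} (ha : h[a]? = some cell) (hf : cell.final = false)
      (hd : cell.content = .deferred d) :
      ForceStep D h (⟨a, d, .rootLLX w⟩ :: rest) .progress h
        (⟨a, d, d.begin D [(a, cell.version)]⟩ :: rest)
  | alloc {h : Heap S} {a : Addr} {d : Deferred S Addr} {rest : Stack S} {R : ReadSet} {m : ℕ}
      {env : Fin m → Addr} {x : Content S (Fin m)} {k : Code S (m + 1)} :
      ForceStep D h (⟨a, d, .run R env (.alloc x k)⟩ :: rest) .progress
        (h ++ [Cell.fresh (x.map env)])
        (⟨a, d, .run R (Fin.snoc (α := fun _ => Addr) env h.length) k⟩ :: rest)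
  | strictBegin {h : Heap S} {a : Addr} {d : Deferred S Addr} {rest : Stack S} {R : ReadSet}
      {m : ℕ} {env : Fin m → Addr} {x : Fin m}
      {k : (c : Fin S.numCases) → Option S.Elem → Bool → Code S (m + S.arity c)}
      {cell : Cell S} (hx : h[env x]? = some cell) :
      ForceStep D h (⟨a, d, .run R env (.readStrict x k)⟩ :: rest) .progress h
        (⟨a, d, .childLLX R env (.readStrict x k) cell.version⟩ :: rest)
  | strictFailed {h : Heap S} {a : Addr} {d : Deferred S Addr} {rest : Stack S} {R : ReadSet}
      {m : ℕ} {env : Fin m → Addr} {x : Fin m}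
      {k : (c : Fin S.numCases) → Option S.Elem → Bool → Code S (m + S.arity c)}
      {w : ℕ} {cell : Cell S} (hx : h[env x]? = some cell) (hw : cell.version ≠ w) :
      ForceStep D h (⟨a, d, .childLLX R env (.readStrict x k) w⟩ :: rest) .childFailed h
        (⟨a, d, .start⟩ :: rest)
  /-- The child is immediate: the read returns it. -/
  | strictImm {h : Heap S} {a : Addr} {d : Deferred S Addr} {rest : Stack S} {R : ReadSet}
      {m : ℕ} {env : Fin m → Addr} {x : Fin m}
      {k : (c : Fin S.numCases) → Option S.Elem → Bool → Code S (m + S.arity c)}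
      {w : ℕ} {cell : Cell S} {y : Imm S Addr} (hx : h[env x]? = some cell)
      (hy : cell.content = .imm y) :
      ForceStep D h (⟨a, d, .childLLX R env (.readStrict x k) w⟩ :: rest) .progress h
        (⟨a, d, .run (R.add (env x) cell) (Fin.append env y.children)
          (k y.tag y.value cell.final)⟩ :: rest)
  /-- The child is finalized and deferred: escape. -/
  | strictSubsumed {h : Heap S} {a : Addr} {d : Deferred S Addr} {rest : Stack S} {R : ReadSet}
      {m : ℕ} {env : Fin m → Addr} {x : Fin m}
      {k : (c : Fin S.numCases) → Option S.Elem → Bool → Code S (m + S.arity c)}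
      {w : ℕ} {cell : Cell S} {d₁ : Deferred S Addr} (hx : h[env x]? = some cell)
      (hd : cell.content = .deferred d₁) (hf : cell.final = true) :
      ForceStep D h (⟨a, d, .childLLX R env (.readStrict x k) w⟩ :: rest) .childSubsumed h
        rest.escape
  /-- The child is active and deferred: forget this LLX, force the child, then read it again. -/
  | strictForce {h : Heap S} {a : Addr} {d : Deferred S Addr} {rest : Stack S} {R : ReadSet}
      {m : ℕ} {env : Fin m → Addr} {x : Fin m}
      {k : (c : Fin S.numCases) → Option S.Elem → Bool → Code S (m + S.arity c)}
      {w : ℕ} {cell : Cell S} {d₁ : Deferred S Addr} (hx : h[env x]? = some cell)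
      (hd : cell.content = .deferred d₁) (hf : cell.final = false) :
      ForceStep D h (⟨a, d, .childLLX R env (.readStrict x k) w⟩ :: rest) .progress h
        (⟨env x, d₁, .start⟩ :: ⟨a, d, .run R env (.readStrict x k)⟩ :: rest)
  | lazyBegin {h : Heap S} {a : Addr} {d : Deferred S Addr} {rest : Stack S} {R : ReadSet}
      {m : ℕ} {env : Fin m → Addr} {x : Fin m} {k : Bool → Code S m}
      {cell : Cell S} (hx : h[env x]? = some cell) :
      ForceStep D h (⟨a, d, .run R env (.readLazy x k)⟩ :: rest) .progress h
        (⟨a, d, .childLLX R env (.readLazy x k) cell.version⟩ :: rest)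
  | lazyFailed {h : Heap S} {a : Addr} {d : Deferred S Addr} {rest : Stack S} {R : ReadSet}
      {m : ℕ} {env : Fin m → Addr} {x : Fin m} {k : Bool → Code S m}
      {w : ℕ} {cell : Cell S} (hx : h[env x]? = some cell) (hw : cell.version ≠ w) :
      ForceStep D h (⟨a, d, .childLLX R env (.readLazy x k) w⟩ :: rest) .childFailed h
        (⟨a, d, .start⟩ :: rest)
  | lazyDone {h : Heap S} {a : Addr} {d : Deferred S Addr} {rest : Stack S} {R : ReadSet}
      {m : ℕ} {env : Fin m → Addr} {x : Fin m} {k : Bool → Code S m}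
      {w : ℕ} {cell : Cell S} (hx : h[env x]? = some cell) :
      ForceStep D h (⟨a, d, .childLLX R env (.readLazy x k) w⟩ :: rest) .progress h
        (⟨a, d, .run (R.add (env x) cell) env (k cell.alreadySnapshot)⟩ :: rest)
  /-- The SCX succeeds: the result is written, and the cell is finalized if it was a snapshot. -/
  | scxSuccess {h : Heap S} {a : Addr} {d : Deferred S Addr} {rest : Stack S} {R : ReadSet}
      {m : ℕ} {env : Fin m → Addr} {x : Imm S (Fin m)} {cell : Cell S}
      (ha : h[a]? = some cell) (hR : R.Valid h) :
      ForceStep D h (⟨a, d, .run R env (.ret x)⟩ :: rest) .progress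
        (h.set a ⟨.imm (x.map env), d.isSnapshot, cell.version + 1⟩) rest
  | scxFailed {h : Heap S} {a : Addr} {d : Deferred S Addr} {rest : Stack S} {R : ReadSet}
      {m : ℕ} {env : Fin m → Addr} {x : Imm S (Fin m)} (hR : ¬ R.Valid h) :
      ForceStep D h (⟨a, d, .run R env (.ret x)⟩ :: rest) .scxFailed h (⟨a, d, .start⟩ :: rest)

/-- A state of the system of `P` threads.  `roots` holds the nodes that were ever published as
roots of trees. -/
structure Config (S : TreeSig.{u, v}) (P : ℕ) where
  heap : Heap S
  roots : Set Addr
  threads : Fin P → Stack S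

/-- The nodes that clients can get hold of: those reachable from a root. -/
inductive Config.Accessible {S : TreeSig.{u, v}} {P : ℕ} (C : Config S P) : Addr → Prop where
  | root {a : Addr} (ha : a ∈ C.roots) : C.Accessible a
  | child {a b : Addr} {cell : Cell S} (ha : C.Accessible a) (hc : C.heap[a]? = some cell)
      (hb : b ∈ cell.content.refs) : C.Accessible b

/-- The initial state: no cells, no roots, all threads idle. -/
def Config.initial (S : TreeSig.{u, v}) (P : ℕ) : Config S P := ⟨[], ∅, fun _ => []⟩

/-- One step of thread `p`.  A thread inside `force` continues it.  An idle thread may start to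
force any accessible deferred node, or publish a new node (an initial tree, a deferred operation
or a deferred snapshot) whose children are accessible. -/
inductive Step {S : TreeSig.{u, v}} {P : ℕ} (D : SeqDef S) :
    Config S P → Fin P → Event → Config S P → Prop where
  | force {C : Config S P} {p : Fin P} {e : Event} {h : Heap S} {st : Stack S}
      (hs : ForceStep D C.heap (C.threads p) e h st) :
      Step D C p e ⟨h, C.roots, Function.update C.threads p st⟩
  | invoke {C : Config S P} {p : Fin P} {a : Addr} {cell : Cell S} {d : Deferred S Addr}
      (hp : C.threads p = []) (ha : C.Accessible a) (hc : C.heap[a]? = some cell)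
      (hd : cell.content = .deferred d) :
      Step D C p (.invoke a)
        ⟨C.heap, C.roots, Function.update C.threads p [⟨a, d, .start⟩]⟩
  | post {C : Config S P} {p : Fin P} {x : Content S Addr}
      (hp : C.threads p = []) (hx : ∀ a ∈ x.refs, C.Accessible a) :
      Step D C p .post
        ⟨C.heap ++ [Cell.fresh x], insert C.heap.length C.roots, C.threads⟩

/-- Finite executions under an arbitrary schedule, with their trace. -/
inductive Exec {S : TreeSig.{u, v}} {P : ℕ} (D : SeqDef S) :
    Config S P → List (Fin P × Event) → Config S P → Prop where
  | nil {C : Config S P} : Exec D C [] C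
  | cons {C C₁ C₂ : Config S P} {p : Fin P} {e : Event} {tr : List (Fin P × Event)}
      (hs : Step D C p e C₁) (ht : Exec D C₁ tr C₂) : Exec D C ((p, e) :: tr) C₂

/-- The number of steps of thread `p` in a trace. -/
def stepsOf {P : ℕ} (p : Fin P) (tr : List (Fin P × Event)) : ℕ :=
  tr.countP fun s => decide (s.1 = p)

/-- The number of failures met by thread `p` in a trace. -/
def failuresOf {P : ℕ} (p : Fin P) (tr : List (Fin P × Event)) : ℕ :=
  tr.countP fun s => decide (s.1 = p) && s.2.isFailure

/-- The sequential meaning of a node.  `SeqCost D h a r t`: the tree that the node at `a` stands for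
is `r`, and executing, by their sequential definitions, all operations that are still deferred in it
takes `t` steps altogether.  A snapshot returns its argument.  -/
inductive SeqCost {S : TreeSig.{u, v}} (D : SeqDef S) (h : Heap S) :
    Addr → SeqTree S → ℕ → Prop where
  | imm {a : Addr} {cell : Cell S} {y : Imm S Addr} {ts : Fin (S.arity y.tag) → SeqTree S}
      {τ : Fin (S.arity y.tag) → ℕ} (ha : h[a]? = some cell) (hy : cell.content = .imm y)
      (hc : ∀ i, SeqCost D h (y.children i) (ts i) (τ i)) :
      SeqCost D h a (.node y.tag y.value ts) (∑ i, τ i)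
  | op {a : Addr} {cell : Cell S} {j : Fin S.numOps} {arg : S.Arg j}
      {children : Fin (S.opArity j) → Addr} {ts : Fin (S.opArity j) → SeqTree S}
      {τ : Fin (S.opArity j) → ℕ} {r : SeqTree S} {t : ℕ} (ha : h[a]? = some cell)
      (hd : cell.content = .deferred (.op j arg children))
      (hc : ∀ i, SeqCost D h (children i) (ts i) (τ i))
      (hr : SeqRun D ts (D j arg) r t) :
      SeqCost D h a r ((∑ i, τ i) + t + 1)
  | snapshot {a b : Addr} {cell : Cell S} {r : SeqTree S} {t : ℕ} (ha : h[a]? = some cell)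
      (hd : cell.content = .deferred (.snapshot b)) (hb : SeqCost D h b r t) :
      SeqCost D h a r (t + 1)

/-! Three things must be controlled: the number of restarts of one activation, the depth of nested
forcing, and the interference of other threads.

Restarts. The result of forcing a deferred node is determined up to the identity of the new cells.
To express this, code is evaluated on virtual nodes (`Term`): new nodes stay terms, and existing
cells may be read strictly only when they are immediate. Such evaluations (`Run`, `EvalPath`) are
deterministic and survive every change of the heap, because immediate cells never change and forcing
preserves what `readLazy` reports. `Ref` relates a virtual node to a cell that realises it, and
`Resolves.ref` shows that this relation survives forcing. An attempt can only be spoiled by the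
modification of a cell that it has read or is reading or forcing. This is the node to be forced
itself (at most once), a node that a snapshot reads without forcing (at most `maxArity` times), or a
child that another thread forced during the strict read. In the last case the virtual evaluation was
stuck exactly at this child and can from now on go one instruction further, and it has at most
`codeBound` instructions. So `codeBound + maxArity + 1` restarts suffice; `Progress` is the
corresponding potential.

Privacy. The last case requires that the child is not a cell allocated in the current attempt. Such
cells are unknown to all other threads until the SCX (`Isolated`, `ForceStep.avoids`), so only
nested forcing by the same thread changes them, and the virtual evaluation accounts for that.

Depth. Termination of the sequential program gives every node a tree and a level
(`SeqCost.denotes`). Code of level `M` reads strictly only nodes of smaller level (`Sound`), and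
forcing preserves trees and levels (`Resolves.denotes`). Hence the recursion on the level in
`forceBound`: number of attempts, times number of instructions, times the cost of one nested force.

Accounting. The activations on the stack of a thread carry ghost data with budgets. A step of the
thread lowers the total budget (`StackInv.step_self`), and a step of another thread leaves it
unchanged (`StackInv.step_other`). A rational rank of the cells keeps the heap acyclic, and together
with the shape of the activations it also yields that a thread is never blocked (`ConfigOK`). -/

/-! ### Uniform view of deferred nodes -/

section Deferred

variable {S : TreeSig.{u, v}} {α β : Type}

/-- The number of node arguments of a deferred node. -/
def Deferred.arity : Deferred S α → ℕ
  | .op j _ _ => S.opArity j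
  | .snapshot _ => 1

/-- The node arguments of a deferred node. -/
def Deferred.env : (d : Deferred S α) → Fin d.arity → α
  | .op _ _ children => children
  | .snapshot child => fun _ => child

/-- The code that forces a deferred node. -/
def Deferred.code (D : SeqDef S) : (d : Deferred S α) → Code S d.arity
  | .op j arg _ => (D j arg).transform
  | .snapshot _ => snapshotCode S

theorem Deferred.begin_eq (D : SeqDef S) (R : ReadSet) (d : Deferred S Addr) :
    d.begin D R = .run R d.env (d.code D) := by
  cases d <;> rfl

theorem Content.refs_deferred (d : Deferred S α) :
    (Content.deferred d).refs = Set.range d.env := by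
  cases d with
  | op j arg ch => rfl
  | snapshot c =>
    ext x
    constructor
    · rintro rfl
      exact ⟨(0 : Fin 1), rfl⟩
    · rintro ⟨_, rfl⟩
      rfl

theorem Content.mem_refs_map {g : α → β} {x : Content S α} {b : β}
    (hb : b ∈ (x.map g).refs) : ∃ a ∈ x.refs, g a = b := by
  cases x with
  | imm y =>
    obtain ⟨i, rfl⟩ := hb
    exact ⟨_, ⟨i, rfl⟩, rfl⟩
  | deferred d =>
    cases d with
    | op j arg ch =>
      obtain ⟨i, rfl⟩ := hb
      exact ⟨_, ⟨i, rfl⟩, rfl⟩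
    | snapshot c =>
      obtain rfl := hb
      exact ⟨_, rfl, rfl⟩

end Deferred

/-! ### Virtual nodes and their resolved evaluation -/

/-- A virtual node: an existing cell, an immediate node, or a suspended piece of code. -/
inductive Term (S : TreeSig.{u, v}) : Type (max u v) where
  | addr (a : Addr)
  | imm (tag : Fin S.numCases) (value : Option S.Elem) (children : Fin (S.arity tag) → Term S)
  | susp {m : ℕ} (code : Code S m) (snap : Bool) (children : Fin m → Term S)

def Content.toTerm {S : TreeSig.{u, v}} {α : Type} (D : SeqDef S) (x : Content S α)
    (σ : α → Term S) : Term S :=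
  match x with
  | .imm y => .imm y.tag y.value fun i => σ (y.children i)
  | .deferred d => .susp (d.code D) d.isSnapshot fun i => σ (d.env i)

/-- What `readLazy` reports on a virtual node. -/
def Term.already {S : TreeSig.{u, v}} (h : Heap S) : Term S → Option Bool
  | .addr a => (h[a]?).map Cell.alreadySnapshot
  | .imm _ _ _ => some false
  | .susp _ snap _ => some snap

/-- Evaluation of code on virtual nodes, in which existing cells are read only if they are
immediate, and which does not change the heap. -/
inductive Run {S : TreeSig.{u, v}} (D : SeqDef S) (h : Heap S) :
    {m : ℕ} → (Fin m → Term S) → Code S m →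
    (c : Fin S.numCases) → Option S.Elem → (Fin (S.arity c) → Term S) → Prop where
  | ret {m : ℕ} {σ : Fin m → Term S} {x : Imm S (Fin m)} :
      Run D h σ (.ret x) x.tag x.value fun i => σ (x.children i)
  | alloc {m : ℕ} {σ : Fin m → Term S} {x : Content S (Fin m)} {k : Code S (m + 1)}
      {c : Fin S.numCases} {val : Option S.Elem} {ts : Fin (S.arity c) → Term S}
      (hk : Run D h (Fin.snoc (α := fun _ => Term S) σ (x.toTerm D σ)) k c val ts) :
      Run D h σ (.alloc x k) c val ts
  | lazy {m : ℕ} {σ : Fin m → Term S} {x : Fin m} {k : Bool → Code S m} {b : Bool}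
      {c : Fin S.numCases} {val : Option S.Elem} {ts : Fin (S.arity c) → Term S}
      (hx : (σ x).already h = some b) (hk : Run D h σ (k b) c val ts) :
      Run D h σ (.readLazy x k) c val ts
  | strictAddr {m : ℕ} {σ : Fin m → Term S} {x : Fin m}
      {k : (c : Fin S.numCases) → Option S.Elem → Bool → Code S (m + S.arity c)}
      {a : Addr} {cell : Cell S} {y : Imm S Addr}
      {c : Fin S.numCases} {val : Option S.Elem} {ts : Fin (S.arity c) → Term S}
      (hx : σ x = .addr a) (ha : h[a]? = some cell) (hy : cell.content = .imm y)
      (hk : Run D h (Fin.append σ fun i => .addr (y.children i)) (k y.tag y.value cell.final)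
        c val ts) :
      Run D h σ (.readStrict x k) c val ts
  | strictImm {m : ℕ} {σ : Fin m → Term S} {x : Fin m}
      {k : (c : Fin S.numCases) → Option S.Elem → Bool → Code S (m + S.arity c)}
      {c₁ : Fin S.numCases} {val₁ : Option S.Elem} {ts₁ : Fin (S.arity c₁) → Term S}
      {c : Fin S.numCases} {val : Option S.Elem} {ts : Fin (S.arity c) → Term S}
      (hx : σ x = .imm c₁ val₁ ts₁)
      (hk : Run D h (Fin.append σ ts₁) (k c₁ val₁ false) c val ts) :
      Run D h σ (.readStrict x k) c val ts
  | strictSusp {m : ℕ} {σ : Fin m → Term S} {x : Fin m}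
      {k : (c : Fin S.numCases) → Option S.Elem → Bool → Code S (m + S.arity c)}
      {m₁ : ℕ} {code : Code S m₁} {snap : Bool} {args : Fin m₁ → Term S}
      {c₁ : Fin S.numCases} {val₁ : Option S.Elem} {ts₁ : Fin (S.arity c₁) → Term S}
      {c : Fin S.numCases} {val : Option S.Elem} {ts : Fin (S.arity c) → Term S}
      (hx : σ x = .susp code snap args) (hr : Run D h args code c₁ val₁ ts₁)
      (hk : Run D h (Fin.append σ ts₁) (k c₁ val₁ snap) c val ts) :
      Run D h σ (.readStrict x k) c val ts

/-- `Whnf D h t c val ts f`: the virtual node `t` evaluates to an immediate node, finalized if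
`f` holds. -/
inductive Whnf {S : TreeSig.{u, v}} (D : SeqDef S) (h : Heap S) :
    Term S → (c : Fin S.numCases) → Option S.Elem → (Fin (S.arity c) → Term S) → Bool → Prop where
  | addr {a : Addr} {cell : Cell S} {y : Imm S Addr} (ha : h[a]? = some cell)
      (hy : cell.content = .imm y) :
      Whnf D h (.addr a) y.tag y.value (fun i => .addr (y.children i)) cell.final
  | imm {c : Fin S.numCases} {val : Option S.Elem} {ts : Fin (S.arity c) → Term S} :
      Whnf D h (.imm c val ts) c val ts false
  | susp {m : ℕ} {code : Code S m} {snap : Bool} {args : Fin m → Term S}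
      {c : Fin S.numCases} {val : Option S.Elem} {ts : Fin (S.arity c) → Term S}
      (hr : Run D h args code c val ts) : Whnf D h (.susp code snap args) c val ts snap

section Evaluation

variable {S : TreeSig.{u, v}} {D : SeqDef S} {h h' : Heap S}

theorem Run.strict {m : ℕ} {σ : Fin m → Term S} {x : Fin m}
    {k : (c : Fin S.numCases) → Option S.Elem → Bool → Code S (m + S.arity c)}
    {c₁ : Fin S.numCases} {val₁ : Option S.Elem} {ts₁ : Fin (S.arity c₁) → Term S} {f : Bool}
    {c : Fin S.numCases} {val : Option S.Elem} {ts : Fin (S.arity c) → Term S}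
    (hx : Whnf D h (σ x) c₁ val₁ ts₁ f)
    (hk : Run D h (Fin.append σ ts₁) (k c₁ val₁ f) c val ts) :
    Run D h σ (.readStrict x k) c val ts := by
  generalize hσ : σ x = t at hx
  cases hx with
  | addr ha hy => exact .strictAddr hσ ha hy hk
  | imm => exact .strictImm hσ hk
  | susp hr => exact .strictSusp hσ hr hk

/-- A constructor with its value and children that are terms. -/
abbrev Result (S : TreeSig.{u, v}) : Type (max u v) :=
  (c : Fin S.numCases) × Option S.Elem × (Fin (S.arity c) → Term S)

/-- The instruction at the head of the code and the form of the term that it reads leave only one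
applicable rule. -/
theorem Run.deterministic {m : ℕ} {σ : Fin m → Term S} {code : Code S m}
    {c : Fin S.numCases} {val : Option S.Elem} {ts : Fin (S.arity c) → Term S}
    (hr : Run D h σ code c val ts) :
    ∀ {c' : Fin S.numCases} {val' : Option S.Elem} {ts' : Fin (S.arity c') → Term S},
      Run D h σ code c' val' ts' → (⟨c, val, ts⟩ : Result S) = ⟨c', val', ts'⟩ := by
  induction hr with
  | ret => intro c' val' ts' hr'; cases hr'; rfl
  | alloc hk ih => intro c' val' ts' hr'; cases hr' with | alloc hk' => exact ih hk'
  | lazy hx hk ih =>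
    intro c' val' ts' hr'
    cases hr' with
    | lazy hx' hk' =>
      obtain rfl : _ = _ := Option.some.inj (hx.symm.trans hx')
      exact ih hk'
  | strictAddr hx ha hy hk ih =>
    intro c' val' ts' hr'
    cases hr' with
    | strictAddr hx' ha' hy' hk' =>
      rw [hx] at hx'
      cases hx'
      rw [ha] at ha'
      cases ha'
      rw [hy] at hy'
      cases hy'
      exact ih hk'
    | strictImm hx' hk' => rw [hx] at hx'; cases hx'
    | strictSusp hx' hr' hk' => rw [hx] at hx'; cases hx'
  | strictImm hx hk ih =>
    intro c' val' ts' hr'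
    cases hr' with
    | strictAddr hx' ha' hy' hk' => rw [hx] at hx'; cases hx'
    | strictImm hx' hk' =>
      rw [hx] at hx'
      cases hx'
      exact ih hk'
    | strictSusp hx' hr' hk' => rw [hx] at hx'; cases hx'
  | strictSusp hx hr hk ih₁ ih =>
    intro c' val' ts' hr'
    cases hr' with
    | strictAddr hx' ha' hy' hk' => rw [hx] at hx'; cases hx'
    | strictImm hx' hk' => rw [hx] at hx'; cases hx'
    | strictSusp hx' hr' hk' =>
      rw [hx] at hx'
      cases hx'
      cases ih₁ hr'
      exact ih hk'

theorem Whnf.deterministic {t : Term S}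
    {c : Fin S.numCases} {val : Option S.Elem} {ts : Fin (S.arity c) → Term S} {f : Bool}
    {c' : Fin S.numCases} {val' : Option S.Elem} {ts' : Fin (S.arity c') → Term S} {f' : Bool}
    (hr : Whnf D h t c val ts f) (hr' : Whnf D h t c' val' ts' f') :
    (⟨c, val, ts⟩ : Result S) = ⟨c', val', ts'⟩ ∧ f = f' := by
  cases hr with
  | addr ha hy =>
    cases hr' with
    | addr ha' hy' =>
      rw [ha] at ha'
      cases ha'
      rw [hy] at hy'
      cases hy'
      exact ⟨rfl, rfl⟩
  | imm => cases hr'; exact ⟨rfl, rfl⟩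
  | susp hr => cases hr' with | susp hr' => exact ⟨hr.deterministic hr', rfl⟩

/-- What `readLazy` reports on a virtual node that can be evaluated. -/
theorem Whnf.already {t : Term S}
    {c : Fin S.numCases} {val : Option S.Elem} {ts : Fin (S.arity c) → Term S} {f : Bool}
    (hr : Whnf D h t c val ts f) : t.already h = some f := by
  cases hr with
  | addr ha hy => simp [Term.already, ha, Cell.alreadySnapshot, hy]
  | imm => rfl
  | susp hr => rfl

/-- The ways in which a heap can change: cells are added, and deferred cells become immediate. -/
def Evolves (h h' : Heap S) : Prop :=
  ∀ (a : Addr) (cell : Cell S), h[a]? = some cell → h'[a]? = some cell ∨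
    ∃ d : Deferred S Addr, cell.content = .deferred d ∧ ∃ (cell' : Cell S) (y : Imm S Addr), h'[a]? = some cell' ∧ cell'.content = .imm y ∧
      cell'.final = d.isSnapshot ∧ cell'.version = cell.version + 1

theorem Evolves.imm (he : Evolves h h') {a : Addr} {cell : Cell S} {y : Imm S Addr}
    (ha : h[a]? = some cell) (hy : cell.content = .imm y) : h'[a]? = some cell := by
  rcases he a cell ha with h1 | ⟨d, hd, _⟩
  · exact h1
  · rw [hy] at hd; cases hd

/-- A forced operation becomes immediate and not finalized, a forced snapshot becomes immediate and
finalized; in both cases `readLazy` gives the same answer before and after. So reads without forcing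
do not make evaluations depend on the schedule. -/
theorem Evolves.already (he : Evolves h h') {t : Term S} {b : Bool}
    (ht : t.already h = some b) : t.already h' = some b := by
  cases t with
  | addr a =>
    simp only [Term.already, Option.map_eq_some_iff] at ht ⊢
    obtain ⟨cell, ha, hb⟩ := ht
    rcases he a cell ha with h1 | ⟨d, hd, cell', y, h1, hy, hf, _⟩
    · exact ⟨cell, h1, hb⟩
    · refine ⟨cell', h1, ?_⟩
      rw [← hb]
      simp [Cell.alreadySnapshot, hd, hy, hf]
  | imm _ _ _ => exact ht
  | susp _ _ _ => exact ht

theorem Run.evolves (he : Evolves h h') {m : ℕ} {σ : Fin m → Term S} {code : Code S m}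
    {c : Fin S.numCases} {val : Option S.Elem} {ts : Fin (S.arity c) → Term S}
    (hr : Run D h σ code c val ts) : Run D h' σ code c val ts := by
  induction hr with
  | ret => exact .ret
  | alloc hk ih => exact .alloc ih
  | lazy hx hk ih => exact .lazy (he.already hx) ih
  | strictAddr hx ha hy hk ih => exact .strictAddr hx (he.imm ha hy) hy ih
  | strictImm hx hk ih => exact .strictImm hx ih
  | strictSusp hx hr hk ih₁ ih => exact .strictSusp hx ih₁ ih

theorem Whnf.evolves (he : Evolves h h') {t : Term S}
    {c : Fin S.numCases} {val : Option S.Elem} {ts : Fin (S.arity c) → Term S} {f : Bool}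
    (hr : Whnf D h t c val ts f) : Whnf D h' t c val ts f := by
  cases hr with
  | addr ha hy => exact .addr (he.imm ha hy) hy
  | imm => exact .imm
  | susp hr => exact .susp (hr.evolves he)

end Evaluation

/-! ### Partial evaluations -/

/-- The state of a partial evaluation. -/
structure EvalState (S : TreeSig.{u, v}) : Type (max u v) where
  numVars : ℕ
  env : Fin numVars → Term S
  code : Code S numVars

/-- `EvalPath D h s₀ s l`: the evaluation from `s₀` gets in `l` instructions to `s`. -/
inductive EvalPath {S : TreeSig.{u, v}} (D : SeqDef S) (h : Heap S) (s₀ : EvalState S) :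
    EvalState S → ℕ → Prop where
  | nil : EvalPath D h s₀ s₀ 0
  | alloc {m : ℕ} {σ : Fin m → Term S} {x : Content S (Fin m)} {k : Code S (m + 1)} {l : ℕ}
      (hp : EvalPath D h s₀ ⟨m, σ, .alloc x k⟩ l) :
      EvalPath D h s₀ ⟨m + 1, Fin.snoc (α := fun _ => Term S) σ (x.toTerm D σ), k⟩ (l + 1)
  | lazy {m : ℕ} {σ : Fin m → Term S} {x : Fin m} {k : Bool → Code S m} {b : Bool} {l : ℕ}
      (hp : EvalPath D h s₀ ⟨m, σ, .readLazy x k⟩ l) (hx : (σ x).already h = some b) :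
      EvalPath D h s₀ ⟨m, σ, k b⟩ (l + 1)
  | strict {m : ℕ} {σ : Fin m → Term S} {x : Fin m}
      {k : (c : Fin S.numCases) → Option S.Elem → Bool → Code S (m + S.arity c)}
      {c : Fin S.numCases} {val : Option S.Elem} {ts : Fin (S.arity c) → Term S} {f : Bool} {l : ℕ}
      (hp : EvalPath D h s₀ ⟨m, σ, .readStrict x k⟩ l) (hx : Whnf D h (σ x) c val ts f) :
      EvalPath D h s₀ ⟨m + S.arity c, Fin.append σ ts, k c val f⟩ (l + 1)

section Path

variable {S : TreeSig.{u, v}} {D : SeqDef S} {h h' : Heap S} {s₀ s : EvalState S} {l : ℕ}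

theorem EvalPath.evolves (he : Evolves h h') (hp : EvalPath D h s₀ s l) : EvalPath D h' s₀ s l := by
  induction hp with
  | nil => exact .nil
  | alloc hp ih => exact .alloc ih
  | lazy hp hx ih => exact .lazy ih (he.already hx)
  | strict hp hx ih => exact .strict ih (hx.evolves he)

theorem EvalPath.run (hp : EvalPath D h s₀ s l)
    {c : Fin S.numCases} {val : Option S.Elem} {ts : Fin (S.arity c) → Term S}
    (hr : Run D h s.env s.code c val ts) : Run D h s₀.env s₀.code c val ts := by
  induction hp with
  | nil => exact hr
  | alloc hp ih => exact ih (.alloc hr)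
  | lazy hp hx ih => exact ih (.lazy hx hr)
  | strict hp hx ih => exact ih (.strict hx hr)

/-- Makes partial evaluations of the same task comparable by their length alone. -/
theorem EvalPath.deterministic (hp : EvalPath D h s₀ s l) :
    ∀ {s' : EvalState S}, EvalPath D h s₀ s' l → s = s' := by
  induction hp with
  | nil => intro s' hp'; cases hp'; rfl
  | alloc hp ih =>
    intro s' hp'
    cases hp' with
    | alloc hp' => cases ih hp'; rfl
    | lazy hp' hx' => cases ih hp'
    | strict hp' hx' => cases ih hp'
  | lazy hp hx ih =>
    intro s' hp'
    cases hp' with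
    | alloc hp' => cases ih hp'
    | lazy hp' hx' =>
      cases ih hp'
      rw [hx] at hx'
      cases hx'
      rfl
    | strict hp' hx' => cases ih hp'
  | strict hp hx ih =>
    intro s' hp'
    cases hp' with
    | alloc hp' => cases ih hp'
    | lazy hp' hx' => cases ih hp'
    | strict hp' hx' =>
      cases ih hp'
      obtain ⟨h1, rfl⟩ := hx.deterministic hx'
      cases h1
      rfl

/-- By determinism a longer path would have to pass through this state and execute its read. -/
theorem EvalPath.le_of_stuck {m : ℕ} {σ : Fin m → Term S} {x : Fin m}
    {k : (c : Fin S.numCases) → Option S.Elem → Bool → Code S (m + S.arity c)}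
    (hp : EvalPath D h s₀ ⟨m, σ, .readStrict x k⟩ l)
    (hstuck : ∀ c val ts f, ¬ Whnf D h (σ x) c val ts f) {s' : EvalState S} {l' : ℕ}
    (hp' : EvalPath D h s₀ s' l') : l' ≤ l := by
  induction hp' with
  | nil => exact Nat.zero_le _
  | alloc hp' ih =>
    rcases ih.lt_or_eq with h1 | rfl
    · exact h1
    · cases hp.deterministic hp'
  | lazy hp' hx ih =>
    rcases ih.lt_or_eq with h1 | rfl
    · exact h1
    · cases hp.deterministic hp'
  | strict hp' hx ih =>
    rcases ih.lt_or_eq with h1 | rfl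
    · exact h1
    · cases hp.deterministic hp'
      exact absurd hx (hstuck _ _ _ _)

end Path

/-! ### Cells that realise virtual nodes -/

/-- `Ref D Q h t a`: the cell `a` realises the virtual node `t`.  A cell that is not in `Q`
realises only itself. -/
inductive Ref {S : TreeSig.{u, v}} (D : SeqDef S) (Q : Set Addr) (h : Heap S) :
    Term S → Addr → Prop where
  | addr {a : Addr} : Ref D Q h (.addr a) a
  | susp {a : Addr} {cell : Cell S} {d : Deferred S Addr} {args : Fin d.arity → Term S}
      (hQ : a ∈ Q) (ha : h[a]? = some cell) (hd : cell.content = .deferred d)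
      (hc : ∀ i, Ref D Q h (args i) (d.env i)) :
      Ref D Q h (.susp (d.code D) d.isSnapshot args) a
  | whnf {t : Term S} {a : Addr} {cell : Cell S} {y : Imm S Addr}
      {ts : Fin (S.arity y.tag) → Term S}
      (hQ : a ∈ Q) (ha : h[a]? = some cell) (hy : cell.content = .imm y)
      (ht : Whnf D h t y.tag y.value ts cell.final)
      (hc : ∀ i, Ref D Q h (ts i) (y.children i)) : Ref D Q h t a

/-- The virtual node on the right arises from that on the left by replacing subterms by cells that
realise them. -/
inductive Refine {S : TreeSig.{u, v}} (D : SeqDef S) (Q : Set Addr) (h : Heap S) :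
    Term S → Term S → Prop where
  | addr {t : Term S} {a : Addr} (ht : Ref D Q h t a) : Refine D Q h t (.addr a)
  | imm {c : Fin S.numCases} {val : Option S.Elem} {ts ts' : Fin (S.arity c) → Term S}
      (hc : ∀ i, Refine D Q h (ts i) (ts' i)) : Refine D Q h (.imm c val ts) (.imm c val ts')
  | susp {m : ℕ} {code : Code S m} {snap : Bool} {ts ts' : Fin m → Term S}
      (hc : ∀ i, Refine D Q h (ts i) (ts' i)) :
      Refine D Q h (.susp code snap ts) (.susp code snap ts')

section Ref

variable {S : TreeSig.{u, v}} {D : SeqDef S} {h h' : Heap S} {Q Q' : Set Addr}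

theorem Ref.eq_addr {t : Term S} {a : Addr} (hr : Ref D Q h t a) (ha : a ∉ Q) : t = .addr a := by
  cases hr with
  | addr => rfl
  | susp hQ => exact absurd hQ ha
  | whnf hQ => exact absurd hQ ha

/-- Cells of `Q` that are unchanged still realise the same virtual nodes. -/
theorem Ref.evolves (he : Evolves h h')
    (hQ : ∀ a ∈ Q, ∀ cell, h[a]? = some cell → a ∈ Q' ∧ h'[a]? = some cell)
    {t : Term S} {a : Addr} (hr : Ref D Q h t a) : Ref D Q' h' t a := by
  induction hr with
  | addr => exact .addr
  | susp hQa ha hd hc ih =>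
    obtain ⟨h1, h2⟩ := hQ _ hQa _ ha
    exact .susp h1 h2 hd ih
  | whnf hQa ha hy ht hc ih =>
    obtain ⟨h1, h2⟩ := hQ _ hQa _ ha
    exact .whnf h1 h2 hy (ht.evolves he) ih

theorem Ref.mono (hQ : Q ⊆ Q') {t : Term S} {a : Addr} (hr : Ref D Q h t a) :
    Ref D Q' h t a :=
  hr.evolves (fun _ _ h1 => Or.inl h1) fun _ h1 _ h2 => ⟨hQ h1, h2⟩

theorem Ref.whnf_of_imm {t : Term S} {a : Addr} (hr : Ref D Q h t a) {cell : Cell S}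
    {y : Imm S Addr} (ha : h[a]? = some cell) (hy : cell.content = .imm y) :
    ∃ ts, Whnf D h t y.tag y.value ts cell.final ∧ ∀ i, Ref D Q h (ts i) (y.children i) := by
  cases hr with
  | addr => exact ⟨_, .addr ha hy, fun i => .addr⟩
  | susp hQ ha' hd hc =>
    rw [ha] at ha'
    cases ha'
    rw [hy] at hd
    cases hd
  | whnf hQ ha' hy' ht hc =>
    rw [ha] at ha'
    cases ha'
    rw [hy] at hy'
    cases hy'
    exact ⟨_, ht, hc⟩

theorem Ref.already {t : Term S} {a : Addr} (hr : Ref D Q h t a) {cell : Cell S}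
    (ha : h[a]? = some cell) : t.already h = some cell.alreadySnapshot := by
  cases hr with
  | addr => simp [Term.already, ha]
  | susp hQ ha' hd hc =>
    rw [ha] at ha'
    cases ha'
    simp [Term.already, Cell.alreadySnapshot, hd]
  | whnf hQ ha' hy' ht hc =>
    rw [ha] at ha'
    cases ha'
    rw [ht.already]
    simp [Cell.alreadySnapshot, hy']

theorem Refine.already {t t' : Term S} (hr : Refine D Q h t t') {b : Bool}
    (ht : t'.already h = some b) : t.already h = some b := by
  cases hr with
  | addr hr =>
    simp only [Term.already, Option.map_eq_some_iff] at ht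
    obtain ⟨cell, ha, rfl⟩ := ht
    exact hr.already ha
  | imm hc => exact ht
  | susp hc => exact ht

theorem forall_append {α : Type*} {β : Type*} {R : α → β → Prop} {m n : ℕ} {f : Fin m → α}
    {g : Fin n → α} {f' : Fin m → β} {g' : Fin n → β} (hf : ∀ i, R (f i) (f' i))
    (hg : ∀ i, R (g i) (g' i)) (i : Fin (m + n)) : R (Fin.append f g i) (Fin.append f' g' i) := by
  induction i using Fin.addCases with
  | left i => simpa using hf i
  | right i => simpa using hg i

theorem forall_snoc {α : Type*} {β : Type*} {R : α → β → Prop} {m : ℕ} {f : Fin m → α}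
    {a : α} {f' : Fin m → β} {b : β} (hf : ∀ i, R (f i) (f' i)) (hg : R a b) (i : Fin (m + 1)) :
    R (Fin.snoc (α := fun _ => α) f a i) (Fin.snoc (α := fun _ => β) f' b i) := by
  induction i using Fin.lastCases with
  | last => simpa using hg
  | cast i => simpa using hf i

theorem Refine.toTerm {m : ℕ} {x : Content S (Fin m)} {σ σ' : Fin m → Term S}
    (hσ : ∀ i, Refine D Q h (σ i) (σ' i)) : Refine D Q h (x.toTerm D σ) (x.toTerm D σ') := by
  cases x with
  | imm y => exact .imm fun i => hσ _
  | deferred d => exact .susp fun i => hσ _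

/-- A simulation: code cannot tell a cell from a virtual node that it realises. Where the given run
reads an immediate cell, the constructed one evaluates the term that this cell realises, with the
same constructor, value and finalized mark. -/
theorem Run.refine {m : ℕ} {σ' : Fin m → Term S} {code : Code S m}
    {c : Fin S.numCases} {val : Option S.Elem} {ts' : Fin (S.arity c) → Term S}
    (hr : Run D h σ' code c val ts') :
    ∀ {σ : Fin m → Term S}, (∀ i, Refine D Q h (σ i) (σ' i)) →
      ∃ ts, Run D h σ code c val ts ∧ ∀ i, Refine D Q h (ts i) (ts' i) := by
  induction hr with
  | ret => intro σ hσ; exact ⟨_, .ret, fun i => hσ _⟩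
  | alloc hk ih =>
    intro σ hσ
    obtain ⟨ts, h1, h2⟩ := ih (forall_snoc hσ (Refine.toTerm hσ))
    exact ⟨ts, .alloc h1, h2⟩
  | lazy hx hk ih =>
    intro σ hσ
    obtain ⟨ts, h1, h2⟩ := ih hσ
    exact ⟨ts, .lazy ((hσ _).already hx) h1, h2⟩
  | @strictAddr _ σ' x k _ _ _ _ _ _ hx ha hy hk ih =>
    intro σ hσ
    have h3 := hσ x
    rw [hx] at h3
    generalize ht : σ x = t at h3
    cases h3 with
    | addr hr =>
      obtain ⟨ts₁, h4, h5⟩ := hr.whnf_of_imm ha hy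
      obtain ⟨ts, h1, h2⟩ := ih (forall_append hσ fun i => .addr (h5 i))
      exact ⟨ts, .strict (ht ▸ h4) h1, h2⟩
  | @strictImm _ σ' x k _ _ _ _ _ _ hx hk ih =>
    intro σ hσ
    have h3 := hσ x
    rw [hx] at h3
    generalize ht : σ x = t at h3
    cases h3 with
    | imm hc =>
      obtain ⟨ts, h1, h2⟩ := ih (forall_append hσ hc)
      exact ⟨ts, .strictImm ht h1, h2⟩
  | @strictSusp _ σ' x k _ _ _ _ _ _ _ _ _ _ hx hr hk ih₁ ih =>
    intro σ hσ
    have h3 := hσ x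
    rw [hx] at h3
    generalize ht : σ x = t at h3
    cases h3 with
    | susp hc =>
      obtain ⟨ts₁, h4, h5⟩ := ih₁ hc
      obtain ⟨ts, h1, h2⟩ := ih (forall_append hσ h5)
      exact ⟨ts, .strictSusp ht h4 h1, h2⟩

theorem Whnf.refine {t t' : Term S}
    {c : Fin S.numCases} {val : Option S.Elem} {ts' : Fin (S.arity c) → Term S} {f : Bool}
    (hr : Whnf D h t' c val ts' f) (ht : Refine D Q h t t') :
    ∃ ts, Whnf D h t c val ts f ∧ ∀ i, Refine D Q h (ts i) (ts' i) := by
  cases hr with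
  | addr ha hy =>
    cases ht with
    | addr hr =>
      obtain ⟨ts, h1, h2⟩ := hr.whnf_of_imm ha hy
      exact ⟨ts, h1, fun i => .addr (h2 i)⟩
  | imm => cases ht with | imm hc => exact ⟨_, .imm, hc⟩
  | susp hr =>
    cases ht with
    | susp hc =>
      obtain ⟨ts, h1, h2⟩ := hr.refine hc
      exact ⟨ts, .susp h1, h2⟩

theorem Ref.refine {t' : Term S} {a : Addr} (hr : Ref D Q h t' a) :
    ∀ {t : Term S}, Refine D Q h t t' → Ref D Q h t a := by
  induction hr with
  | addr => intro t ht; cases ht with | addr hr => exact hr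
  | susp hQ ha hd hc ih =>
    intro t ht
    cases ht with
    | susp hc' => exact .susp hQ ha hd fun i => ih i (hc' i)
  | whnf hQ ha hy ht' hc ih =>
    intro t ht
    obtain ⟨ts, h1, h2⟩ := ht'.refine ht
    exact .whnf hQ ha hy h1 fun i => ih i (h2 i)

/-- The change of the heap by a successful SCX on `z`: the deferred node is replaced by the result
of its evaluation. -/
structure Resolves (D : SeqDef S) (Q : Set Addr) (h h' : Heap S) (z : Addr) (d : Deferred S Addr)
    (y : Imm S Addr) : Prop where
  evolves : Evolves h h'
  length : h'.length = h.length
  other : ∀ a, a ≠ z → h'[a]? = h[a]?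
  before : ∃ cell, h[z]? = some cell ∧ cell.content = .deferred d
  after : ∃ cell, h'[z]? = some cell ∧ cell.content = .imm y ∧ cell.final = d.isSnapshot ∧
    cell.version ≠ 0
  not_mem : z ∉ Q
  run : ∃ ts, Run D h (fun i => .addr (d.env i)) (d.code D) y.tag y.value ts ∧
    ∀ i, Ref D Q h (ts i) (y.children i)

/-- If `z` is outside `Q`, no cell of `Q` is touched. -/
theorem Resolves.ref_of_not_mem {z : Addr} {d : Deferred S Addr} {y : Imm S Addr} {Q₁ : Set Addr}
    (hs : Resolves D Q₁ h h' z d y) (hz : z ∉ Q) {t : Term S} {a : Addr} (hr : Ref D Q h t a) :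
    Ref D Q h' t a := by
  refine hr.evolves hs.evolves fun b hb cell hc => ⟨hb, ?_⟩
  rw [hs.other b (fun h1 => hz (h1 ▸ hb)), hc]

/-- The central invariance. If `z` itself realises a suspension, that suspension evaluates to a node
whose children are realised by the children just written. The cells used for this lie in `Q'`, which
explains the hypothesis `z ∈ Q → Q' ⊆ Q`. -/
theorem Resolves.ref {z : Addr} {d : Deferred S Addr} {y : Imm S Addr}
    (hs : Resolves D Q' h h' z d y) (hz : z ∈ Q → Q' ⊆ Q) {t : Term S} {a : Addr}
    (hr : Ref D Q h t a) : Ref D Q h' t a := by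
  induction hr with
  | addr => exact .addr
  | @susp a cell d' args hQ ha hd hc ih =>
    by_cases haz : a = z
    · subst haz
      obtain ⟨cell₀, h1, h2⟩ := hs.before
      rw [ha] at h1
      cases h1
      rw [hd] at h2
      cases h2
      obtain ⟨cell', h3, h4, h5, -⟩ := hs.after
      obtain ⟨ts, h6, h7⟩ := hs.run
      -- The SCX supplies a run on the addresses of the arguments; simulation transports it to the
      -- virtual arguments `args`.
      obtain ⟨ts', h8, h9⟩ := (h6.evolves hs.evolves).refine (Q := Q) (σ := args)
        fun i => .addr (ih i)
      refine .whnf hQ h3 h4 ?_ fun i =>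
        ((hs.ref_of_not_mem hs.not_mem (h7 i)).mono (hz hQ)).refine (h9 i)
      rw [h5]
      exact .susp h8
    · exact .susp hQ (by rw [hs.other a haz, ha]) hd ih
  | @whnf t a cell y ts hQ ha hy ht hc ih =>
    exact .whnf hQ (hs.evolves.imm ha hy) hy (ht.evolves hs.evolves) ih

end Ref

/-! ### Values, levels and the length of an execution -/

/-- The largest number of children of a node. -/
def maxArity (S : TreeSig.{u, v}) : ℕ := Finset.univ.sup S.arity

theorem arity_le_maxArity (S : TreeSig.{u, v}) (c : Fin S.numCases) : S.arity c ≤ maxArity S :=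
  Finset.le_sup (f := S.arity) (Finset.mem_univ c)

/-- The largest number of instructions in the code of a deferred node of level `M`. -/
def codeBound (S : TreeSig.{u, v}) (M : ℕ) : ℕ := M + 2 * maxArity S + 2

/-- The tree that a node stands for, with its level, which bounds the depth of nested forcing. -/
abbrev Value (S : TreeSig.{u, v}) : Type (max u v) := SeqTree S × ℕ

/-- `Sound D M e code r n`: with the variables bound to the values `e`, the code has at most `n`
instructions to execute, reads strictly only nodes of levels below `M`, and returns the tree `r`,
with children of levels at most `M`. -/
inductive Sound {S : TreeSig.{u, v}} (D : SeqDef S) :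
    ℕ → {m : ℕ} → (Fin m → Value S) → Code S m → SeqTree S → ℕ → Prop where
  | strict {M m : ℕ} {e : Fin m → Value S} {x : Fin m}
      {k : (c : Fin S.numCases) → Option S.Elem → Bool → Code S (m + S.arity c)}
      {c : Fin S.numCases} {val : Option S.Elem} {ts : Fin (S.arity c) → SeqTree S}
      {r : SeqTree S} {n : ℕ} (hx : (e x).1 = .node c val ts) (hl : (e x).2 < M)
      (hk : ∀ f, Sound D M (Fin.append e fun i => (ts i, (e x).2)) (k c val f) r n) :
      Sound D M e (.readStrict x k) r (n + 1)
  | lazy {M m : ℕ} {e : Fin m → Value S} {x : Fin m} {k : Bool → Code S m}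
      {r : SeqTree S} {n : ℕ} (hk : ∀ b, Sound D M e (k b) r n) :
      Sound D M e (.readLazy x k) r (n + 1)
  | allocImm {M m l : ℕ} {e : Fin m → Value S} {y : Imm S (Fin m)} {k : Code S (m + 1)}
      {r : SeqTree S} {n : ℕ} (hl : ∀ i, (e (y.children i)).2 ≤ l)
      (hk : Sound D M (Fin.snoc (α := fun _ => Value S) e
        (.node y.tag y.value fun i => (e (y.children i)).1, l)) k r n) :
      Sound D M e (.alloc (.imm y) k) r (n + 1)
  | allocDeferred {M m l : ℕ} {e : Fin m → Value S} {d : Deferred S (Fin m)} {k : Code S (m + 1)}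
      {r r₁ : SeqTree S} {n n₁ : ℕ}
      (hd : Sound D l (fun i => e (d.env i)) (d.code D) r₁ n₁) (hn : n₁ ≤ codeBound S l)
      (hk : Sound D M (Fin.snoc (α := fun _ => Value S) e (r₁, l)) k r n) :
      Sound D M e (.alloc (.deferred d) k) r (n + 1)
  | ret {M m : ℕ} {e : Fin m → Value S} {x : Imm S (Fin m)} {n : ℕ}
      (hl : ∀ i, (e (x.children i)).2 ≤ M) :
      Sound D M e (.ret x) (.node x.tag x.value fun i => (e (x.children i)).1) (n + 1)

/-! ### Levels of sequential code and of snapshots -/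

section Sound

variable {S : TreeSig.{u, v}} {D : SeqDef S}

theorem codeBound_mono {M M' : ℕ} (h : M ≤ M') : codeBound S M ≤ codeBound S M' := by
  unfold codeBound
  omega

theorem Sound.mono {M m n : ℕ} {e : Fin m → Value S} {code : Code S m} {r : SeqTree S}
    (hs : Sound D M e code r n) :
    ∀ {M' n' : ℕ}, M ≤ M' → n ≤ n' → Sound D M' e code r n' := by
  induction hs with
  | strict hx hl hk ih =>
    intro M' n' hM hn
    obtain ⟨n', rfl⟩ := Nat.exists_eq_add_of_le' (show 1 ≤ n' by omega)
    exact .strict hx (hl.trans_le hM) fun f => ih f hM (by omega)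
  | lazy hk ih =>
    intro M' n' hM hn
    obtain ⟨n', rfl⟩ := Nat.exists_eq_add_of_le' (show 1 ≤ n' by omega)
    exact .lazy fun b => ih b hM (by omega)
  | allocImm hl hk ih =>
    intro M' n' hM hn
    obtain ⟨n', rfl⟩ := Nat.exists_eq_add_of_le' (show 1 ≤ n' by omega)
    exact .allocImm hl (ih hM (by omega))
  | allocDeferred hd hn hk _ ih =>
    intro M' n' hM hn'
    obtain ⟨n', rfl⟩ := Nat.exists_eq_add_of_le' (show 1 ≤ n' by omega)
    exact .allocDeferred hd hn (ih hM (by omega))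
  | ret hl =>
    intro M' n' hM hn
    obtain ⟨n', rfl⟩ := Nat.exists_eq_add_of_le' (show 1 ≤ n' by omega)
    exact .ret fun i => (hl i).trans hM

theorem Sound.pos {M m n : ℕ} {e : Fin m → Value S} {code : Code S m} {r : SeqTree S}
    (hs : Sound D M e code r n) : 1 ≤ n := by
  cases hs <;> omega

theorem fst_append {m n : ℕ} (e : Fin m → Value S) (ts : Fin n → SeqTree S) (l : ℕ) :
    (fun i => (Fin.append e (fun i => (ts i, l)) i).1) = Fin.append (fun i => (e i).1) ts := by
  funext i
  induction i using Fin.addCases <;> simp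

theorem fst_snoc {m : ℕ} (e : Fin m → Value S) (t : SeqTree S) (l : ℕ) :
    (fun i => (Fin.snoc (α := fun _ => Value S) e (t, l) i).1) =
      Fin.snoc (α := fun _ => SeqTree S) (fun i => (e i).1) t := by
  funext i
  induction i using Fin.lastCases <;> simp

/-- Levels are sums of sequential costs. Time not yet spent pays for the higher levels of the
results of calls, so that every variable that is ever read stays below `M`. -/
theorem SeqRun.sound {m t : ℕ} {env : Fin m → SeqTree S} {b : Body S m} {r : SeqTree S}
    (hr : SeqRun D env b r t) :
    ∀ {e : Fin m → Value S} {L M : ℕ}, (fun i => (e i).1) = env → (∀ i, (e i).2 ≤ L) →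
      L + t + 1 ≤ M → Sound D M e b.transform r t := by
  induction hr with
  | @read m env x k c val ts r t hx hk ih =>
    intro e L M he hL hM
    subst he
    refine .strict hx ?_ fun f => ih (L := L) (fst_append _ _ _) ?_ (by omega)
    · have := hL x
      omega
    · intro i
      induction i using Fin.addCases <;> simp [hL]
  | @call m env j arg xs k r₁ r t₁ t hj hk ihj ih =>
    intro e L M he hL hM
    subst he
    -- A call of cost `t₁` on arguments of level at most `L` has level `L + t₁ + 1`. The rest then
    -- needs `(L + t₁ + 1) + t + 1 ≤ M`, which is exactly the hypothesis for the cost `t₁ + t + 1`.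
    refine .mono (.allocDeferred (l := L + t₁ + 1) (d := .op j arg xs) (r₁ := r₁) (n₁ := t₁)
      (ihj (L := L) rfl (fun i => hL _) le_rfl) (by unfold codeBound; omega)
      (ih (L := L + t₁ + 1) (M := M) (fst_snoc _ _ _) ?_ (by omega))) le_rfl (by omega)
    intro i
    induction i using Fin.lastCases with
    | last => simp
    | cast i =>
      have := hL i
      simp only [Fin.snoc_castSucc]
      omega
  | @build m env x k r t hk ih =>
    intro e L M he hL hM
    subst he
    refine .allocImm (l := L) (fun i => hL _) (ih (L := L) (fst_snoc _ _ _) ?_ (by omega))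
    intro i
    induction i using Fin.lastCases <;> simp [hL]
  | @ret m env x =>
    intro e L M he hL hM
    subst he
    exact .ret (n := 0) fun i => by have := hL (x.children i); omega

/-- Each listed child costs at most two instructions, a lazy read and an allocation. `Nodup`
guarantees that a variable replaced by a new snapshot is not treated again. -/
theorem Sound.snapshotChildren {c : Fin S.numCases} {val : Option S.Elem} {M : ℕ}
    {ts : Fin (S.arity c) → SeqTree S}
    (hsnap : ∀ i l, l < M → Sound D M (fun _ : Fin 1 => (ts i, l)) (snapshotCode S) (ts i)
      (codeBound S M)) (is : List (Fin (S.arity c))) :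
    ∀ {m : ℕ} {e : Fin m → Value S} {xs : Fin (S.arity c) → Fin m}, is.Nodup →
      (∀ i, (e (xs i)).1 = ts i) → (∀ i, (e (xs i)).2 ≤ M) → (∀ i ∈ is, (e (xs i)).2 < M) →
      Sound D M e (snapshotChildren c val is xs) (.node c val ts) (2 * is.length + 1) := by
  induction is with
  | nil =>
    intro m e xs _ he hM _
    have := Sound.ret (D := D) (M := M) (e := e) (x := ⟨c, val, xs⟩) (n := 0) hM
    simpa [_root_.snapshotChildren, he] using this
  | cons i is ih =>
    intro m e xs hnd he hM hlt
    rw [List.nodup_cons] at hnd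
    refine .lazy (n := 2 * is.length + 2) fun b => ?_
    cases b with
    | true =>
      exact (ih hnd.2 he hM fun j hj => hlt j (List.mem_cons_of_mem _ hj)).mono le_rfl (by omega)
    | false =>
      -- The new snapshot has the full level `M`, since it will force a child of level below `M`.
      -- This is allowed because it is only returned and not read strictly here.
      refine .allocDeferred (d := .snapshot (xs i)) (l := M) (r₁ := ts i) (n₁ := codeBound S M)
        ?_ le_rfl (ih hnd.2 ?_ ?_ ?_)
      · have := hsnap i (e (xs i)).2 (hlt i List.mem_cons_self)
        rw [← he i] at this ⊢
        exact this
      · intro j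
        by_cases hj : j = i
        · subst hj; simp
        · simp [Function.update_of_ne hj, he]
      · intro j
        by_cases hj : j = i
        · subst hj; simp
        · simp [Function.update_of_ne hj, hM]
      · intro j hjs
        have hj : j ≠ i := fun h1 => hnd.1 (h1 ▸ hjs)
        simpa [Function.update_of_ne hj] using hlt j (List.mem_cons_of_mem _ hjs)

/-- Snapshots create further snapshots at the same level, so the induction is on the tree and not on
the level. The `2 * maxArity + 2` in `codeBound` comes from here: one strict read, two instructions
per child, one `ret`. -/
theorem Sound.snapshotCode {M : ℕ} (r : SeqTree S) :
    ∀ l < M, Sound D M (fun _ : Fin 1 => (r, l)) (snapshotCode S) r (codeBound S M) := by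
  induction r with
  | node c val ts ih =>
    intro l hl
    have hA := arity_le_maxArity S c
    refine .mono (.strict (n := 2 * S.arity c + 1) rfl hl fun f => ?_) le_rfl
      (by unfold codeBound; omega)
    cases f with
    | true =>
      have := Sound.ret (D := D) (M := M)
        (e := Fin.append (fun _ : Fin 1 => ((SeqTree.node c val ts, l) : Value S))
          fun i => (ts i, l)) (x := ⟨c, val, fun i => Fin.natAdd 1 i⟩) (n := 2 * S.arity c)
        (fun i => by simpa using hl.le)
      simpa using this
    | false =>
      have := Sound.snapshotChildren (D := D) (val := val) (M := M) ih
        (List.finRange (S.arity c)) (m := 1 + S.arity c)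
        (e := Fin.append (fun _ : Fin 1 => ((SeqTree.node c val ts, l) : Value S))
          fun i => (ts i, l)) (xs := fun i => Fin.natAdd 1 i) (List.nodup_finRange _)
        (fun i => by simp) (fun i => by simpa using hl.le) (fun i _ => by simpa using hl)
      simpa using this

end Sound

/-- `Denotes D h t r M`: the virtual node `t` stands for the tree `r`, at level `M`. -/
inductive Denotes {S : TreeSig.{u, v}} (D : SeqDef S) (h : Heap S) :
    Term S → SeqTree S → ℕ → Prop where
  | addrImm {a : Addr} {cell : Cell S} {y : Imm S Addr} {ts : Fin (S.arity y.tag) → SeqTree S}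
      {M : ℕ} (ha : h[a]? = some cell) (hy : cell.content = .imm y)
      (hc : ∀ i, Denotes D h (.addr (y.children i)) (ts i) M) :
      Denotes D h (.addr a) (.node y.tag y.value ts) M
  | addrDeferred {a : Addr} {cell : Cell S} {d : Deferred S Addr} {e : Fin d.arity → Value S}
      {r : SeqTree S} {n M : ℕ} (ha : h[a]? = some cell) (hd : cell.content = .deferred d)
      (hc : ∀ i, Denotes D h (.addr (d.env i)) (e i).1 (e i).2)
      (hs : Sound D M e (d.code D) r n) (hn : n ≤ codeBound S M) :
      Denotes D h (.addr a) r M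
  | imm {c : Fin S.numCases} {val : Option S.Elem} {args : Fin (S.arity c) → Term S}
      {ts : Fin (S.arity c) → SeqTree S} {M : ℕ} (hc : ∀ i, Denotes D h (args i) (ts i) M) :
      Denotes D h (.imm c val args) (.node c val ts) M
  | susp {m : ℕ} {code : Code S m} {snap : Bool} {args : Fin m → Term S} {e : Fin m → Value S}
      {r : SeqTree S} {n M : ℕ} (hc : ∀ i, Denotes D h (args i) (e i).1 (e i).2)
      (hs : Sound D M e code r n) (hn : n ≤ codeBound S M) :
      Denotes D h (.susp code snap args) r M

/-! ### Preservation of trees and levels by evaluation and forcing -/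

section Denotes

variable {S : TreeSig.{u, v}} {D : SeqDef S} {h h' : Heap S}

theorem Denotes.mono {t : Term S} {r : SeqTree S} {M : ℕ} (hd : Denotes D h t r M) :
    ∀ {M' : ℕ}, M ≤ M' → Denotes D h t r M' := by
  induction hd with
  | addrImm ha hy hc ih => exact fun hM => .addrImm ha hy fun i => ih i hM
  | addrDeferred ha hd hc hs hn ih =>
    exact fun hM => .addrDeferred ha hd hc (hs.mono hM le_rfl) (hn.trans (codeBound_mono hM))
  | imm hc ih => exact fun hM => .imm fun i => ih i hM
  | susp hc hs hn ih =>
    exact fun hM => .susp hc (hs.mono hM le_rfl) (hn.trans (codeBound_mono hM))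

theorem Denotes.imm_inv {a : Addr} {cell : Cell S} {y : Imm S Addr} {r : SeqTree S} {M : ℕ}
    (hd : Denotes D h (.addr a) r M) (ha : h[a]? = some cell) (hy : cell.content = .imm y) :
    ∃ ts, r = .node y.tag y.value ts ∧ ∀ i, Denotes D h (.addr (y.children i)) (ts i) M := by
  cases hd with
  | addrImm ha' hy' hc =>
    rw [ha] at ha'
    cases ha'
    rw [hy] at hy'
    cases hy'
    exact ⟨_, rfl, hc⟩
  | addrDeferred ha' hd hc hs hn =>
    rw [ha] at ha'
    cases ha'
    rw [hy] at hd
    cases hd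

/-- The deferred node `d` is suitable to be forced at level `M`. -/
def TaskSound (D : SeqDef S) (h : Heap S) (d : Deferred S Addr) (M : ℕ) : Prop :=
  ∃ (e : Fin d.arity → Value S) (r : SeqTree S) (n : ℕ),
    (∀ i, Denotes D h (.addr (d.env i)) (e i).1 (e i).2) ∧
      Sound D M e (d.code D) r n ∧ n ≤ codeBound S M

theorem Denotes.taskSound {a : Addr} {cell : Cell S} {d : Deferred S Addr} {r : SeqTree S}
    {M : ℕ} (hd : Denotes D h (.addr a) r M) (ha : h[a]? = some cell)
    (hc : cell.content = .deferred d) : TaskSound D h d M := by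
  cases hd with
  | addrImm ha' hy' hc' =>
    rw [ha] at ha'
    cases ha'
    rw [hc] at hy'
    cases hy'
  | addrDeferred ha' hd hc' hs hn =>
    rw [ha] at ha'
    cases ha'
    rw [hc] at hd
    cases hd
    exact ⟨_, _, _, hc', hs, hn⟩

/-- The total sequential cost itself serves as the level: each argument costs at most the sum of all
arguments, which is below the cost of the node. -/
theorem SeqCost.denotes {a : Addr} {r : SeqTree S} {T : ℕ} (hs : SeqCost D h a r T) :
    Denotes D h (.addr a) r T := by
  induction hs with
  | imm ha hy hc ih =>
    exact .addrImm ha hy fun i => (ih i).mono (Finset.single_le_sum (fun _ _ => Nat.zero_le _)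
      (Finset.mem_univ i))
  | @op a cell j arg ch ts τ r t ha hd hc hr ih =>
    exact .addrDeferred (d := .op j arg ch) (e := fun i => (ts i, τ i)) ha hd ih
      (hr.sound (L := ∑ i, τ i) rfl (fun i => Finset.single_le_sum (f := τ)
        (fun _ _ => Nat.zero_le _) (Finset.mem_univ i)) le_rfl)
      (by unfold codeBound; omega)
  | @snapshot a b cell r t ha hd hb ih =>
    exact .addrDeferred (d := .snapshot b) (e := fun _ => (r, t)) ha hd (fun _ => ih)
      (Sound.snapshotCode r t (Nat.lt_succ_self t)) le_rfl

theorem Denotes.snoc {m : ℕ} {σ : Fin m → Term S} {e : Fin m → Value S} {t : Term S}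
    {w : Value S} (hσ : ∀ i, Denotes D h (σ i) (e i).1 (e i).2)
    (ht : Denotes D h t w.1 w.2) (i : Fin (m + 1)) :
    Denotes D h (Fin.snoc (α := fun _ => Term S) σ t i)
      (Fin.snoc (α := fun _ => Value S) e w i).1 (Fin.snoc (α := fun _ => Value S) e w i).2 :=
  forall_snoc (R := fun t (w : Value S) => Denotes D h t w.1 w.2) hσ ht i

theorem Denotes.append {m n l : ℕ} {σ : Fin m → Term S} {e : Fin m → Value S}
    {τ : Fin n → Term S} {ts : Fin n → SeqTree S}
    (hσ : ∀ i, Denotes D h (σ i) (e i).1 (e i).2)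
    (ht : ∀ i, Denotes D h (τ i) (ts i) l) (i : Fin (m + n)) :
    Denotes D h (Fin.append σ τ i) (Fin.append e (fun i => (ts i, l)) i).1
      (Fin.append e (fun i => (ts i, l)) i).2 :=
  forall_append (R := fun t (w : Value S) => Denotes D h t w.1 w.2) hσ ht i

/-- Subject reduction: the derivations of `Run` and `Sound` are followed in parallel, and a nested
evaluation uses the soundness stored with its suspension. -/
theorem Run.denotes {m : ℕ} {σ : Fin m → Term S} {code : Code S m}
    {c : Fin S.numCases} {val : Option S.Elem} {ts : Fin (S.arity c) → Term S}
    (hr : Run D h σ code c val ts) :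
    ∀ {M n : ℕ} {e : Fin m → Value S} {r : SeqTree S},
      (∀ i, Denotes D h (σ i) (e i).1 (e i).2) → Sound D M e code r n →
      ∃ rs, r = .node c val rs ∧ ∀ i, Denotes D h (ts i) (rs i) M := by
  induction hr with
  | ret =>
    intro M n e r he hs
    cases hs with
    | ret hl => exact ⟨_, rfl, fun i => (he _).mono (hl i)⟩
  | alloc hk ih =>
    intro M n e r he hs
    cases hs with
    | allocImm hl hk' =>
      refine ih (Denotes.snoc he ?_) hk'
      exact .imm fun i => (he _).mono (hl i)
    | allocDeferred hd hn hk' =>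
      refine ih (Denotes.snoc he ?_) hk'
      exact .susp (fun i => he _) hd hn
  | lazy hx hk ih =>
    intro M n e r he hs
    cases hs with
    | lazy hk' => exact ih he (hk' _)
  | @strictAddr _ σ x _ _ _ _ _ _ _ hx ha hy hk ih =>
    intro M n e r he hs
    cases hs with
    | strict hx' hl hk' =>
      have h1 := he x
      rw [hx] at h1
      obtain ⟨ts₁, h2, h3⟩ := h1.imm_inv ha hy
      rw [hx'] at h2
      cases h2
      exact ih (Denotes.append he h3) (hk' _)
  | @strictImm _ σ x _ _ _ _ _ _ _ hx hk ih =>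
    intro M n e r he hs
    cases hs with
    | strict hx' hl hk' =>
      have h1 := he x
      rw [hx, hx'] at h1
      cases h1 with
      | imm hc => exact ih (Denotes.append he hc) (hk' _)
  | @strictSusp _ σ x _ _ _ _ _ _ _ _ _ _ _ hx hr hk ih₁ ih =>
    intro M n e r he hs
    cases hs with
    | strict hx' hl hk' =>
      have h1 := he x
      rw [hx, hx'] at h1
      generalize (e x).2 = l at h1 hk'
      cases h1 with
      | susp hc hs₁ hn =>
        obtain ⟨rs, h2, h3⟩ := ih₁ hc hs₁
        cases h2
        exact ih (Denotes.append he h3) (hk' _)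

theorem Whnf.denotes {t : Term S}
    {c : Fin S.numCases} {val : Option S.Elem} {ts : Fin (S.arity c) → Term S} {f : Bool}
    (hr : Whnf D h t c val ts f) {r : SeqTree S} {M : ℕ} (ht : Denotes D h t r M) :
    ∃ rs, r = .node c val rs ∧ ∀ i, Denotes D h (ts i) (rs i) M := by
  cases hr with
  | addr ha hy => exact ht.imm_inv ha hy
  | imm => cases ht with | imm hc => exact ⟨_, rfl, hc⟩
  | susp hr => cases ht with | susp hc hs hn => exact hr.denotes hc hs

theorem Ref.denotes {Q : Set Addr} {t : Term S} {a : Addr} (hr : Ref D Q h t a) :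
    ∀ {r : SeqTree S} {M : ℕ}, Denotes D h t r M → Denotes D h (.addr a) r M := by
  induction hr with
  | addr => exact fun ht => ht
  | susp hQ ha hd hc ih =>
    intro r M ht
    cases ht with
    | susp hc' hs hn => exact .addrDeferred ha hd (fun i => ih i (hc' i)) hs hn
  | whnf hQ ha hy ht' hc ih =>
    intro r M ht
    obtain ⟨rs, rfl, h1⟩ := ht'.denotes ht
    exact .addrImm ha hy fun i => ih i (h1 i)

theorem Denotes.of_extends (he : ∀ (a : Addr) (cell : Cell S), h[a]? = some cell → h'[a]? = some cell)
    {t : Term S} {r : SeqTree S} {M : ℕ} (hd : Denotes D h t r M) : Denotes D h' t r M := by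
  induction hd with
  | addrImm ha hy hc ih => exact .addrImm (he _ _ ha) hy ih
  | addrDeferred ha hd hc hs hn ih => exact .addrDeferred (he _ _ ha) hd ih hs hn
  | imm hc ih => exact .imm ih
  | susp hc hs hn ih => exact .susp ih hs hn

/-- Forcing by any thread preserves meaning and level: the cell written contains a result of
evaluating the task, and `Run.denotes` and `Ref.denotes` carry the tree and level over to its
children. -/
theorem Resolves.denotes {Q : Set Addr} {z : Addr} {d : Deferred S Addr} {y : Imm S Addr}
    (hs : Resolves D Q h h' z d y) {t : Term S} {r : SeqTree S} {M : ℕ}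
    (hd : Denotes D h t r M) : Denotes D h' t r M := by
  induction hd with
  | addrImm ha hy hc ih => exact .addrImm (hs.evolves.imm ha hy) hy ih
  | @addrDeferred a cell d' e r n M ha hd hc hs' hn ih =>
    by_cases haz : a = z
    · subst haz
      obtain ⟨cell₀, h1, h2⟩ := hs.before
      rw [ha] at h1
      cases h1
      rw [hd] at h2
      cases h2
      obtain ⟨cell', h3, h4, -⟩ := hs.after
      obtain ⟨ts, h6, h7⟩ := hs.run
      obtain ⟨rs, rfl, h8⟩ := (h6.evolves hs.evolves).denotes ih hs'
      exact .addrImm h3 h4 fun i => (hs.ref_of_not_mem hs.not_mem (h7 i)).denotes (h8 i)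
    · exact .addrDeferred (by rw [hs.other a haz, ha]) hd ih hs' hn
  | imm hc ih => exact .imm ih
  | susp hc hs hn ih => exact .susp ih hs hn

theorem TaskSound.of_denotes
    (hD : ∀ (t : Term S) (r : SeqTree S) (M : ℕ), Denotes D h t r M → Denotes D h' t r M)
    {d : Deferred S Addr} {M : ℕ} (ht : TaskSound D h d M) : TaskSound D h' d M := by
  obtain ⟨e, r, n, h1, h2⟩ := ht
  exact ⟨e, r, n, fun i => hD _ _ _ (h1 i), h2⟩

end Denotes

/-! ### Activations of `force` and the evaluations that they follow -/

section Follows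

variable {S : TreeSig.{u, v}} {D : SeqDef S} {h h' : Heap S}

/-- The start of the evaluation of a deferred node. -/
def Deferred.evalState (D : SeqDef S) (d : Deferred S Addr) : EvalState S :=
  ⟨d.arity, fun i => .addr (d.env i), d.code D⟩

/-- An execution of `apply` for `d` has executed `l` instructions, and it has got, up to the
identity of the new nodes, to the same point as the evaluation of `d` on virtual nodes. -/
def Follows (D : SeqDef S) (Q : Set Addr) (h : Heap S) (d : Deferred S Addr) {m : ℕ}
    (env : Fin m → Addr) (code : Code S m) (l : ℕ) : Prop :=
  ∃ σ, EvalPath D h (d.evalState D) ⟨m, σ, code⟩ l ∧ ∀ i, Ref D Q h (σ i) (env i)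

variable {Q Q' : Set Addr} {d : Deferred S Addr} {m l : ℕ} {env : Fin m → Addr}

theorem Follows.init : Follows D Q h d d.env (d.code D) 0 :=
  ⟨_, .nil, fun _ => .addr⟩

theorem Follows.trans {code : Code S m} (he : Evolves h h')
    (hr : ∀ (t : Term S) (a : Addr), Ref D Q h t a → Ref D Q' h' t a)
    (hf : Follows D Q h d env code l) : Follows D Q' h' d env code l := by
  obtain ⟨σ, h1, h2⟩ := hf
  exact ⟨σ, h1.evolves he, fun i => hr _ _ (h2 i)⟩

theorem Follows.strict {x : Fin m}
    {k : (c : Fin S.numCases) → Option S.Elem → Bool → Code S (m + S.arity c)}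
    (hf : Follows D Q h d env (.readStrict x k) l) {cell : Cell S} {y : Imm S Addr}
    (hx : h[env x]? = some cell) (hy : cell.content = .imm y) :
    Follows D Q h d (Fin.append env y.children) (k y.tag y.value cell.final) (l + 1) := by
  obtain ⟨σ, h1, h2⟩ := hf
  obtain ⟨ts, h3, h4⟩ := (h2 x).whnf_of_imm hx hy
  exact ⟨_, h1.strict h3, forall_append h2 h4⟩

theorem Follows.lazy {x : Fin m} {k : Bool → Code S m}
    (hf : Follows D Q h d env (.readLazy x k) l) {cell : Cell S} (hx : h[env x]? = some cell) :
    Follows D Q h d env (k cell.alreadySnapshot) (l + 1) := by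
  obtain ⟨σ, h1, h2⟩ := hf
  exact ⟨_, h1.lazy ((h2 x).already hx), h2⟩

theorem Evolves.refl (h : Heap S) : Evolves h h := fun _ _ h1 => Or.inl h1

theorem getElem?_append_fresh (c : Cell S) {a : Addr} {cell : Cell S} (ha : h[a]? = some cell) :
    (h ++ [c])[a]? = some cell := by
  rw [List.getElem?_append_left, ha]
  exact (List.getElem?_eq_some_iff.1 ha).1

theorem Evolves.append (h : Heap S) (c : Cell S) : Evolves h (h ++ [c]) :=
  fun _ _ h1 => Or.inl (getElem?_append_fresh c h1)

theorem lt_length_of_getElem? {a : Addr} {cell : Cell S} (ha : h[a]? = some cell) :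
    a < h.length :=
  (List.getElem?_eq_some_iff.1 ha).1

theorem Ref.append {t : Term S} {a : Addr} {c : Cell S} (hr : Ref D Q h t a)
    (hQ : ∀ b < h.length, b ∈ Q → b ∈ Q') : Ref D Q' (h ++ [c]) t a :=
  hr.evolves (.append h c) fun b hb _ hc =>
    ⟨hQ b (lt_length_of_getElem? hc) hb, getElem?_append_fresh c hc⟩

theorem Ref.fresh {Q : Set Addr} {h : Heap S} {m : ℕ} {σ : Fin m → Term S} {env : Fin m → Addr}
    (x : Content S (Fin m)) (hx : h[h.length - 1]? = some (Cell.fresh (x.map env)))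
    (hQ : h.length - 1 ∈ Q) (hr : ∀ i, Ref D Q h (σ i) (env i)) :
    Ref D Q h (x.toTerm D σ) (h.length - 1) := by
  cases x with
  | imm y =>
    exact .whnf (y := y.map env) hQ hx rfl .imm fun i => hr _
  | deferred d =>
    cases d with
    | op j arg ch => exact .susp (d := .op j arg fun i => env (ch i)) hQ hx rfl fun i => hr _
    | snapshot c => exact .susp (d := .snapshot (env c)) hQ hx rfl fun i => hr _

/-- The virtual evaluation binds a term where the execution binds the new cell. Hence the new
address must enter `Q'`, for cells outside realise only themselves. -/
theorem Follows.alloc {x : Content S (Fin m)} {k : Code S (m + 1)}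
    (hf : Follows D Q h d env (.alloc x k) l) (hQ : ∀ b < h.length, b ∈ Q → b ∈ Q')
    (hnew : h.length ∈ Q') :
    Follows D Q' (h ++ [Cell.fresh (x.map env)]) d
      (Fin.snoc (α := fun _ => Addr) env h.length) k (l + 1) := by
  obtain ⟨σ, h1, h2⟩ := hf
  have h3 : ∀ i, Ref D Q' (h ++ [Cell.fresh (x.map env)]) (σ i) (env i) :=
    fun i => (h2 i).append hQ
  refine ⟨_, (h1.evolves (.append h (Cell.fresh (x.map env)))).alloc, forall_snoc h3 ?_⟩
  have := Ref.fresh (Q := Q') x (h := h ++ [Cell.fresh (x.map env)]) (σ := σ) (env := env)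
    (by simp) (by simpa using hnew) h3
  simpa using this

theorem Follows.run {x : Imm S (Fin m)} (hf : Follows D Q h d env (.ret x) l) :
    ∃ ts, Run D h (fun i => .addr (d.env i)) (d.code D) x.tag x.value ts ∧
      ∀ i, Ref D Q h (ts i) (env (x.children i)) := by
  obtain ⟨σ, h1, h2⟩ := hf
  exact ⟨_, h1.run (.ret (x := x)), fun i => h2 _⟩

theorem Follows.resolves {x : Imm S (Fin m)} (hf : Follows D Q h d env (.ret x) l)
    {a : Addr} {cell : Cell S} (ha : h[a]? = some cell) (hd : cell.content = .deferred d)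
    (hQ : a ∉ Q) :
    Resolves D Q h (h.set a ⟨.imm (x.map env), d.isSnapshot, cell.version + 1⟩) a d
      (x.map env) where
  evolves := by
    intro b cell' hb
    by_cases hab : a = b
    · subst hab
      rw [ha] at hb
      cases hb
      refine Or.inr ⟨d, hd, ⟨.imm (x.map env), d.isSnapshot, cell.version + 1⟩, x.map env, ?_,
        rfl, rfl, rfl⟩
      rw [List.getElem?_set_self (lt_length_of_getElem? ha)]
    · left
      rw [List.getElem?_set_ne hab, hb]
  length := List.length_set
  other := fun b hb => List.getElem?_set_ne (Ne.symm hb)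
  before := ⟨cell, ha, hd⟩
  after := ⟨⟨.imm (x.map env), d.isSnapshot, cell.version + 1⟩,
    List.getElem?_set_self (lt_length_of_getElem? ha), rfl, rfl, Nat.succ_ne_zero _⟩
  not_mem := hQ
  run := hf.run

end Follows

/-! ### The invariant of all threads -/

section Invariant

variable {S : TreeSig.{u, v}} {D : SeqDef S} {h h' : Heap S}

/-- The variable that is read by the instruction at the head of the code. -/
def Code.readVar : {m : ℕ} → Code S m → Option (Fin m)
  | _, .readStrict x _ => some x
  | _, .readLazy x _ => some x
  | _, .alloc _ _ => none
  | _, .ret _ => none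

def Phase.refs : Phase S → Set Addr
  | .start => ∅
  | .rootLLX _ => ∅
  | .run _ env _ => Set.range env
  | .childLLX _ env _ _ => Set.range env

/-- The cells that an activation knows, apart from the one that it forces. -/
def Frame.refs (fr : Frame S) : Set Addr :=
  Set.range fr.task.env ∪ fr.phase.refs

/-- `ord` shows that the heap is acyclic, and deferred cells were never modified. -/
structure HeapOK (ord : Addr → ℚ) (h : Heap S) : Prop where
  refs : ∀ (a : Addr) (cell : Cell S), h[a]? = some cell →
    ∀ b ∈ cell.content.refs, b < h.length ∧ ord b < ord a
  unmodified : ∀ (a : Addr) (cell : Cell S) (d : Deferred S Addr), h[a]? = some cell →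
    cell.content = .deferred d → cell.version = 0 ∧ cell.final = false

/-- The entry `(a, 0)` makes an SCX with a valid read-set hit a cell that was never modified. The
set of cells of smaller rank than `a` is a coarse substitute for the private cells, available for
every thread without ghost data. -/
def PhaseOK (D : SeqDef S) (ord : Addr → ℚ) (h : Heap S) (a : Addr) (d : Deferred S Addr) :
    Phase S → Prop
  | .start => True
  | .rootLLX _ => True
  | .run R env code => (a, 0) ∈ R ∧ ∃ l, Follows D {b | ord b < ord a} h d env code l
  | .childLLX R env code _ =>
    (a, 0) ∈ R ∧ (∃ l, Follows D {b | ord b < ord a} h d env code l) ∧ code.readVar.isSome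

/-- The nonzero version in the second alternative is what contradicts an entry `(a, 0)` once the
node has been forced. All known cells rank below `addr`, so writing a result there creates no cycle.
-/
structure FrameOK (D : SeqDef S) (ord : Addr → ℚ) (h : Heap S) (fr : Frame S) : Prop where
  cell : ∃ cell, h[fr.addr]? = some cell ∧
    (cell.content = .deferred fr.task ∨ (∃ y, cell.content = .imm y) ∧ cell.version ≠ 0)
  refs : ∀ b ∈ fr.refs, b < h.length ∧ ord b < ord fr.addr
  phase : PhaseOK D ord h fr.addr fr.task fr.phase

variable {ord ord' : Addr → ℚ}

theorem FrameOK.lt_length {fr : Frame S} (hf : FrameOK D ord h fr) : fr.addr < h.length := by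
  obtain ⟨cell, h1, -⟩ := hf.cell
  exact lt_length_of_getElem? h1

theorem FrameOK.restart {fr : Frame S} (hf : FrameOK D ord h fr) :
    FrameOK D ord h ⟨fr.addr, fr.task, .start⟩ :=
  ⟨hf.cell, fun b hb => hf.refs b (hb.elim Or.inl False.elim), trivial⟩

theorem FrameOK.trans (he : Evolves h h') (hl : h.length ≤ h'.length)
    (ho : ∀ b < h.length, ord' b = ord b)
    (hr : ∀ a < h.length, ∀ (t : Term S) (b : Addr), Ref D {b | ord b < ord a} h t b →
      Ref D {b | ord' b < ord' a} h' t b)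
    {fr : Frame S} (hf : FrameOK D ord h fr) : FrameOK D ord' h' fr := by
  have ha := hf.lt_length
  obtain ⟨⟨cell, h1, h2⟩, h3, h4⟩ := hf
  refine ⟨?_, fun b hb => ⟨(h3 b hb).1.trans_le hl, ?_⟩, ?_⟩
  · rcases he _ _ h1 with h5 | ⟨d, h5, cell', y, h6, h7, h8, h9⟩
    · exact ⟨cell, h5, h2⟩
    · exact ⟨cell', h6, Or.inr ⟨⟨y, h7⟩, by omega⟩⟩
  · rw [ho b (h3 b hb).1, ho _ ha]
    exact (h3 b hb).2
  · generalize hph : fr.phase = ph at h4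
    cases ph with
    | start => trivial
    | rootLLX w => trivial
    | run R env code =>
      obtain ⟨h5, l, h6⟩ := h4
      exact ⟨h5, l, h6.trans he (hr _ ha)⟩
    | childLLX R env code w =>
      obtain ⟨h5, ⟨l, h6⟩, h7⟩ := h4
      exact ⟨h5, ⟨l, h6.trans he (hr _ ha)⟩, h7⟩

theorem FrameOK.of_append {c : Cell S} (ho : ∀ b < h.length, ord' b = ord b)
    {fr : Frame S} (hf : FrameOK D ord h fr) : FrameOK D ord' (h ++ [c]) fr := by
  refine hf.trans (.append h c) (by simp) ho fun a ha t b hr => hr.append fun x hx hxa => ?_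
  simp only [Set.mem_ofPred_eq] at hxa ⊢
  rwa [ho x hx, ho a ha]

theorem FrameOK.of_resolves {z : Addr} {d : Deferred S Addr} {y : Imm S Addr}
    (hs : Resolves D {b | ord b < ord z} h h' z d y)
    {fr : Frame S} (hf : FrameOK D ord h fr) : FrameOK D ord h' fr :=
  hf.trans hs.evolves hs.length.ge (fun _ _ => rfl) fun _ _ _ _ hr =>
    hs.ref (fun hz b (hb : ord b < ord z) => lt_trans hb hz) hr

theorem HeapOK.of_append {x : Content S Addr} (hh : HeapOK ord h)
    (ho : ∀ b < h.length, ord' b = ord b)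
    (hx : ∀ b ∈ x.refs, b < h.length ∧ ord b < ord' h.length) :
    HeapOK ord' (h ++ [Cell.fresh x]) where
  refs := by
    intro a cell ha b hb
    rw [List.getElem?_append] at ha
    split at ha
    next hlt =>
      obtain ⟨h1, h2⟩ := hh.refs a cell ha b hb
      rw [ho b h1, ho a hlt]
      exact ⟨h1.trans_le (by simp), h2⟩
    next hlt =>
      rw [List.getElem?_singleton] at ha
      split at ha
      next h0 =>
        obtain rfl : a = h.length := le_antisymm (Nat.le_of_sub_eq_zero h0) (not_lt.1 hlt)
        cases ha
        obtain ⟨h1, h2⟩ := hx b hb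
        rw [ho b h1]
        exact ⟨h1.trans_le (by simp), h2⟩
      next => cases ha
  unmodified := by
    intro a cell d ha hd
    rw [List.getElem?_append] at ha
    split at ha
    next hlt => exact hh.unmodified a cell d ha hd
    next hlt =>
      rw [List.getElem?_singleton] at ha
      split at ha
      next h0 => cases ha; exact ⟨rfl, rfl⟩
      next => cases ha

theorem HeapOK.of_resolves {Q : Set Addr} {z : Addr} {d : Deferred S Addr} {y : Imm S Addr}
    (hh : HeapOK ord h) (hs : Resolves D Q h h' z d y)
    (hy : ∀ i, y.children i < h.length ∧ ord (y.children i) < ord z) : HeapOK ord h' where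
  refs := by
    intro a cell ha b hb
    rw [hs.length]
    by_cases haz : a = z
    · subst haz
      obtain ⟨cell', h1, h2, -⟩ := hs.after
      rw [ha] at h1
      cases h1
      rw [h2] at hb
      obtain ⟨i, rfl⟩ := hb
      exact hy i
    · rw [hs.other a haz] at ha
      exact hh.refs a cell ha b hb
  unmodified := by
    intro a cell d' ha hd
    by_cases haz : a = z
    · subst haz
      obtain ⟨cell', h1, h2, -⟩ := hs.after
      rw [ha] at h1
      cases h1
      rw [h2] at hd
      cases hd
    · rw [hs.other a haz] at ha
      exact hh.unmodified a cell d' ha hd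

/-- Density is the reason for rational ranks: a cell allocated while forcing `a` must fit between
its children and `a` without changing existing ranks. -/
theorem exists_rat_between {m : ℕ} {f : Fin m → ℚ} {q : ℚ} (hf : ∀ i, f i < q) :
    ∃ r, (∀ i, f i < r) ∧ r < q := by
  have h1 : ∀ᶠ r in nhdsWithin q (Set.Iio q), ∀ i, r ∈ Set.Ioo (f i) q :=
    Filter.eventually_all.2 fun i => Ioo_mem_nhdsLT (hf i)
  obtain ⟨r, h2, h3⟩ := (h1.and self_mem_nhdsWithin).exists
  exact ⟨r, fun i => (h2 i).1, h3⟩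

/-- A thread that is about to do an SCX with a valid read-set will resolve its task. -/
theorem FrameOK.resolves {a : Addr} {d : Deferred S Addr} {R : ReadSet}
    {m l : ℕ} {env : Fin m → Addr} {x : Imm S (Fin m)} {cell : Cell S} {Q : Set Addr}
    (hf : FrameOK D ord h ⟨a, d, .run R env (.ret x)⟩) (ha : h[a]? = some cell)
    (hR : R.Valid h) (hQ : a ∉ Q) (hfo : Follows D Q h d env (.ret x) l) :
    Resolves D Q h (h.set a ⟨.imm (x.map env), d.isSnapshot, cell.version + 1⟩) a d
      (x.map env) := by
  obtain ⟨cell', h1, h2⟩ := hf.cell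
  simp only at h1 h2
  rw [ha] at h1
  cases h1
  obtain ⟨cell', h3, h4⟩ := hR _ hf.phase.1
  simp only at h3 h4
  rw [ha] at h3
  cases h3
  rcases h2 with h2 | ⟨-, h2⟩
  · exact hfo.resolves ha h2 hQ
  · exact absurd h4 h2

theorem mem_range_append {m n : ℕ} {f : Fin m → Addr} {g : Fin n → Addr} {b : Addr}
    (hb : b ∈ Set.range (Fin.append f g)) : b ∈ Set.range f ∨ b ∈ Set.range g := by
  obtain ⟨i, rfl⟩ := hb
  induction i using Fin.addCases with
  | left i => exact Or.inl ⟨i, by simp⟩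
  | right i => exact Or.inr ⟨i, by simp⟩

theorem mem_range_snoc {m : ℕ} {f : Fin m → Addr} {a b : Addr}
    (hb : b ∈ Set.range (Fin.snoc (α := fun _ => Addr) f a)) : b ∈ Set.range f ∨ b = a := by
  obtain ⟨i, rfl⟩ := hb
  induction i using Fin.lastCases with
  | last => exact Or.inr (by simp)
  | cast i => exact Or.inl ⟨i, by simp⟩

theorem mem_escape {st : Stack S} {fr : Frame S} (hf : fr ∈ st.escape) :
    ∃ fr' ∈ st, fr = ⟨fr'.addr, fr'.task, .start⟩ ∨ fr = fr' := by
  cases st with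
  | nil => cases hf
  | cons fr' rest =>
    rcases List.mem_cons.1 hf with rfl | hf
    · exact ⟨fr', List.mem_cons_self, Or.inl rfl⟩
    · exact ⟨fr, List.mem_cons_of_mem _ hf, Or.inr rfl⟩

theorem HeapOK.frameOK_of_deferred (hh : HeapOK ord h) {a : Addr} {cell : Cell S}
    {d : Deferred S Addr} (ha : h[a]? = some cell) (hd : cell.content = .deferred d) :
    FrameOK D ord h ⟨a, d, .start⟩ where
  cell := ⟨cell, ha, Or.inl hd⟩
  refs := by
    intro b hb
    refine hh.refs a cell ha b ?_
    rw [hd, Content.refs_deferred]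
    exact hb.elim id False.elim
  phase := trivial

/-- The middle conclusion speaks of arbitrary frames, so that the frames of the other threads are
covered as well. -/
theorem ForceStep.invariant {st st' : Stack S} {e : Event} (hs : ForceStep D h st e h' st')
    (hh : HeapOK ord h) (hf : ∀ fr ∈ st, FrameOK D ord h fr) :
    ∃ ord', HeapOK ord' h' ∧ (∀ fr, FrameOK D ord h fr → FrameOK D ord' h' fr) ∧
      ∀ fr ∈ st', FrameOK D ord' h' fr := by
  have same : (∀ fr ∈ st', FrameOK D ord h fr) → h' = h →
      ∃ ord', HeapOK ord' h' ∧ (∀ fr, FrameOK D ord h fr → FrameOK D ord' h' fr) ∧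
      ∀ fr ∈ st', FrameOK D ord' h' fr := by
    rintro h1 rfl
    exact ⟨ord, hh, fun fr h => h, h1⟩
  have escape : ∀ {fr : Frame S} {rest : Stack S}, (∀ fr' ∈ fr :: rest, FrameOK D ord h fr') →
      ∀ fr' ∈ rest.escape, FrameOK D ord h fr' := by
    intro fr rest h1 fr' h2
    obtain ⟨fr₁, h3, h4⟩ := mem_escape h2
    have h5 := h1 fr₁ (List.mem_cons_of_mem _ h3)
    rcases h4 with rfl | rfl
    · exact h5.restart
    · exact h5
  cases hs with
  | rootBegin ha =>
    rw [List.forall_mem_cons] at hf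
    obtain ⟨⟨h1, h2, h3⟩, hr⟩ := hf
    exact same (List.forall_mem_cons.2 ⟨⟨h1, h2, trivial⟩, hr⟩) rfl
  | rootFailed ha hw =>
    rw [List.forall_mem_cons] at hf
    exact same (List.forall_mem_cons.2 ⟨hf.1.restart, hf.2⟩) rfl
  | rootFinalized ha hfi => exact same (escape hf) rfl
  | rootMismatch ha hfi hd => exact same (escape hf) rfl
  | rootSuccess ha hfi hd =>
    rw [List.forall_mem_cons] at hf
    obtain ⟨⟨h1, h2, h3⟩, hr⟩ := hf
    refine same (List.forall_mem_cons.2 ⟨⟨h1, ?_, ?_⟩, hr⟩) rfl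
    · intro b hb
      refine h2 b (Or.inl ?_)
      rw [Deferred.begin_eq] at hb
      exact hb.elim id id
    · rw [Deferred.begin_eq]
      refine ⟨?_, 0, Follows.init⟩
      -- A deferred cell has version 0, so the initial read-set is `[(a, 0)]`.
      rw [(hh.unmodified _ _ _ ha hd).1]
      exact List.mem_singleton.2 rfl
  | @alloc a d rest R m env x k =>
    rw [List.forall_mem_cons] at hf
    obtain ⟨hf₁, hr⟩ := hf
    have henv : ∀ i, env i < h.length ∧ ord (env i) < ord a :=
      fun i => hf₁.refs _ (Or.inr ⟨i, rfl⟩)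
    obtain ⟨r, h1, h2⟩ := exists_rat_between fun i => (henv i).2
    have ho : ∀ b < h.length, Function.update ord h.length r b = ord b :=
      fun b hb => Function.update_of_ne hb.ne _ _
    have hpres : ∀ fr, FrameOK D ord h fr → FrameOK D (Function.update ord h.length r)
        (h ++ [Cell.fresh (x.map env)]) fr := fun fr hfr => hfr.of_append ho
    refine ⟨Function.update ord h.length r, hh.of_append ho ?_, hpres,
      List.forall_mem_cons.2 ⟨⟨(hpres _ hf₁).cell, ?_, ?_⟩, fun fr hfr => hpres _ (hr fr hfr)⟩⟩
    · intro b hb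
      obtain ⟨i, -, rfl⟩ := Content.mem_refs_map hb
      exact ⟨(henv i).1, by simpa using h1 i⟩
    · intro b hb
      rcases hb with hb | hb
      · exact (hpres _ hf₁).refs b (Or.inl hb)
      · rcases mem_range_snoc hb with hb | rfl
        · exact (hpres _ hf₁).refs b (Or.inr hb)
        · refine ⟨by simp, ?_⟩
          simp only
          rw [ho _ hf₁.lt_length]
          simpa using h2
    · obtain ⟨h3, l, h4⟩ := hf₁.phase
      have ha := ho _ hf₁.lt_length
      simp only at ha
      refine ⟨h3, l + 1, h4.alloc ?_ ?_⟩
      · intro b hb hba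
        simp only [Set.mem_ofPred_eq] at hba ⊢
        rwa [ha, ho b hb]
      · simp only [Set.mem_ofPred_eq]
        rw [ha]
        simpa using h2
  | strictBegin hx =>
    rw [List.forall_mem_cons] at hf
    obtain ⟨⟨h1, h2, h3, h4⟩, hr⟩ := hf
    exact same (List.forall_mem_cons.2 ⟨⟨h1, h2, h3, h4, rfl⟩, hr⟩) rfl
  | strictFailed hx hw =>
    rw [List.forall_mem_cons] at hf
    exact same (List.forall_mem_cons.2 ⟨hf.1.restart, hf.2⟩) rfl
  | strictImm hx hy =>
    rw [List.forall_mem_cons] at hf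
    obtain ⟨⟨h1, h2, h3, ⟨l, h4⟩, -⟩, hr⟩ := hf
    refine same (List.forall_mem_cons.2 ⟨⟨h1, ?_, ?_, l + 1, h4.strict hx hy⟩, hr⟩) rfl
    · intro b hb
      rcases hb with hb | hb
      · exact h2 b (Or.inl hb)
      · rcases mem_range_append hb with hb | ⟨i, rfl⟩
        · exact h2 b (Or.inr hb)
        · have h5 := hh.refs _ _ hx _ (by rw [hy]; exact ⟨i, rfl⟩)
          exact ⟨h5.1, h5.2.trans (h2 _ (Or.inr ⟨_, rfl⟩)).2⟩
    · unfold ReadSet.add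
      split
      · exact h3
      · exact List.mem_cons_of_mem _ h3
  | strictSubsumed hx hd hfi => exact same (escape hf) rfl
  | strictForce hx hd hfi =>
    rw [List.forall_mem_cons] at hf
    obtain ⟨⟨h1, h2, h3, h4, -⟩, hr⟩ := hf
    exact same (List.forall_mem_cons.2 ⟨hh.frameOK_of_deferred hx hd,
      List.forall_mem_cons.2 ⟨⟨h1, h2, h3, h4⟩, hr⟩⟩) rfl
  | lazyBegin hx =>
    rw [List.forall_mem_cons] at hf
    obtain ⟨⟨h1, h2, h3, h4⟩, hr⟩ := hf
    exact same (List.forall_mem_cons.2 ⟨⟨h1, h2, h3, h4, rfl⟩, hr⟩) rfl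
  | lazyFailed hx hw =>
    rw [List.forall_mem_cons] at hf
    exact same (List.forall_mem_cons.2 ⟨hf.1.restart, hf.2⟩) rfl
  | lazyDone hx =>
    rw [List.forall_mem_cons] at hf
    obtain ⟨⟨h1, h2, h3, ⟨l, h4⟩, -⟩, hr⟩ := hf
    refine same (List.forall_mem_cons.2 ⟨⟨h1, h2, ?_, l + 1, h4.lazy hx⟩, hr⟩) rfl
    unfold ReadSet.add
    split
    · exact h3
    · exact List.mem_cons_of_mem _ h3
  | @scxSuccess a d rest R m env x cell ha hR =>
    rw [List.forall_mem_cons] at hf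
    obtain ⟨hf₁, hr⟩ := hf
    obtain ⟨-, l, h1⟩ := hf₁.phase
    have hs := hf₁.resolves ha hR (fun (h2 : ord a < ord a) => lt_irrefl _ h2) h1
    have hpres : ∀ fr, FrameOK D ord h fr → FrameOK D ord _ fr := fun fr hfr => hfr.of_resolves hs
    exact ⟨ord, hh.of_resolves hs fun i => hf₁.refs _ (Or.inr ⟨_, rfl⟩), hpres,
      fun fr hfr => hpres fr (hr fr hfr)⟩
  | scxFailed hR =>
    rw [List.forall_mem_cons] at hf
    exact same (List.forall_mem_cons.2 ⟨hf.1.restart, hf.2⟩) rfl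

/-- The invariant of all reachable states. -/
structure ConfigOK (D : SeqDef S) {P : ℕ} (ord : Addr → ℚ) (C : Config S P) : Prop where
  heap : HeapOK ord C.heap
  frames : ∀ q, ∀ fr ∈ C.threads q, FrameOK D ord C.heap fr
  roots : ∀ a ∈ C.roots, a < C.heap.length

/-! ### Reachable configurations and enabled steps -/

variable {P : ℕ} {C C' : Config S P}

theorem Config.Accessible.lt_length (hC : ConfigOK D ord C) {a : Addr} (ha : C.Accessible a) :
    a < C.heap.length := by
  cases ha with
  | root ha => exact hC.roots a ha
  | child _ hc hb => exact (hC.heap.refs _ _ hc _ hb).1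

theorem ForceStep.length_le {st st' : Stack S} {e : Event} (hs : ForceStep D h st e h' st') :
    h.length ≤ h'.length := by
  cases hs <;> simp

theorem ConfigOK.step {p : Fin P} {e : Event} (hC : ConfigOK D ord C) (hs : Step D C p e C') :
    ∃ ord', ConfigOK D ord' C' := by
  cases hs with
  | force hs =>
    obtain ⟨ord', h1, h2, h3⟩ := hs.invariant hC.heap (hC.frames p)
    refine ⟨ord', h1, fun q fr hfr => ?_, fun a ha => (hC.roots a ha).trans_le hs.length_le⟩
    by_cases hq : q = p
    · subst hq
      exact h3 fr (by simpa using hfr)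
    · exact h2 fr (hC.frames q fr (by simpa [hq] using hfr))
  | @invoke a cell d hp ha hc hd =>
    refine ⟨ord, hC.heap, fun q fr hfr => ?_, hC.roots⟩
    by_cases hq : q = p
    · subst hq
      obtain rfl : fr = ⟨a, d, .start⟩ := by simpa using hfr
      exact hC.heap.frameOK_of_deferred hc hd
    · exact hC.frames q fr (by simpa [hq] using hfr)
  | @post x hp hx =>
    -- No activation refers to a published cell yet, so it may be ranked above all existing cells.
    obtain ⟨r, hr⟩ := ((Finset.range C.heap.length).image ord).exists_le
    have ho : ∀ b < C.heap.length, Function.update ord C.heap.length (r + 1) b = ord b :=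
      fun b hb => Function.update_of_ne hb.ne _ _
    refine ⟨Function.update ord C.heap.length (r + 1), hC.heap.of_append ho ?_, ?_, ?_⟩
    · intro b hb
      have h1 := (hx b hb).lt_length hC
      have h2 := hr (ord b) (Finset.mem_image_of_mem _ (Finset.mem_range.2 h1))
      refine ⟨h1, ?_⟩
      rw [Function.update_self]
      linarith
    · exact fun q fr hfr => (hC.frames q fr hfr).of_append ho
    · intro a ha
      rcases ha with rfl | ha
      · simp
      · exact (hC.roots a ha).trans_le (by simp)

theorem ConfigOK.initial (S : TreeSig.{u, v}) (D : SeqDef S) (P : ℕ) :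
    ConfigOK D (fun _ => 0) (Config.initial S P) where
  heap := ⟨by simp [Config.initial], by simp [Config.initial]⟩
  frames := by simp [Config.initial]
  roots := by simp [Config.initial]

theorem ConfigOK.exec {tr : List (Fin P × Event)} (he : Exec D C tr C') :
    ∀ {ord : Addr → ℚ}, ConfigOK D ord C → ∃ ord', ConfigOK D ord' C' := by
  induction he with
  | nil => exact fun h => ⟨_, h⟩
  | cons hs ht ih =>
    intro ord hC
    obtain ⟨ord', h1⟩ := hC.step hs
    exact ih h1

theorem List.getElem?_of_lt {α : Type*} {l : List α} {a : ℕ} (h : a < l.length) :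
    ∃ x, l[a]? = some x :=
  ⟨_, List.getElem?_eq_getElem h⟩

/-- A thread inside `force` is never blocked. -/
theorem ConfigOK.enabled (hC : ConfigOK D ord C) {p : Fin P} (hp : C.threads p ≠ []) :
    ∃ (e : Event) (C' : Config S P), Step D C p e C' := by
  suffices hsuff : ∃ e h' st', ForceStep D C.heap (C.threads p) e h' st' by
    obtain ⟨e, h', st', h1⟩ := hsuff
    exact ⟨e, _, .force h1⟩
  have hfr := hC.frames p
  generalize C.threads p = st at hp hfr
  cases st with
  | nil => exact absurd rfl hp
  | cons fr rest =>
    have hf := hfr fr List.mem_cons_self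
    obtain ⟨a, d, ph⟩ := fr
    obtain ⟨cell, ha, -⟩ := hf.cell
    cases ph with
    | start => exact ⟨_, _, _, .rootBegin ha⟩
    | rootLLX w =>
      by_cases h1 : cell.final = true
      · exact ⟨_, _, _, .rootFinalized ha h1⟩
      · rw [Bool.not_eq_true] at h1
        by_cases h2 : cell.content = .deferred d
        · exact ⟨_, _, _, .rootSuccess ha h1 h2⟩
        · exact ⟨_, _, _, .rootMismatch ha h1 h2⟩
    | run R env code =>
      have henv : ∀ i, ∃ cell, C.heap[env i]? = some cell := fun i =>
        List.getElem?_of_lt (hf.refs _ (Or.inr ⟨i, rfl⟩)).1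
      cases code with
      | readStrict x k =>
        obtain ⟨cell', h1⟩ := henv x
        exact ⟨_, _, _, .strictBegin h1⟩
      | readLazy x k =>
        obtain ⟨cell', h1⟩ := henv x
        exact ⟨_, _, _, .lazyBegin h1⟩
      | alloc x k => exact ⟨_, _, _, .alloc⟩
      | ret x =>
        by_cases h1 : R.Valid C.heap
        · exact ⟨_, _, _, .scxSuccess ha h1⟩
        · exact ⟨_, _, _, .scxFailed h1⟩
    | childLLX R env code w =>
      have henv : ∀ i, ∃ cell, C.heap[env i]? = some cell := fun i =>
        List.getElem?_of_lt (hf.refs _ (Or.inr ⟨i, rfl⟩)).1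
      have hv := hf.phase.2.2
      cases code with
      | readStrict x k =>
        obtain ⟨cell', h1⟩ := henv x
        cases h2 : cell'.content with
        | imm y => exact ⟨_, _, _, .strictImm h1 h2⟩
        | deferred d₁ =>
          by_cases h3 : cell'.final = true
          · exact ⟨_, _, _, .strictSubsumed h1 h2 h3⟩
          · exact ⟨_, _, _, .strictForce h1 h2 (by simpa using h3)⟩
      | readLazy x k =>
        obtain ⟨cell', h1⟩ := henv x
        exact ⟨_, _, _, .lazyDone h1⟩
      | alloc x k => cases hv
      | ret x => cases hv

end Invariant

/-! ### The failures that an activation can still meet -/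

section Progress

variable {S : TreeSig.{u, v}} {D : SeqDef S} {h h' : Heap S} {ord : Addr → ℚ}

def IsDeferred (h : Heap S) (a : Addr) : Prop :=
  ∃ cell d, h[a]? = some cell ∧ cell.content = .deferred d

def IsImmediate (h : Heap S) (a : Addr) : Prop :=
  ∃ cell y, h[a]? = some cell ∧ cell.content = .imm y

theorem IsImmediate.not_isDeferred {a : Addr} (hi : IsImmediate h a) : ¬ IsDeferred h a := by
  rintro ⟨cell, d, h1, h2⟩
  obtain ⟨cell', y, h3, h4⟩ := hi
  rw [h1] at h3
  cases h3
  rw [h2] at h4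
  cases h4

theorem IsImmediate.evolves {a : Addr} (he : Evolves h h') (hi : IsImmediate h a) :
    IsImmediate h' a := by
  obtain ⟨cell, y, h1, h2⟩ := hi
  exact ⟨cell, y, he.imm h1 h2, h2⟩

theorem Evolves.isDeferred (he : Evolves h h') {a : Addr} (ha : a < h.length)
    (hd : IsDeferred h' a) : IsDeferred h a := by
  obtain ⟨cell, hc⟩ := List.getElem?_of_lt ha
  rcases he a cell hc with h1 | ⟨d, h1, -⟩
  · obtain ⟨cell', d, h2, h3⟩ := hd
    rw [h1] at h2
    cases h2
    exact ⟨_, _, hc, h3⟩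
  · exact ⟨_, _, hc, h1⟩

/-- `z` is one of the nodes that the snapshot `d` reads without forcing. -/
def LazyTarget (h : Heap S) (d : Deferred S Addr) (z : Addr) : Prop :=
  ∃ b cell y i, d = .snapshot b ∧ h[b]? = some cell ∧ cell.content = .imm y ∧ y.children i = z

theorem LazyTarget.evolves {d : Deferred S Addr} {z : Addr} (he : Evolves h h')
    (hl : LazyTarget h d z) : LazyTarget h' d z := by
  obtain ⟨b, cell, y, i, h1, h2, h3, h4⟩ := hl
  exact ⟨b, cell, y, i, h1, he.imm h2 h3, h3, h4⟩

/-- At most `c` of the nodes that the snapshot `d` reads without forcing can still be modified. -/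
def LazyBound (h : Heap S) (d : Deferred S Addr) (c : ℕ) : Prop :=
  ∀ b, d = .snapshot b → maxArity S ≤ c ∨ ∃ cell y, h[b]? = some cell ∧ cell.content = .imm y ∧
    {i | IsDeferred h (y.children i)}.ncard ≤ c

theorem LazyBound.evolves (hh : HeapOK ord h) {d : Deferred S Addr} {c : ℕ} (he : Evolves h h')
    (hl : LazyBound h d c) : LazyBound h' d c := by
  intro b hb
  refine (hl b hb).imp id ?_
  rintro ⟨cell, y, h1, h2, h3⟩
  refine ⟨cell, y, he.imm h1 h2, h2, le_trans (Set.ncard_le_ncard ?_ (Set.toFinite _)) h3⟩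
  intro i hi
  exact he.isDeferred (hh.refs _ _ h1 _ (by rw [h2]; exact ⟨i, rfl⟩)).1 hi

/-- Once the child of the snapshot is immediate, its children are fixed. Forcing one of them removes
its index from the finite set of deferred ones, and no index ever enters this set. -/
theorem LazyBound.drop (hh : HeapOK ord h) {d : Deferred S Addr} {c : ℕ} (he : Evolves h h')
    (hl : LazyBound h d c) {z : Addr} (ht : LazyTarget h d z) (hz : IsDeferred h z)
    (hz' : ¬ IsDeferred h' z) : ∃ c' < c, LazyBound h' d c' := by
  obtain ⟨b, cell, y, i, rfl, h1, h2, h3⟩ := ht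
  have hlt : {i | IsDeferred h' (y.children i)}.ncard < {i | IsDeferred h (y.children i)}.ncard := by
    refine Set.ncard_lt_ncard ⟨?_, fun hsub => ?_⟩ (Set.toFinite _)
    · intro j hj
      exact he.isDeferred (hh.refs _ _ h1 _ (by rw [h2]; exact ⟨j, rfl⟩)).1 hj
    · have : i ∈ {i | IsDeferred h' (y.children i)} := hsub (by simpa [h3] using hz)
      exact hz' (by simpa [h3] using this)
  have hle : {i | IsDeferred h (y.children i)}.ncard ≤ maxArity S := by
    refine le_trans ?_ (arity_le_maxArity S y.tag)
    simpa using Set.ncard_le_card {i | IsDeferred h (y.children i)}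
  refine ⟨{i | IsDeferred h' (y.children i)}.ncard, hlt.trans_le ?_, ?_⟩
  · rcases hl b rfl with h4 | ⟨cell', y', h4, h5, h6⟩
    · exact hle.trans h4
    · rw [h1] at h4
      cases h4
      rw [h2] at h5
      cases h5
      exact h6
  · intro b' hb'
    cases hb'
    exact Or.inr ⟨cell, y, he.imm h1 h2, h2, le_rfl⟩

/-- An activation of level `M` that forces the node `a`, which contained `d`, has to restart at most
`u` more times: the evaluation of `d` gets at least `l` instructions far without a node that can
still be modified, and so on. -/
def Progress (D : SeqDef S) (h : Heap S) (a : Addr) (d : Deferred S Addr) (M u : ℕ) : Prop :=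
  ∃ s l c ρ, EvalPath D h (d.evalState D) s l ∧ l ≤ codeBound S M ∧ LazyBound h d c ∧
    (IsDeferred h a → 1 ≤ ρ) ∧ codeBound S M + ρ + c ≤ l + u

/-- As `Progress`, with fewer than `u` restarts. -/
def ProgressLt (D : SeqDef S) (h : Heap S) (a : Addr) (d : Deferred S Addr) (M u : ℕ) : Prop :=
  ∃ u' < u, Progress D h a d M u'

/-! ### Changes of the restart potential -/

variable {a : Addr} {d : Deferred S Addr} {M u : ℕ}

theorem Progress.init (a : Addr) (d : Deferred S Addr) (M : ℕ) :
    Progress D h a d M (codeBound S M + maxArity S + 1) :=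
  ⟨_, 0, maxArity S, 1, .nil, Nat.zero_le _, fun _ _ => Or.inl le_rfl, fun _ => le_rfl, by omega⟩

theorem Progress.evolves (hh : HeapOK ord h) (he : Evolves h h') (ha : a < h.length)
    (hp : Progress D h a d M u) : Progress D h' a d M u := by
  obtain ⟨s, l, c, ρ, h1, h2, h3, h4, h5⟩ := hp
  exact ⟨s, l, c, ρ, h1.evolves he, h2, h3.evolves hh he, fun h6 => h4 (he.isDeferred ha h6), h5⟩

theorem ProgressLt.evolves (hh : HeapOK ord h) (he : Evolves h h') (ha : a < h.length)
    (hp : ProgressLt D h a d M u) : ProgressLt D h' a d M u := by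
  obtain ⟨u', h1, h2⟩ := hp
  exact ⟨u', h1, h2.evolves hh he ha⟩

theorem Progress.root_modified (hh : HeapOK ord h) (he : Evolves h h')
    (hp : Progress D h a d M u) (hd : IsDeferred h a) (hd' : ¬ IsDeferred h' a) :
    ProgressLt D h' a d M u := by
  obtain ⟨s, l, c, ρ, h1, h2, h3, h4, h5⟩ := hp
  have := h4 hd
  exact ⟨u - 1, by omega, s, l, c, ρ - 1, h1.evolves he, h2, h3.evolves hh he,
    fun h6 => absurd h6 hd', by omega⟩

theorem Progress.lazy_modified (hh : HeapOK ord h) (he : Evolves h h') (ha : a < h.length)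
    (hp : Progress D h a d M u) {z : Addr} (ht : LazyTarget h d z) (hz : IsDeferred h z)
    (hz' : ¬ IsDeferred h' z) : ProgressLt D h' a d M u := by
  obtain ⟨s, l, c, ρ, h1, h2, h3, h4, h5⟩ := hp
  obtain ⟨c', h6, h7⟩ := h3.drop hh he ht hz hz'
  exact ⟨u - 1, by omega, s, l, c', ρ, h1.evolves he, h2, h7,
    fun h6 => h4 (he.isDeferred ha h6), by omega⟩

/-- A modified child pays for the restart by lengthening the virtual evaluation. The gain persists
over restarts, because the path contains no address allocated in the attempt. -/
theorem Progress.strict_modified (hh : HeapOK ord h) (he : Evolves h h') (ha : a < h.length)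
    (hp : Progress D h a d M u) {Q : Set Addr} {m l : ℕ} {env : Fin m → Addr} {x : Fin m}
    {k : (c : Fin S.numCases) → Option S.Elem → Bool → Code S (m + S.arity c)}
    (hf : Follows D Q h d env (.readStrict x k) l) (hl : l < codeBound S M)
    (hQ : env x ∉ Q) (hd : IsDeferred h (env x)) (hi : IsImmediate h' (env x)) :
    ProgressLt D h' a d M u := by
  obtain ⟨s, l₀, c, ρ, h1, h2, h3, h4, h5⟩ := hp
  obtain ⟨σ, h6, h7⟩ := hf
  -- Being outside the private cells, the child occurs in the virtual evaluation as itself. As long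
  -- as it is deferred the evaluation is stuck here, so the recorded length `l₀` is at most `l`.
  have hx : σ x = .addr (env x) := (h7 x).eq_addr hQ
  have hle : l₀ ≤ l := by
    refine h6.le_of_stuck ?_ h1
    intro c val ts f hw
    rw [hx] at hw
    cases hw with
    | addr ha' hy => exact IsImmediate.not_isDeferred ⟨_, _, ha', hy⟩ hd
  obtain ⟨cell, y, h8, h9⟩ := hi
  have h10 : Whnf D h' (σ x) y.tag y.value (fun i => .addr (y.children i)) cell.final := by
    rw [hx]
    exact .addr h8 h9
  exact ⟨u - 1, by omega, _, l + 1, c, ρ, (h6.evolves he).strict h10, hl, h3.evolves hh he,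
    fun h6 => h4 (he.isDeferred ha h6), by omega⟩

/-! ### What is read without forcing -/

/-- All variables read without forcing satisfy `P`, if the variables in `B` hold the child of the
snapshot. -/
def LazySafe : {m : ℕ} → (Fin m → Prop) → (Fin m → Prop) → Code S m → Prop
  | _, B, P, .readStrict x k => ∀ c val f,
      LazySafe (Fin.append B fun _ => False) (Fin.append P fun _ => B x) (k c val f)
  | _, B, P, .readLazy x k => P x ∧ ∀ b, LazySafe B P (k b)
  | _, B, P, .alloc _ k => LazySafe (Fin.snoc (α := fun _ => Prop) B False)
      (Fin.snoc (α := fun _ => Prop) P False) k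
  | _, _, _, .ret _ => True

theorem Body.lazySafe {m : ℕ} (b : Body S m) :
    ∀ B P : Fin m → Prop, LazySafe B P b.transform := by
  induction b with
  | read x k ih => exact fun B P c val f => ih c val _ _
  | call j arg xs k ih => exact fun B P => ih _ _
  | build x k ih => exact fun B P => ih _ _
  | ret x => exact fun B P => trivial

theorem lazySafe_snapshotChildren (c : Fin S.numCases) (val : Option S.Elem)
    (is : List (Fin (S.arity c))) :
    ∀ {m : ℕ} {xs : Fin (S.arity c) → Fin m} {B P : Fin m → Prop}, is.Nodup →
      (∀ i ∈ is, P (xs i)) → LazySafe B P (snapshotChildren c val is xs) := by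
  induction is with
  | nil => exact fun _ _ => trivial
  | cons i is ih =>
    intro m xs B P hnd hP
    rw [List.nodup_cons] at hnd
    refine ⟨hP i List.mem_cons_self, fun b => ?_⟩
    cases b with
    | true => exact ih hnd.2 fun j hj => hP j (List.mem_cons_of_mem _ hj)
    | false =>
      refine ih hnd.2 fun j hjs => ?_
      have hj : j ≠ i := fun h1 => hnd.1 (h1 ▸ hjs)
      simpa [Function.update_of_ne hj] using hP j (List.mem_cons_of_mem _ hjs)

/-- The only strict read is that of the child of the snapshot, so the variables that it brings into
scope, and no others, are read lazily. -/
theorem lazySafe_snapshotCode : LazySafe (fun _ => True) (fun _ => False) (snapshotCode S) := by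
  intro c val f
  cases f with
  | true => exact trivial
  | false => exact lazySafe_snapshotChildren c val _ (List.nodup_finRange _) fun i _ => by simp

def LazyOK (h : Heap S) (d : Deferred S Addr) {m : ℕ} (env : Fin m → Addr) (code : Code S m) :
    Prop :=
  ∃ B P, LazySafe B P code ∧ (∀ i, B i → d = .snapshot (env i)) ∧
    ∀ i, P i → LazyTarget h d (env i)

variable {m : ℕ} {env : Fin m → Addr}

theorem LazyOK.init : LazyOK h d d.env (d.code D) := by
  cases d with
  | op j arg ch =>
    exact ⟨fun _ => False, fun _ => False, Body.lazySafe _ _ _, fun _ => False.elim,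
      fun _ => False.elim⟩
  | snapshot b =>
    exact ⟨fun _ => True, fun _ => False, lazySafe_snapshotCode, fun _ _ => rfl,
      fun _ => False.elim⟩

theorem LazyOK.evolves {code : Code S m} (he : Evolves h h') (hl : LazyOK h d env code) :
    LazyOK h' d env code := by
  obtain ⟨B, P, h1, h2, h3⟩ := hl
  exact ⟨B, P, h1, h2, fun i hi => (h3 i hi).evolves he⟩

theorem LazyOK.target {x : Fin m} {k : Bool → Code S m} (hl : LazyOK h d env (.readLazy x k)) :
    LazyTarget h d (env x) := by
  obtain ⟨B, P, h1, h2, h3⟩ := hl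
  exact h3 x h1.1

theorem LazyOK.lazy {x : Fin m} {k : Bool → Code S m} (hl : LazyOK h d env (.readLazy x k))
    (b : Bool) : LazyOK h d env (k b) := by
  obtain ⟨B, P, h1, h2, h3⟩ := hl
  exact ⟨B, P, h1.2 b, h2, h3⟩

theorem LazyOK.alloc {x : Content S (Fin m)} {k : Code S (m + 1)}
    (hl : LazyOK h d env (.alloc x k)) (b : Addr) :
    LazyOK h d (Fin.snoc (α := fun _ => Addr) env b) k := by
  obtain ⟨B, P, h1, h2, h3⟩ := hl
  exact ⟨_, _, h1, forall_snoc (R := fun B a => B → d = .snapshot a) h2 False.elim,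
    forall_snoc (R := fun P a => P → LazyTarget h d a) h3 False.elim⟩

theorem LazyOK.strict {x : Fin m}
    {k : (c : Fin S.numCases) → Option S.Elem → Bool → Code S (m + S.arity c)}
    (hl : LazyOK h d env (.readStrict x k)) {cell : Cell S} {y : Imm S Addr}
    (hx : h[env x]? = some cell) (hy : cell.content = .imm y) (f : Bool) :
    LazyOK h d (Fin.append env y.children) (k y.tag y.value f) := by
  obtain ⟨B, P, h1, h2, h3⟩ := hl
  exact ⟨_, _, h1 _ _ _, forall_append (R := fun B a => B → d = .snapshot a) h2
    fun _ => False.elim, forall_append (R := fun P a => P → LazyTarget h d a) h3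
    fun i hi => ⟨_, _, _, i, h2 x hi, hx, hy, rfl⟩⟩

end Progress

/-! ### What a step of `force` changes -/

section Change

variable {S : TreeSig.{u, v}} {D : SeqDef S} {h h' : Heap S} {ord : Addr → ℚ}

/-- Cells outside `Q` do not refer to cells of `Q`. -/
def HeapAvoids (h : Heap S) (Q : Set Addr) : Prop :=
  ∀ (a : Addr) (cell : Cell S), h[a]? = some cell → a ∉ Q → ∀ b ∈ cell.content.refs, b ∉ Q

def FrameAvoids (fr : Frame S) (Q : Set Addr) : Prop :=
  fr.addr ∉ Q ∧ ∀ b ∈ fr.refs, b ∉ Q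

theorem HeapAvoids.append {Q : Set Addr} {x : Content S Addr} (hh : HeapAvoids h Q)
    (hx : h.length ∉ Q → ∀ b ∈ x.refs, b ∉ Q) : HeapAvoids (h ++ [Cell.fresh x]) Q := by
  intro a cell ha haQ
  rw [List.getElem?_append] at ha
  split at ha
  next hlt => exact hh a cell ha haQ
  next hlt =>
    rw [List.getElem?_singleton] at ha
    split at ha
    next h0 =>
      obtain rfl : a = h.length := le_antisymm (Nat.le_of_sub_eq_zero h0) (not_lt.1 hlt)
      cases ha
      exact hx haQ
    next => cases ha

theorem HeapAvoids.set {Q : Set Addr} {z : Addr} {c : Cell S} (hh : HeapAvoids h Q)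
    (hc : z ∉ Q → ∀ b ∈ c.content.refs, b ∉ Q) : HeapAvoids (h.set z c) Q := by
  intro a cell ha haQ
  rw [List.getElem?_set] at ha
  split at ha
  next heq =>
    subst heq
    split at ha
    · cases ha
      exact hc haQ
    · cases ha
  next hne => exact hh a cell ha haQ

theorem HeapAvoids.imm_children {Q : Set Addr} (hh : HeapAvoids h Q) {a : Addr} {cell : Cell S}
    {y : Imm S Addr} (ha : h[a]? = some cell) (hy : cell.content = .imm y) (haQ : a ∉ Q) :
    ∀ b ∈ Set.range y.children, b ∉ Q := by
  have := hh a cell ha haQ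
  rwa [hy] at this

theorem HeapAvoids.deferred {Q : Set Addr} (hh : HeapAvoids h Q) {a : Addr} {cell : Cell S}
    {d : Deferred S Addr} (ha : h[a]? = some cell) (hd : cell.content = .deferred d)
    (haQ : a ∉ Q) : FrameAvoids ⟨a, d, .start⟩ Q := by
  have := hh a cell ha haQ
  rw [hd, Content.refs_deferred] at this
  exact ⟨haQ, fun b hb => this b (hb.elim id False.elim)⟩

theorem Frame.refs_start_subset {a : Addr} {d : Deferred S Addr} {ph : Phase S} :
    Frame.refs ⟨a, d, .start⟩ ⊆ Frame.refs ⟨a, d, ph⟩ :=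
  fun _ hb => Or.inl (hb.elim id False.elim)

/-- A thread that does not know the nodes in `Q` does not get to know them. -/
theorem ForceStep.avoids {st st' : Stack S} {e : Event} (hs : ForceStep D h st e h' st')
    {Q : Set Addr} (hlt : ∀ b ∈ Q, b < h.length) (hh : HeapAvoids h Q)
    (hf : ∀ fr ∈ st, FrameAvoids fr Q) : HeapAvoids h' Q ∧ ∀ fr ∈ st', FrameAvoids fr Q := by
  have restart : ∀ {a d ph}, FrameAvoids (⟨a, d, ph⟩ : Frame S) Q → FrameAvoids ⟨a, d, .start⟩ Q :=
    fun h1 => ⟨h1.1, fun b hb => h1.2 b (Frame.refs_start_subset hb)⟩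
  have escape : ∀ {fr : Frame S} {rest : Stack S}, (∀ fr' ∈ fr :: rest, FrameAvoids fr' Q) →
      ∀ fr' ∈ rest.escape, FrameAvoids fr' Q := by
    intro fr rest h1 fr' h2
    obtain ⟨fr₁, h3, h4⟩ := mem_escape h2
    have h5 := h1 fr₁ (List.mem_cons_of_mem _ h3)
    rcases h4 with rfl | rfl
    · exact restart h5
    · exact h5
  have hnew : h.length ∉ Q := fun h1 => lt_irrefl _ (hlt _ h1)
  cases hs with
  | rootBegin ha =>
    rw [List.forall_mem_cons] at hf
    exact ⟨hh, List.forall_mem_cons.2 hf⟩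
  | rootFailed ha hw =>
    rw [List.forall_mem_cons] at hf
    exact ⟨hh, List.forall_mem_cons.2 ⟨restart hf.1, hf.2⟩⟩
  | rootFinalized ha hfi => exact ⟨hh, escape hf⟩
  | rootMismatch ha hfi hd => exact ⟨hh, escape hf⟩
  | rootSuccess ha hfi hd =>
    rw [List.forall_mem_cons] at hf
    refine ⟨hh, List.forall_mem_cons.2 ⟨⟨hf.1.1, fun b hb => hf.1.2 b (Or.inl ?_)⟩, hf.2⟩⟩
    rw [Deferred.begin_eq] at hb
    exact hb.elim id id
  | @alloc a d rest R m env x k =>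
    rw [List.forall_mem_cons] at hf
    refine ⟨hh.append fun _ b hb => ?_, List.forall_mem_cons.2 ⟨⟨hf.1.1, fun b hb => ?_⟩, hf.2⟩⟩
    · obtain ⟨i, -, rfl⟩ := Content.mem_refs_map hb
      exact hf.1.2 _ (Or.inr ⟨i, rfl⟩)
    · rcases hb with hb | hb
      · exact hf.1.2 b (Or.inl hb)
      · rcases mem_range_snoc hb with hb | rfl
        · exact hf.1.2 b (Or.inr hb)
        · exact hnew
  | strictBegin hx =>
    rw [List.forall_mem_cons] at hf
    exact ⟨hh, List.forall_mem_cons.2 hf⟩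
  | strictFailed hx hw =>
    rw [List.forall_mem_cons] at hf
    exact ⟨hh, List.forall_mem_cons.2 ⟨restart hf.1, hf.2⟩⟩
  | strictImm hx hy =>
    rw [List.forall_mem_cons] at hf
    refine ⟨hh, List.forall_mem_cons.2 ⟨⟨hf.1.1, fun b hb => ?_⟩, hf.2⟩⟩
    rcases hb with hb | hb
    · exact hf.1.2 b (Or.inl hb)
    · rcases mem_range_append hb with hb | hb
      · exact hf.1.2 b (Or.inr hb)
      · exact hh.imm_children hx hy (hf.1.2 _ (Or.inr ⟨_, rfl⟩)) b hb
  | strictSubsumed hx hd hfi => exact ⟨hh, escape hf⟩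
  | strictForce hx hd hfi =>
    rw [List.forall_mem_cons] at hf
    exact ⟨hh, List.forall_mem_cons.2 ⟨hh.deferred hx hd (hf.1.2 _ (Or.inr ⟨_, rfl⟩)),
      List.forall_mem_cons.2 hf⟩⟩
  | lazyBegin hx =>
    rw [List.forall_mem_cons] at hf
    exact ⟨hh, List.forall_mem_cons.2 hf⟩
  | lazyFailed hx hw =>
    rw [List.forall_mem_cons] at hf
    exact ⟨hh, List.forall_mem_cons.2 ⟨restart hf.1, hf.2⟩⟩
  | lazyDone hx =>
    rw [List.forall_mem_cons] at hf
    exact ⟨hh, List.forall_mem_cons.2 hf⟩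
  | @scxSuccess a d rest R m env x cell ha hR =>
    rw [List.forall_mem_cons] at hf
    refine ⟨hh.set fun _ b hb => ?_, hf.2⟩
    obtain ⟨i, rfl⟩ := hb
    exact hf.1.2 _ (Or.inr ⟨_, rfl⟩)
  | scxFailed hR =>
    rw [List.forall_mem_cons] at hf
    exact ⟨hh, List.forall_mem_cons.2 ⟨restart hf.1, hf.2⟩⟩

/-- Only a successful SCX changes an existing cell, and then it writes a correct result of the task.
This is all that other threads need to know about a step. -/
theorem ForceStep.change {st st' : Stack S} {e : Event} (hs : ForceStep D h st e h' st')
    (hf : ∀ fr ∈ st, FrameOK D ord h fr) :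
    h' = h ∨ (∃ c, h' = h ++ [c]) ∨
      ∃ fr ∈ st, ∃ Q y, Resolves D Q h h' fr.addr fr.task y := by
  cases hs with
  | alloc => exact Or.inr (Or.inl ⟨_, rfl⟩)
  | @scxSuccess a d rest R m env x cell ha hR =>
    rw [List.forall_mem_cons] at hf
    obtain ⟨-, l, h1⟩ := hf.1.phase
    exact Or.inr (Or.inr ⟨_, List.mem_cons_self, _, _,
      hf.1.resolves ha hR (fun (h2 : ord a < ord a) => lt_irrefl _ h2) h1⟩)
  | _ => exact Or.inl rfl

end Change

/-! ### The budget of a thread -/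

/-- A bound on the number of steps for forcing a node of level less than `M`. -/
def forceBound (S : TreeSig.{u, v}) : ℕ → ℕ
  | 0 => 0
  | M + 1 => (codeBound S M + maxArity S + 2) * (2 + codeBound S M * (forceBound S M + 4))

/-- The budget for one instruction of code of level `M`. -/
def unitCost (S : TreeSig.{u, v}) (M : ℕ) : ℕ := forceBound S M + 4

/-- The budget for one attempt to force a node of level `M`. -/
def attemptCost (S : TreeSig.{u, v}) (M : ℕ) : ℕ := 2 + codeBound S M * unitCost S M

theorem forceBound_succ (S : TreeSig.{u, v}) (M : ℕ) :
    forceBound S (M + 1) = (codeBound S M + maxArity S + 1) * attemptCost S M + attemptCost S M := by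
  simp only [forceBound, attemptCost, unitCost]
  ring

theorem forceBound_mono (S : TreeSig.{u, v}) : Monotone (forceBound S) := by
  refine monotone_nat_of_le_succ fun M => ?_
  induction M with
  | zero => exact Nat.zero_le _
  | succ M ih =>
    have h1 : codeBound S M ≤ codeBound S (M + 1) := codeBound_mono (Nat.le_succ M)
    simp only [forceBound] at ih ⊢
    gcongr

/-- An activation of `force` together with the data of its analysis: the cells that were allocated
in the current attempt and that only this thread knows, the level of the task, the number of
restarts that are still possible, and the number of steps that are still allowed. -/
structure Ghost (S : TreeSig.{u, v}) where
  frame : Frame S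
  own : Set Addr
  level : ℕ
  retries : ℕ
  budget : ℕ

section Ghost

variable {S : TreeSig.{u, v}} {D : SeqDef S} {h h' : Heap S} {ord : Addr → ℚ}

/-- The entry `en` of a read-set is up to date, or the number of restarts has decreased. -/
def EntryOK (D : SeqDef S) (h : Heap S) (a : Addr) (d : Deferred S Addr) (M u : ℕ)
    (en : Addr × ℕ) : Prop :=
  ∃ cell, h[en.1]? = some cell ∧ (cell.version = en.2 ∨ ProgressLt D h a d M u) ∧
    (IsDeferred h en.1 → en.1 = a ∨ LazyTarget h d en.1)

/-- The number `l` executed and the number `n` remaining are bounded together by `codeBound`; as `n`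
is positive, the virtual evaluation may be lengthened by one instruction within that bound. -/
structure Executes (D : SeqDef S) (h : Heap S) (a : Addr) (d : Deferred S Addr) (Q : Set Addr)
    (M u : ℕ) {m : ℕ} (R : ReadSet) (env : Fin m → Addr) (code : Code S m) (n : ℕ) : Prop where
  follows : ∃ l, Follows D Q h d env code l ∧ l + n ≤ codeBound S M
  sound : ∃ e r, (∀ i, Denotes D h (.addr (env i)) (e i).1 (e i).2) ∧ Sound D M e code r n
  lazyOK : LazyOK h d env code
  entries : ∀ en ∈ R, EntryOK D h a d M u en

/-- `rem` steps suffice for the remaining `n` instructions. -/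
def Enough (h : Heap S) (M : ℕ) {m : ℕ} (env : Fin m → Addr) (code : Code S m) (n rem : ℕ) :
    Prop :=
  n * unitCost S M ≤ rem ∨ ∃ x k, code = .readStrict x k ∧ IsImmediate h (env x) ∧
    (n - 1) * unitCost S M + 2 ≤ rem

/-- The LLX on `x` that began with version `w` will succeed, or the number of restarts has
decreased. -/
def LLXOK (D : SeqDef S) (h : Heap S) (a : Addr) (d : Deferred S Addr) (M u : ℕ) (x : Addr)
    (w : ℕ) : Prop :=
  ∀ cell, h[x]? = some cell → cell.version ≠ w → ProgressLt D h a d M u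

/-- The `u` attempts that may still follow are reserved in full besides the current one. The `B + 1`
in the LLX phases accounts for the step that began the LLX. -/
def PhaseBudget (D : SeqDef S) (h : Heap S) (a : Addr) (d : Deferred S Addr) (Q : Set Addr)
    (M u B : ℕ) : Phase S → Prop
  | .start => u * attemptCost S M + attemptCost S M ≤ B
  | .rootLLX w => u * attemptCost S M + attemptCost S M ≤ B + 1 ∧ LLXOK D h a d M u a w
  | .run R env code => ∃ n rem, Executes D h a d Q M u R env code n ∧ Enough h M env code n rem ∧
      u * attemptCost S M + rem ≤ B
  | .childLLX R env code w => ∃ n rem, Executes D h a d Q M u R env code n ∧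
      Enough h M env code n rem ∧ u * attemptCost S M + rem ≤ B + 1 ∧
      ∀ x, code.readVar = some x → LLXOK D h a d M u (env x) w

structure Ghost.OK (D : SeqDef S) (h : Heap S) (g : Ghost S) : Prop where
  task : TaskSound D h g.frame.task g.level
  progress : Progress D h g.frame.addr g.frame.task g.level g.retries
  not_own : g.frame.addr ∉ g.own

/-- The innermost activation. -/
structure Ghost.TopOK (D : SeqDef S) (h : Heap S) (g : Ghost S) : Prop extends g.OK D h where
  phase : PhaseBudget D h g.frame.addr g.frame.task g.own g.level g.retries g.budget g.frame.phase

/-- An activation that waits until the node `X` is forced. -/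
structure Ghost.BelowOK (D : SeqDef S) (h : Heap S) (X : Addr) (g : Ghost S) : Prop
    extends g.OK D h where
  waits : ∃ (m : ℕ) (R : ReadSet) (env : Fin m → Addr) (x : Fin m)
    (k : (c : Fin S.numCases) → Option S.Elem → Bool → Code S (m + S.arity c)) (n : ℕ),
    g.frame.phase = .run R env (.readStrict x k) ∧ env x = X ∧
    Executes D h g.frame.addr g.frame.task g.own g.level g.retries R env (.readStrict x k) n ∧
    (IsDeferred h X ∨ ProgressLt D h g.frame.addr g.frame.task g.level g.retries) ∧
    g.retries * attemptCost S g.level + ((n - 1) * unitCost S g.level + 2) ≤ g.budget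

def BelowShape (D : SeqDef S) (h : Heap S) : Addr → List (Ghost S) → Prop
  | _, [] => True
  | X, g :: L => g.BelowOK D h X ∧ BelowShape D h g.frame.addr L

def StackShape (D : SeqDef S) (h : Heap S) : List (Ghost S) → Prop
  | [] => True
  | g :: L => g.TopOK D h ∧ BelowShape D h g.frame.addr L

/-- A change of the heap, seen by an activation whose own cells were `Q` and are now `Q'`. -/
structure Change (D : SeqDef S) (ord : Addr → ℚ) (h h' : Heap S) (Q Q' : Set Addr) : Prop where
  heapOK : HeapOK ord h
  evolves : Evolves h h'
  denotes : ∀ (t : Term S) (r : SeqTree S) (M : ℕ), Denotes D h t r M → Denotes D h' t r M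
  ref : ∀ (t : Term S) (a : Addr), Ref D Q h t a → Ref D Q' h' t a

theorem Change.append {Q Q' : Set Addr} (hh : HeapOK ord h) (c : Cell S)
    (hQ : ∀ b < h.length, b ∈ Q → b ∈ Q') : Change D ord h (h ++ [c]) Q Q' where
  heapOK := hh
  evolves := .append h c
  denotes := fun _ _ _ hd => hd.of_extends fun _ _ ha => getElem?_append_fresh c ha
  ref := fun _ _ hr => hr.append hQ

theorem Change.resolves {Q Q₁ : Set Addr} (hh : HeapOK ord h) {z : Addr} {d : Deferred S Addr}
    {y : Imm S Addr} (hs : Resolves D Q₁ h h' z d y) (hz : z ∈ Q → Q₁ ⊆ Q) :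
    Change D ord h h' Q Q where
  heapOK := hh
  evolves := hs.evolves
  denotes := fun _ _ _ hd => hs.denotes hd
  ref := fun _ _ hr => hs.ref hz hr

/-! ### Stability of the bookkeeping under changes of the heap -/

section Change

variable {a : Addr} {d : Deferred S Addr} {Q Q' : Set Addr} {M u m : ℕ}

theorem Evolves.modified (he : Evolves h h') {x : Addr} {cell cell' : Cell S}
    (hx : h[x]? = some cell) (hx' : h'[x]? = some cell') (hne : cell'.version ≠ cell.version) :
    IsDeferred h x ∧ IsImmediate h' x := by
  rcases he x cell hx with h1 | ⟨d, h1, c, y, h2, h3, -⟩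
  · rw [hx'] at h1
    cases h1
    exact absurd rfl hne
  · exact ⟨⟨_, _, hx, h1⟩, ⟨_, _, h2, h3⟩⟩

/-- Cells read strictly are immediate when they enter the read-set and cannot change. An entry can
thus become outdated only at the node to be forced or at a lazily read node, and both lower the
potential. -/
theorem EntryOK.change (hc : Change D ord h h' Q Q') (ha : a < h.length)
    (hp : Progress D h a d M u) {en : Addr × ℕ} (he : EntryOK D h a d M u en) :
    EntryOK D h' a d M u en := by
  obtain ⟨cell, h1, h2, h3⟩ := he
  have h4 : ProgressLt D h a d M u → ProgressLt D h' a d M u :=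
    fun h5 => h5.evolves hc.heapOK hc.evolves ha
  rcases hc.evolves _ _ h1 with h5 | ⟨d', h5, cell', y, h6, h7, h8, h9⟩
  · refine ⟨cell, h5, h2.imp id h4, fun h6 => ?_⟩
    exact (h3 (hc.evolves.isDeferred (lt_length_of_getElem? h1) h6)).imp id
      fun h7 => h7.evolves hc.evolves
  · have hd : IsDeferred h en.1 := ⟨_, _, h1, h5⟩
    have hi : ¬ IsDeferred h' en.1 := IsImmediate.not_isDeferred ⟨_, _, h6, h7⟩
    refine ⟨cell', h6, Or.inr ?_, fun h10 => absurd h10 hi⟩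
    rcases h3 hd with h10 | h10
    · rw [h10] at hd hi
      exact hp.root_modified hc.heapOK hc.evolves hd hi
    · exact hp.lazy_modified hc.heapOK hc.evolves ha h10 hd hi

theorem Executes.change (hc : Change D ord h h' Q Q') (ha : a < h.length)
    (hp : Progress D h a d M u) {R : ReadSet} {env : Fin m → Addr} {code : Code S m} {n : ℕ}
    (he : Executes D h a d Q M u R env code n) : Executes D h' a d Q' M u R env code n where
  follows := by
    obtain ⟨l, h1, h2⟩ := he.follows
    exact ⟨l, h1.trans hc.evolves hc.ref, h2⟩
  sound := by
    obtain ⟨e, r, h1, h2⟩ := he.sound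
    exact ⟨e, r, fun i => hc.denotes _ _ _ (h1 i), h2⟩
  lazyOK := he.lazyOK.evolves hc.evolves
  entries := fun en hen => (he.entries en hen).change hc ha hp

theorem Executes.pos {R : ReadSet} {env : Fin m → Addr} {code : Code S m} {n : ℕ}
    (he : Executes D h a d Q M u R env code n) : 1 ≤ n := by
  obtain ⟨e, r, h1, h2⟩ := he.sound
  exact h2.pos

theorem Executes.strict_modified (hc : Change D ord h h' Q Q') (ha : a < h.length)
    (hp : Progress D h a d M u) {R : ReadSet} {env : Fin m → Addr} {x : Fin m}
    {k : (c : Fin S.numCases) → Option S.Elem → Bool → Code S (m + S.arity c)} {n : ℕ}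
    (he : Executes D h a d Q M u R env (.readStrict x k) n) (hx : env x ∉ Q)
    (hd : IsDeferred h (env x)) (hi : IsImmediate h' (env x)) : ProgressLt D h' a d M u := by
  obtain ⟨l, h1, h2⟩ := he.follows
  have := he.pos
  exact hp.strict_modified hc.heapOK hc.evolves ha h1 (by omega) hx hd hi

theorem Enough.evolves (he : Evolves h h') {env : Fin m → Addr} {code : Code S m} {n rem : ℕ}
    (hen : Enough h M env code n rem) : Enough h' M env code n rem := by
  rcases hen with h1 | ⟨x, k, h1, h2, h3⟩
  · exact Or.inl h1
  · exact Or.inr ⟨x, k, h1, h2.evolves he, h3⟩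

theorem Enough.two_le {env : Fin m → Addr} {code : Code S m} {n rem : ℕ} (hn : 1 ≤ n)
    (hen : Enough h M env code n rem) : 2 ≤ rem := by
  rcases hen with h1 | ⟨x, k, h1, h2, h3⟩
  · have : 1 * unitCost S M ≤ n * unitCost S M := Nat.mul_le_mul_right _ hn
    unfold unitCost at *
    omega
  · omega

theorem LLXOK.change (hc : Change D ord h h' Q Q') (ha : a < h.length) {x : Addr} {w : ℕ}
    (hx : x < h.length)
    (hmod : IsDeferred h x → IsImmediate h' x → ProgressLt D h' a d M u)
    (hl : LLXOK D h a d M u x w) : LLXOK D h' a d M u x w := by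
  intro cell' h1 h2
  obtain ⟨cell, h3⟩ := List.getElem?_of_lt hx
  by_cases h4 : cell'.version = cell.version
  · exact (hl cell h3 (h4 ▸ h2)).evolves hc.heapOK hc.evolves ha
  · obtain ⟨h5, h6⟩ := hc.evolves.modified h3 h1 h4
    exact hmod h5 h6

end Change

theorem Ghost.OK.change {g g' : Ghost S} (hc : Change D ord h h' g.own g'.own)
    (hf : FrameOK D ord h g.frame) (hfr : g'.frame = g.frame) (hlev : g'.level = g.level)
    (hret : g'.retries = g.retries) (hown : g'.frame.addr ∈ g'.own → g.frame.addr ∈ g.own)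
    (hg : g.OK D h) : g'.OK D h' where
  task := by
    rw [hfr, hlev]
    exact hg.task.of_denotes hc.denotes
  progress := by
    rw [hfr, hlev, hret]
    exact hg.progress.evolves hc.heapOK hc.evolves hf.lt_length
  not_own := fun h1 => hg.not_own (hown h1)

/-- The innermost activation of a thread, when another thread changes the heap. -/
theorem Ghost.TopOK.change {g : Ghost S} (hc : Change D ord h h' g.own g.own)
    (hf : FrameOK D ord h g.frame) (hmod : ∀ b ∈ g.own, IsDeferred h b → IsDeferred h' b)
    (hg : g.TopOK D h) : g.TopOK D h' := by
  have ha := hf.lt_length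
  refine ⟨hg.toOK.change hc hf rfl rfl rfl id, ?_⟩
  have h1 := hg.phase
  have h2 := hf.refs
  unfold Frame.refs at h2
  generalize g.frame.phase = ph at h1 h2
  cases ph with
  | start => exact h1
  | rootLLX w =>
    exact ⟨h1.1, h1.2.change hc ha ha fun h2 h3 =>
      hg.progress.root_modified hc.heapOK hc.evolves h2 h3.not_isDeferred⟩
  | run R env code =>
    obtain ⟨n, rem, h3, h4, h5⟩ := h1
    exact ⟨n, rem, h3.change hc ha hg.progress, h4.evolves hc.evolves, h5⟩
  | childLLX R env code w =>
    obtain ⟨n, rem, h3, h4, h5, h6⟩ := h1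
    refine ⟨n, rem, h3.change hc ha hg.progress, h4.evolves hc.evolves, h5, fun x hx => ?_⟩
    refine (h6 x hx).change hc ha (h2 _ (Or.inr ⟨x, rfl⟩)).1 fun h7 h8 => ?_
    cases code with
    | readStrict x' k =>
      cases hx
      exact h3.strict_modified hc ha hg.progress
        (fun h9 => h8.not_isDeferred (hmod _ h9 h7)) h7 h8
    | readLazy x' k =>
      cases hx
      exact hg.progress.lazy_modified hc.heapOK hc.evolves ha h3.lazyOK.target h7 h8.not_isDeferred
    | alloc y k => cases hx
    | ret y => cases hx

/-- If the awaited node is forced, it was not a private cell by `hmod`, so the waiting activation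
gains the progress that pays for its later restart. -/
theorem Ghost.BelowOK.change {X : Addr} {g g' : Ghost S} (hc : Change D ord h h' g.own g'.own)
    (hf : FrameOK D ord h g.frame) (hfr : g'.frame = g.frame) (hlev : g'.level = g.level)
    (hret : g'.retries = g.retries) (hbud : g'.budget = g.budget)
    (hown : g'.frame.addr ∈ g'.own → g.frame.addr ∈ g.own)
    (hmod : X ∈ g.own → IsDeferred h X → IsDeferred h' X)
    (hg : g.BelowOK D h X) : g'.BelowOK D h' X := by
  have ha := hf.lt_length
  refine ⟨hg.toOK.change hc hf hfr hlev hret hown, ?_⟩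
  obtain ⟨m, R, env, x, k, n, h1, rfl, h2, h3, h4⟩ := hg.waits
  rw [hfr, hlev, hret, hbud]
  refine ⟨m, R, env, x, k, n, h1, rfl, h2.change hc ha hg.progress, ?_, h4⟩
  rcases h3 with h3 | h3
  · by_cases hd : IsDeferred h' (env x)
    · exact Or.inl hd
    · refine Or.inr (h2.strict_modified hc ha hg.progress (fun h5 => hd (hmod h5 h3)) h3 ?_)
      obtain ⟨cell, d, h5, h6⟩ := h3
      rcases hc.evolves _ _ h5 with h7 | ⟨_, _, cell', y, h7, h8, -⟩
      · exact absurd ⟨_, _, h7, h6⟩ hd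
      · exact ⟨_, _, h7, h8⟩
  · exact Or.inr (h3.evolves hc.heapOK hc.evolves ha)

/-- The predicate `T` carries information about the awaited node outwards along the stack, for
instance that its rank exceeds that of the node just resolved. -/
theorem BelowShape.map {f : Ghost S → Ghost S} (hfr : ∀ g, (f g).frame = g.frame)
    {T : Addr → Prop} {L : List (Ghost S)} :
    ∀ {X : Addr}, BelowShape D h X L → T X →
      (∀ g ∈ L, ∀ X, T X → g.BelowOK D h X → (f g).BelowOK D h' X ∧ T g.frame.addr) →
      BelowShape D h' X (L.map f) := by
  induction L with
  | nil => exact fun _ _ _ => trivial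
  | cons g L ih =>
    intro X hs hX hT
    obtain ⟨h1, h2⟩ := hT g List.mem_cons_self X hX hs.1
    refine ⟨h1, ?_⟩
    rw [hfr]
    exact ih hs.2 h2 fun g' hg' => hT g' (List.mem_cons_of_mem _ hg')

/-- An activation that has to restart. -/
def Ghost.restart (g : Ghost S) (u : ℕ) : Ghost S :=
  ⟨⟨g.frame.addr, g.frame.task, .start⟩, ∅, g.level, u,
    u * attemptCost S g.level + attemptCost S g.level⟩

theorem Ghost.OK.restart {g : Ghost S} (hg : g.OK D h)
    (hp : ProgressLt D h g.frame.addr g.frame.task g.level g.retries) :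
    ∃ u, (g.restart u).TopOK D h ∧ (g.restart u).budget ≤ g.retries * attemptCost S g.level := by
  obtain ⟨u, h1, h2⟩ := hp
  refine ⟨u, ⟨⟨hg.task, h2, Set.notMem_empty _⟩, le_rfl⟩, ?_⟩
  calc u * attemptCost S g.level + attemptCost S g.level = (u + 1) * attemptCost S g.level := by
        ring
    _ ≤ g.retries * attemptCost S g.level := Nat.mul_le_mul_right _ h1

end Ghost

/-! ### The cells that only one thread knows -/

section Private

variable {S : TreeSig.{u, v}} {D : SeqDef S} {P : ℕ} {C C' : Config S P} {ord : Addr → ℚ}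
  {p : Fin P}

/-- The cells in `Q` can be reached only from cells in `Q` and through the thread `p`. -/
structure Isolated (C : Config S P) (p : Fin P) (Q : Set Addr) : Prop where
  lt : ∀ b ∈ Q, b < C.heap.length
  heap : HeapAvoids C.heap Q
  threads : ∀ q ≠ p, ∀ fr ∈ C.threads q, FrameAvoids fr Q
  roots : ∀ a ∈ C.roots, a ∉ Q

/-- The relation between the own cells of an inner activation and of an outer one. -/
def Above (g g' : Ghost S) : Prop :=
  (g.frame.addr ∉ g'.own → FrameAvoids g.frame g'.own) ∧ (g.frame.addr ∈ g'.own → g.own ⊆ g'.own)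

structure StackInv (D : SeqDef S) (C : Config S P) (p : Fin P) (L : List (Ghost S)) : Prop where
  threads : C.threads p = L.map Ghost.frame
  isolated : ∀ g ∈ L, Isolated C p g.own
  above : L.Pairwise Above
  shape : StackShape D C.heap L

def totalBudget (L : List (Ghost S)) : ℕ := (L.map Ghost.budget).sum

theorem Isolated.accessible {Q : Set Addr} (hi : Isolated C p Q) {a : Addr}
    (ha : C.Accessible a) : a ∉ Q := by
  induction ha with
  | root ha => exact hi.roots _ ha
  | child _ hc hb ih => exact hi.heap _ _ hc ih _ hb

/-- A client action of another thread uses only accessible nodes, and these avoid `Q`; its steps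
inside `force` are covered by `ForceStep.avoids`. -/
theorem Isolated.step_other {Q : Set Addr} (hi : Isolated C p Q) {q : Fin P} (hq : q ≠ p)
    {e : Event} (hs : Step D C q e C') : Isolated C' p Q := by
  cases hs with
  | force hs =>
    obtain ⟨h1, h2⟩ := hs.avoids hi.lt hi.heap (hi.threads q hq)
    refine ⟨fun b hb => (hi.lt b hb).trans_le hs.length_le, h1, fun q' hq' fr hfr => ?_, hi.roots⟩
    by_cases hqq : q' = q
    · subst hqq
      exact h2 fr (by simpa using hfr)
    · exact hi.threads q' hq' fr (by simpa [hqq] using hfr)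
  | @invoke a cell d hp ha hc hd =>
    refine ⟨hi.lt, hi.heap, fun q' hq' fr hfr => ?_, hi.roots⟩
    by_cases hqq : q' = q
    · subst hqq
      obtain rfl : fr = ⟨a, d, .start⟩ := by simpa using hfr
      exact hi.heap.deferred hc hd (hi.accessible ha)
    · exact hi.threads q' hq' fr (by simpa [hqq] using hfr)
  | @post x hp hx =>
    refine ⟨fun b hb => (hi.lt b hb).trans_le (by simp),
      hi.heap.append fun _ b hb => hi.accessible (hx b hb), hi.threads, fun a ha => ?_⟩
    rcases ha with rfl | ha
    · exact fun h1 => lt_irrefl _ (hi.lt _ h1)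
    · exact hi.roots a ha

theorem StackShape.change {h h' : Heap S} {L : List (Ghost S)}
    (hf : ∀ g ∈ L, FrameOK D ord h g.frame)
    (hc : ∀ g ∈ L, Change D ord h h' g.own g.own ∧
      ∀ b ∈ g.own, IsDeferred h b → IsDeferred h' b)
    (hs : StackShape D h L) : StackShape D h' L := by
  cases L with
  | nil => trivial
  | cons g L =>
    refine ⟨hs.1.change (hc g List.mem_cons_self).1 (hf g List.mem_cons_self)
      (hc g List.mem_cons_self).2, ?_⟩
    rw [← List.map_id L]
    refine BelowShape.map (fun _ => rfl) (T := fun _ => True) hs.2 trivial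
      fun g' hg' X _ hb => ⟨?_, trivial⟩
    have hg := List.mem_cons_of_mem g hg'
    exact hb.change (hc g' hg).1 (hf g' hg) rfl rfl rfl rfl id ((hc g' hg).2 X)

theorem Resolves.isDeferred {h h' : Heap S} {Q : Set Addr} {z : Addr} {d : Deferred S Addr}
    {y : Imm S Addr} (hs : Resolves D Q h h' z d y) {b : Addr} (hb : b ≠ z)
    (hd : IsDeferred h b) : IsDeferred h' b := by
  obtain ⟨cell, d', h1, h2⟩ := hd
  exact ⟨cell, d', by rw [hs.other b hb, h1], h2⟩

theorem IsDeferred.append {h : Heap S} {b : Addr} (c : Cell S) (hd : IsDeferred h b) :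
    IsDeferred (h ++ [c]) b := by
  obtain ⟨cell, d', h1, h2⟩ := hd
  exact ⟨cell, d', getElem?_append_fresh c h1, h2⟩

theorem StackInv.frameOK (hC : ConfigOK D ord C) {L : List (Ghost S)} (hL : StackInv D C p L) :
    ∀ g ∈ L, FrameOK D ord C.heap g.frame := by
  intro g hg
  refine hC.frames p _ ?_
  rw [hL.threads]
  exact List.mem_map_of_mem hg

/-- The ghost list `L` is unchanged, budgets included: interference costs nothing at the moment it
happens, since the restarts it may cause are already reserved. -/
theorem StackInv.step_other (hC : ConfigOK D ord C) {L : List (Ghost S)} (hL : StackInv D C p L)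
    {q : Fin P} (hq : q ≠ p) {e : Event} (hs : Step D C q e C') : StackInv D C' p L := by
  have hf := hL.frameOK hC
  have happend : ∀ (c : Cell S), StackShape D (C.heap ++ [c]) L := fun c =>
    hL.shape.change hf fun g _ => ⟨.append hC.heap c fun _ _ h1 => h1, fun b _ h1 => h1.append c⟩
  refine ⟨?_, fun g hg => (hL.isolated g hg).step_other hq hs, hL.above, ?_⟩
  · cases hs with
    | force hs => simpa [Ne.symm hq] using hL.threads
    | invoke hp ha hc hd => simpa [Ne.symm hq] using hL.threads
    | post hp hx => exact hL.threads
  · cases hs with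
    | force hs =>
      rcases hs.change (hC.frames q) with h1 | ⟨c, h1⟩ | ⟨fr, hfr, Q, y, h1⟩
      · simp only [h1]
        exact hL.shape
      · simp only [h1]
        exact happend c
      · refine hL.shape.change hf fun g hg => ?_
        -- Privacy enters here: another thread never resolves a cell of the current attempt.
        have hz : fr.addr ∉ g.own := ((hL.isolated g hg).threads q hq fr hfr).1
        exact ⟨.resolves hC.heap h1 fun h2 => absurd h2 hz,
          fun b hb hd => h1.isDeferred (fun h2 => hz (h2 ▸ hb)) hd⟩
    | invoke hp ha hc hd => exact hL.shape
    | post hp hx => exact happend _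

/-! ### The steps of the thread itself -/

theorem Isolated.update {Q : Set Addr} (hi : Isolated C p Q) (st : Stack S) :
    Isolated ⟨C.heap, C.roots, Function.update C.threads p st⟩ p Q where
  lt := hi.lt
  heap := hi.heap
  threads := fun q hq fr hfr => hi.threads q hq fr (by simpa [hq] using hfr)
  roots := hi.roots

theorem Isolated.empty (C : Config S P) (p : Fin P) : Isolated C p ∅ where
  lt := fun _ hb => hb.elim
  heap := fun _ _ _ _ _ _ => Set.notMem_empty _
  threads := fun _ _ _ _ => ⟨Set.notMem_empty _, fun _ _ => Set.notMem_empty _⟩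
  roots := fun _ _ => Set.notMem_empty _

/-- The innermost activation changes without changing the heap. -/
theorem StackInv.replace_top {g g' : Ghost S} {L : List (Ghost S)}
    (hL : StackInv D C p (g :: L)) (haddr : g'.frame.addr = g.frame.addr)
    (hown : g'.own = g.own ∨ g'.own = ∅)
    (hrefs : ∀ Q, HeapAvoids C.heap Q → FrameAvoids g.frame Q → ∀ b ∈ g'.frame.refs, b ∉ Q)
    (htop : g'.TopOK D C.heap) :
    StackInv D ⟨C.heap, C.roots, Function.update C.threads p (g'.frame :: L.map Ghost.frame)⟩ p
      (g' :: L) where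
  threads := by simp
  isolated := by
    intro g₁ hg₁
    rcases List.mem_cons.1 hg₁ with rfl | hg₁
    · rcases hown with h1 | h1
      · rw [h1]
        exact (hL.isolated g List.mem_cons_self).update _
      · rw [h1]
        exact Isolated.empty _ p
    · exact (hL.isolated g₁ (List.mem_cons_of_mem _ hg₁)).update _
  above := by
    obtain ⟨h1, h2⟩ := List.pairwise_cons.1 hL.above
    refine List.pairwise_cons.2 ⟨fun g₁ hg₁ => ⟨fun h3 => ?_, fun h3 => ?_⟩, h2⟩
    · refine ⟨h3, hrefs _ (hL.isolated g₁ (List.mem_cons_of_mem _ hg₁)).heap ?_⟩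
      exact (h1 g₁ hg₁).1 (haddr ▸ h3)
    · rcases hown with h4 | h4
      · rw [h4]
        exact (h1 g₁ hg₁).2 (haddr ▸ h3)
      · rw [h4]
        exact Set.empty_subset _
  shape := ⟨htop, by rw [haddr]; exact hL.shape.2⟩

theorem totalBudget_cons (g : Ghost S) (L : List (Ghost S)) :
    totalBudget (g :: L) = g.budget + totalBudget L := by
  simp [totalBudget]

/-- The innermost activation restarts. -/
theorem StackInv.restart {g : Ghost S} {L : List (Ghost S)} (hL : StackInv D C p (g :: L))
    (hp : ProgressLt D C.heap g.frame.addr g.frame.task g.level g.retries)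
    (hb : g.retries * attemptCost S g.level < g.budget) :
    ∃ L', StackInv D ⟨C.heap, C.roots, Function.update C.threads p
        (⟨g.frame.addr, g.frame.task, .start⟩ :: L.map Ghost.frame)⟩ p L' ∧
      totalBudget L' < totalBudget (g :: L) := by
  obtain ⟨u, h1, h2⟩ := hL.shape.1.toOK.restart hp
  refine ⟨g.restart u :: L, hL.replace_top (g' := g.restart u) rfl (Or.inr rfl) ?_ h1, ?_⟩
  · exact fun Q _ hQ b hb => hQ.2 b (Frame.refs_start_subset hb)
  · rw [totalBudget_cons, totalBudget_cons]
    omega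

/-- The innermost activation finds that its node is forced already. -/
theorem StackInv.escape {g : Ghost S} {L : List (Ghost S)} (hL : StackInv D C p (g :: L))
    (hd : ¬ IsDeferred C.heap g.frame.addr) (hb : 0 < g.budget) :
    ∃ L', StackInv D ⟨C.heap, C.roots, Function.update C.threads p
        (Stack.escape (L.map Ghost.frame))⟩ p L' ∧ totalBudget L' < totalBudget (g :: L) := by
  cases L with
  | nil =>
    refine ⟨[], ⟨by simp [Stack.escape], by simp, .nil, trivial⟩, ?_⟩
    simpa [totalBudget] using hb
  | cons g₁ L =>
    obtain ⟨hbelow, hL₁⟩ := hL.shape.2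
    obtain ⟨m, R, env, x, k, n, h1, h2, h3, h4, h5⟩ := hbelow.waits
    -- The caller waited for a node that is no longer deferred, so its potential has dropped
    -- already. The new attempt is paid from its reserve for restarts.
    obtain ⟨u, h6, h7⟩ := hbelow.toOK.restart (h4.resolve_left hd)
    obtain ⟨h8, h9⟩ := List.pairwise_cons.1 (List.pairwise_cons.1 hL.above).2
    refine ⟨g₁.restart u :: L, ⟨by simp [Stack.escape, Ghost.restart], ?_, ?_, h6, hL₁⟩, ?_⟩
    · intro g₂ hg₂
      rcases List.mem_cons.1 hg₂ with rfl | hg₂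
      · exact Isolated.empty _ p
      · exact (hL.isolated g₂ (by simp [hg₂])).update _
    · refine List.pairwise_cons.2 ⟨fun g₂ hg₂ => ⟨fun h10 => ?_, fun _ => Set.empty_subset _⟩, h9⟩
      have h11 := (h8 g₂ hg₂).1 h10
      exact ⟨h10, fun b hb => h11.2 b (Frame.refs_start_subset hb)⟩
    · simp only [totalBudget_cons]
      omega

theorem exists_eq_cons_of_map_frame {L : List (Ghost S)} {fr : Frame S} {rest : Stack S}
    (hL : L.map Ghost.frame = fr :: rest) :
    ∃ Q M u B L₀, L = ⟨fr, Q, M, u, B⟩ :: L₀ ∧ rest = L₀.map Ghost.frame := by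
  obtain ⟨⟨fr', Q, M, u, B⟩, L₀, rfl, rfl, rfl⟩ := List.map_eq_cons_iff.1 hL
  exact ⟨Q, M, u, B, L₀, rfl, rfl⟩

theorem Sound.fresh {h : Heap S} {M m n : ℕ} {env : Fin m → Addr} {e : Fin m → Value S}
    {x : Content S (Fin m)} {k : Code S (m + 1)} {r : SeqTree S} {a : Addr}
    (hs : Sound D M e (.alloc x k) r n) (ha : h[a]? = some (Cell.fresh (x.map env)))
    (he : ∀ i, Denotes D h (.addr (env i)) (e i).1 (e i).2) :
    ∃ e' n', n = n' + 1 ∧ Sound D M e' k r n' ∧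
      ∀ i, Denotes D h (.addr (Fin.snoc (α := fun _ => Addr) env a i)) (e' i).1 (e' i).2 := by
  cases hs with
  | @allocImm _ _ l _ y _ _ n hl hk =>
    refine ⟨_, n, rfl, hk, forall_snoc (R := fun b (w : Value S) => Denotes D h (.addr b) w.1 w.2)
      he ?_⟩
    exact .addrImm (y := y.map env) ha rfl fun i => (he _).mono (hl i)
  | @allocDeferred _ _ l _ d _ _ r₁ n n₁ hd hn hk =>
    refine ⟨_, n, rfl, hk, forall_snoc (R := fun b (w : Value S) => Denotes D h (.addr b) w.1 w.2)
      he ?_⟩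
    cases d with
    | op j arg ch =>
      exact .addrDeferred (d := .op j arg fun i => env (ch i)) ha rfl (fun i => he _) hd hn
    | snapshot c =>
      exact .addrDeferred (d := .snapshot (env c)) ha rfl (fun i => he _) hd hn

theorem HeapOK.not_isDeferred_of_final {h : Heap S} (hh : HeapOK ord h) {a : Addr}
    {cell : Cell S} (ha : h[a]? = some cell) (hf : cell.final = true) : ¬ IsDeferred h a := by
  rintro ⟨cell', d, h1, h2⟩
  rw [ha] at h1
  cases h1
  rw [(hh.unmodified _ _ _ ha h2).2] at hf
  cases hf

theorem two_le_attemptCost (S : TreeSig.{u, v}) (M : ℕ) : 2 ≤ attemptCost S M := by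
  unfold attemptCost
  omega

theorem le_unitCost (S : TreeSig.{u, v}) (M : ℕ) : 4 ≤ unitCost S M := by
  unfold unitCost
  omega

/-- All references in existing cells and frames are below the length of the heap, so nothing outside
`p` can refer to the new address. -/
theorem Isolated.insert_fresh (hC : ConfigOK D ord C) {Q : Set Addr} (hi : Isolated C p Q)
    (x : Content S Addr) (st : Stack S) :
    Isolated ⟨C.heap ++ [Cell.fresh x], C.roots, Function.update C.threads p st⟩ p
      (insert C.heap.length Q) where
  lt := by
    intro b hb
    rcases hb with rfl | hb
    · simp
    · exact (hi.lt b hb).trans_le (by simp)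
  heap := by
    refine HeapAvoids.append ?_ fun h1 => absurd (Set.mem_insert _ _) h1
    intro a cell ha haQ b hb hbQ
    rcases hbQ with rfl | hbQ
    · exact lt_irrefl _ (hC.heap.refs a cell ha _ hb).1
    · exact hi.heap a cell ha (fun h1 => haQ (Or.inr h1)) b hb hbQ
  threads := by
    intro q hq fr hfr
    have hfr' : fr ∈ C.threads q := by simpa [hq] using hfr
    have hf := hC.frames q fr hfr'
    obtain ⟨h1, h2⟩ := hi.threads q hq fr hfr'
    refine ⟨fun h3 => ?_, fun b hb h3 => ?_⟩
    · rcases h3 with h3 | h3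
      · exact hf.lt_length.ne h3
      · exact h1 h3
    · rcases h3 with h3 | h3
      · exact (hf.refs b hb).1.ne h3
      · exact h2 b hb h3
  roots := by
    intro a ha h3
    rcases h3 with h3 | h3
    · exact (hC.roots a ha).ne h3
    · exact hi.roots a ha h3

theorem Isolated.append_fresh {Q : Set Addr} (hi : Isolated C p Q)
    {x : Content S Addr} (hx : ∀ b ∈ x.refs, b ∉ Q) (st : Stack S) :
    Isolated ⟨C.heap ++ [Cell.fresh x], C.roots, Function.update C.threads p st⟩ p Q where
  lt := fun b hb => (hi.lt b hb).trans_le (by simp)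
  heap := hi.heap.append fun _ => hx
  threads := fun q hq fr hfr => hi.threads q hq fr (by simpa [hq] using hfr)
  roots := hi.roots

theorem Ghost.BelowOK.ord_lt {h : Heap S} {X : Addr} {g : Ghost S} (hg : g.BelowOK D h X)
    (hf : FrameOK D ord h g.frame) : ord X < ord g.frame.addr := by
  obtain ⟨m, R, env, x, k, n, h1, rfl, -⟩ := hg.waits
  refine (hf.refs _ (Or.inr ?_)).2
  rw [h1]
  exact ⟨x, rfl⟩

open Classical in
/-- The innermost activation, which forces the node `a`, allocates the cell `b`. -/
def Ghost.allocated (a b : Addr) (g : Ghost S) : Ghost S :=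
  { g with own := if a ∈ g.own then insert b g.own else g.own }

theorem Ghost.own_subset_allocated (a b : Addr) (g : Ghost S) :
    g.own ⊆ (g.allocated a b).own := by
  simp only [Ghost.allocated]
  split
  · exact Set.subset_insert _ _
  · exact subset_rfl

theorem Ghost.mem_allocated {a b c : Addr} {g : Ghost S} (hc : c ∈ (g.allocated a b).own) :
    c = b ∨ c ∈ g.own := by
  simp only [Ghost.allocated] at hc
  split at hc
  · exact hc
  · exact Or.inr hc

/-- An outer activation has to regard the new cell as private exactly if `a` is private to it:
otherwise the cell does not refer to its private cells, and the result in `a` is public anyway. -/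
theorem StackInv.alloc (hC : ConfigOK D ord C) {a : Addr} {d : Deferred S Addr} {R : ReadSet}
    {m M u B : ℕ} {Q : Set Addr} {env : Fin m → Addr} {x : Content S (Fin m)} {k : Code S (m + 1)}
    {L : List (Ghost S)}
    (hL : StackInv D C p (⟨⟨a, d, .run R env (.alloc x k)⟩, Q, M, u, B⟩ :: L)) :
    ∃ L', StackInv D ⟨C.heap ++ [Cell.fresh (x.map env)], C.roots, Function.update C.threads p
        (⟨a, d, .run R (Fin.snoc (α := fun _ => Addr) env C.heap.length) k⟩ ::
          L.map Ghost.frame)⟩ p L' ∧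
      totalBudget L' < totalBudget (⟨⟨a, d, .run R env (.alloc x k)⟩, Q, M, u, B⟩ :: L) := by
  have hf := hL.frameOK hC
  obtain ⟨hf₁, hf₂⟩ := List.forall_mem_cons.1 hf
  obtain ⟨hi₁, hi₂⟩ := List.forall_mem_cons.1 hL.isolated
  obtain ⟨ha₁, ha₂⟩ := List.pairwise_cons.1 hL.above
  obtain ⟨⟨⟨htask, hprog, hnot⟩, hphase⟩, hbelow⟩ := hL.shape
  simp only at htask hprog hnot hphase hbelow
  have haL : a < C.heap.length := hf₁.lt_length
  have hx : ∀ Q', FrameAvoids (⟨a, d, .run R env (.alloc x k)⟩ : Frame S) Q' →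
      ∀ b ∈ (x.map env).refs, b ∉ Q' := by
    intro Q' hQ' b hb
    obtain ⟨i, -, rfl⟩ := Content.mem_refs_map hb
    exact hQ'.2 _ (Or.inr ⟨i, rfl⟩)
  have hchange : ∀ Q₁ Q₂ : Set Addr, Q₁ ⊆ Q₂ →
      Change D ord C.heap (C.heap ++ [Cell.fresh (x.map env)]) Q₁ Q₂ :=
    fun Q₁ Q₂ hQ => .append hC.heap _ fun b _ hb => hQ hb
  obtain ⟨n, rem, hex, hen, hB⟩ := hphase
  have hex' := hex.change (hchange Q Q subset_rfl) haL hprog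
  obtain ⟨e, r, he, hs⟩ := hex'.sound
  obtain ⟨e', n, rfl, hs', he'⟩ := hs.fresh (a := C.heap.length) (by simp) he
  have hrem : (n + 1) * unitCost S M ≤ rem := by
    rcases hen with h1 | ⟨_, _, h1, -⟩
    · exact h1
    · cases h1
  have hunit := le_unitCost S M
  rw [Nat.add_mul, Nat.one_mul] at hrem
  refine ⟨⟨⟨a, d, .run R (Fin.snoc (α := fun _ => Addr) env C.heap.length) k⟩,
    insert C.heap.length Q, M, u, B - 1⟩ :: L.map (Ghost.allocated a C.heap.length),
    ⟨?_, ?_, ?_, ⟨⟨?_, ?_, ?_⟩, ?_⟩, ?_⟩, ?_⟩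
  · simp [Function.comp_def, Ghost.allocated]
  · refine List.forall_mem_cons.2 ⟨hi₁.insert_fresh hC _ _, ?_⟩
    intro g' hg'
    obtain ⟨g, hg, rfl⟩ := List.mem_map.1 hg'
    simp only [Ghost.allocated]
    split
    next h1 => exact (hi₂ g hg).insert_fresh hC _ _
    next h1 => exact (hi₂ g hg).append_fresh (hx _ ((ha₁ g hg).1 h1)) _
  · refine List.pairwise_cons.2 ⟨?_, ?_⟩
    · intro g' hg'
      obtain ⟨g, hg, rfl⟩ := List.mem_map.1 hg'
      refine ⟨fun h1 => ?_, fun h1 => ?_⟩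
      · have h2 : a ∉ g.own := fun h3 => h1 (g.own_subset_allocated _ _ h3)
        have h3 := (ha₁ g hg).1 h2
        have h4 : (g.allocated a C.heap.length).own = g.own := by simp [Ghost.allocated, h2]
        rw [h4] at h1 ⊢
        refine ⟨h1, fun b hb => ?_⟩
        rcases hb with hb | hb
        · exact h3.2 b (Or.inl hb)
        · rcases mem_range_snoc hb with hb | rfl
          · exact h3.2 b (Or.inr hb)
          · exact fun h5 => lt_irrefl _ ((hi₂ g hg).lt _ h5)
      · have h2 : a ∈ g.own := (Ghost.mem_allocated h1).resolve_left haL.ne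
        have h4 : (g.allocated a C.heap.length).own = insert C.heap.length g.own := by
          simp [Ghost.allocated, h2]
        rw [h4]
        exact Set.insert_subset_insert ((ha₁ g hg).2 h2)
    · rw [List.pairwise_map]
      refine ha₂.imp_of_mem fun {g g'} hg hg' hgg => ⟨fun h1 => ?_, fun h1 => ?_⟩
      · have h2 := hgg.1 fun h3 => h1 (g'.own_subset_allocated _ _ h3)
        refine ⟨h1, fun b hb h3 => ?_⟩
        rcases Ghost.mem_allocated h3 with h3 | h3
        · exact ((hf₂ g hg).refs b hb).1.ne h3
        · exact h2.2 b hb h3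
      · have h2 := hgg.2 ((Ghost.mem_allocated h1).resolve_left (hf₂ g hg).lt_length.ne)
        intro b hb
        -- As `g.own ⊆ g'.own`, a new cell that enters `g.own` also enters `g'.own`, so the
        -- inclusion persists.
        by_cases h3 : a ∈ g.own
        · have h4 : (g'.allocated a C.heap.length).own = insert C.heap.length g'.own := by
            simp [Ghost.allocated, h2 h3]
          rw [h4]
          exact (Ghost.mem_allocated hb).imp id fun h5 => h2 h5
        · have h4 : (g.allocated a C.heap.length).own = g.own := by simp [Ghost.allocated, h3]
          rw [h4] at hb
          exact g'.own_subset_allocated _ _ (h2 hb)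
  · exact htask.of_denotes (hchange Q Q subset_rfl).denotes
  · exact hprog.evolves hC.heap (hchange Q Q subset_rfl).evolves haL
  · intro h1
    rcases h1 with h1 | h1
    · exact haL.ne h1
    · exact hnot h1
  · refine ⟨n, n * unitCost S M, ⟨?_, ⟨e', r, he', hs'⟩, hex'.lazyOK.alloc _, hex'.entries⟩,
      Or.inl le_rfl, ?_⟩
    · obtain ⟨l, h1, h2⟩ := hex.follows
      exact ⟨l + 1, h1.alloc (fun b _ hb => Set.mem_insert_of_mem _ hb) (Set.mem_insert _ _),
        show l + 1 + n ≤ codeBound S M by omega⟩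
    · simp only
      omega
  · refine BelowShape.map (f := Ghost.allocated a C.heap.length) (fun _ => rfl)
      (T := fun _ => True) hbelow trivial
      fun g hg X _ hb => ⟨?_, trivial⟩
    refine hb.change (hchange _ _ (g.own_subset_allocated _ _)) (hf₂ g hg) rfl rfl rfl rfl
      (fun h1 => (Ghost.mem_allocated h1).resolve_left (hf₂ g hg).lt_length.ne)
      fun _ hd => hd.append _
  · have h1 : totalBudget (L.map (Ghost.allocated a C.heap.length)) = totalBudget L := by
      simp [totalBudget, Function.comp_def, Ghost.allocated]
    simp only [totalBudget_cons, h1]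
    omega

/-- The finished activation is popped and its caller becomes the innermost one. If `a` is private to
an outer activation, so are all cells on which the result depends, by the second half of `Above`;
this is what `Change.resolves` requires. -/
theorem StackInv.scx (hC : ConfigOK D ord C) {a : Addr} {d : Deferred S Addr} {R : ReadSet}
    {m M u B : ℕ} {Q : Set Addr} {env : Fin m → Addr} {x : Imm S (Fin m)} {cell : Cell S}
    {L : List (Ghost S)} (ha : C.heap[a]? = some cell) (hR : R.Valid C.heap)
    (hL : StackInv D C p (⟨⟨a, d, .run R env (.ret x)⟩, Q, M, u, B⟩ :: L)) :
    ∃ L', StackInv D ⟨C.heap.set a ⟨.imm (x.map env), d.isSnapshot, cell.version + 1⟩, C.roots,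
        Function.update C.threads p (L.map Ghost.frame)⟩ p L' ∧
      totalBudget L' < totalBudget (⟨⟨a, d, .run R env (.ret x)⟩, Q, M, u, B⟩ :: L) := by
  have hf := hL.frameOK hC
  obtain ⟨hf₁, hf₂⟩ := List.forall_mem_cons.1 hf
  obtain ⟨hi₁, hi₂⟩ := List.forall_mem_cons.1 hL.isolated
  obtain ⟨ha₁, ha₂⟩ := List.pairwise_cons.1 hL.above
  obtain ⟨⟨⟨htask, hprog, hnot⟩, hphase⟩, hbelow⟩ := hL.shape
  simp only at htask hprog hnot hphase hbelow
  obtain ⟨n, rem, hex, hen, hB⟩ := hphase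
  obtain ⟨l, hfo, -⟩ := hex.follows
  have hs := hf₁.resolves ha hR hnot hfo
  have hchange : ∀ g ∈ L, Change D ord C.heap _ g.own g.own :=
    fun g hg => .resolves hC.heap hs (ha₁ g hg).2
  refine ⟨L, ⟨by simp, ?_, ha₂, ?_⟩, ?_⟩
  · intro g hg
    refine ⟨?_, ?_, ?_, (hi₂ g hg).roots⟩
    · simpa using (hi₂ g hg).lt
    · refine (hi₂ g hg).heap.set fun h1 b hb => ?_
      obtain ⟨i, rfl⟩ := hb
      exact ((ha₁ g hg).1 h1).2 _ (Or.inr ⟨_, rfl⟩)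
    · exact fun q hq fr hfr => (hi₂ g hg).threads q hq fr (by simpa [hq] using hfr)
  · cases L with
    | nil => trivial
    | cons g L =>
      obtain ⟨hg, hbelow⟩ := hbelow
      obtain ⟨hf₂, hf₃⟩ := List.forall_mem_cons.1 hf₂
      obtain ⟨hc₂, hc₃⟩ := List.forall_mem_cons.1 hchange
      refine ⟨⟨hg.toOK.change hc₂ hf₂ rfl rfl rfl id, ?_⟩, ?_⟩
      · obtain ⟨m', R', env', x', k, n', h1, h2, h3, h4, h5⟩ := hg.waits
        rw [h1]
        -- The awaited node is now immediate, so reading it again takes just two steps; the second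
        -- alternative of `Enough` exists for this moment.
        refine ⟨n', _, h3.change hc₂ hf₂.lt_length hg.progress,
          Or.inr ⟨x', k, rfl, ?_, le_rfl⟩, h5⟩
        rw [h2]
        obtain ⟨cell', h6, h7, -⟩ := hs.after
        exact ⟨_, _, h6, h7⟩
      · have : BelowShape D _ g.frame.addr (L.map id) :=
          -- Ranks increase strictly outwards along the stack, so the nodes awaited further out
          -- differ from `a` and stay deferred.
          BelowShape.map (fun _ => rfl) (T := fun X => ord a < ord X) hbelow (hg.ord_lt hf₂)
            fun g' hg' X hX hb => ⟨hb.change (hc₃ g' hg') (hf₃ g' hg') rfl rfl rfl rfl id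
              fun _ => hs.isDeferred fun h1 => lt_irrefl _ (h1 ▸ hX),
              hX.trans (hb.ord_lt (hf₃ g' hg'))⟩
        rwa [List.map_id] at this
  · have := hen.two_le hex.pos
    simp only [totalBudget_cons]
    omega

end Private

/-! ### The theorem -/

section Main

variable {S : TreeSig.{u, v}} {D : SeqDef S} {P : ℕ} {C C' : Config S P} {ord : Addr → ℚ}
  {p : Fin P}

theorem LLXOK.self {h : Heap S} {a x : Addr} {d : Deferred S Addr} {M u : ℕ} {cell : Cell S}
    (hx : h[x]? = some cell) : LLXOK D h a d M u x cell.version := by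
  intro cell' h1 h2
  rw [hx] at h1
  cases h1
  exact absurd rfl h2

theorem EntryOK.add {h : Heap S} {a : Addr} {d : Deferred S Addr} {M u : ℕ} {R : ReadSet}
    {x : Addr} {cell : Cell S} (hR : ∀ en ∈ R, EntryOK D h a d M u en) (hx : h[x]? = some cell)
    (ht : IsDeferred h x → LazyTarget h d x) : ∀ en ∈ R.add x cell, EntryOK D h a d M u en := by
  unfold ReadSet.add
  split
  · exact hR
  · exact List.forall_mem_cons.2 ⟨⟨cell, hx, Or.inl rfl, fun h1 => Or.inr (ht h1)⟩, hR⟩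

/-- The two steps of the LLX on the node to be forced have consumed the summand 2 of `attemptCost`;
the remainder covers the code. -/
theorem PhaseBudget.start_begin {h : Heap S} {a : Addr} {d : Deferred S Addr} {Q : Set Addr}
    {M u B : ℕ} {cell : Cell S} (ha : h[a]? = some cell) (ht : TaskSound D h d M)
    (hB : u * attemptCost S M + attemptCost S M ≤ B + 2) :
    PhaseBudget D h a d Q M u B (.run [(a, cell.version)] d.env (d.code D)) := by
  obtain ⟨e, r, n, h1, h2, h3⟩ := ht
  have h4 : n * unitCost S M ≤ codeBound S M * unitCost S M := Nat.mul_le_mul_right _ h3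
  refine ⟨n, n * unitCost S M, ⟨⟨0, .init, by omega⟩, ⟨e, r, h1, h2⟩, .init, ?_⟩,
    Or.inl le_rfl, ?_⟩
  · intro en hen
    obtain rfl := List.mem_singleton.1 hen
    exact ⟨cell, ha, Or.inl rfl, fun _ => Or.inl rfl⟩
  · unfold attemptCost at hB ⊢
    omega

theorem TaskSound.topOK {h : Heap S} {a : Addr} {d : Deferred S Addr} {M : ℕ}
    (ht : TaskSound D h d M) :
    Ghost.TopOK D h ⟨⟨a, d, .start⟩, ∅, M, codeBound S M + maxArity S + 1,
      forceBound S (M + 1)⟩ :=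
  ⟨⟨ht, .init _ _ _, Set.notMem_empty _⟩, (forceBound_succ S M).ge⟩

/-- Every failure either turns a drop of the potential into a paid restart, or pops an activation
whose node has been forced; every other step is paid by the current attempt. -/
theorem StackInv.step_self (hC : ConfigOK D ord C) {L : List (Ghost S)} (hL : StackInv D C p L)
    {e : Event} {h' : Heap S} {st' : Stack S} (hs : ForceStep D C.heap (C.threads p) e h' st') :
    ∃ L', StackInv D ⟨h', C.roots, Function.update C.threads p st'⟩ p L' ∧
      totalBudget L' < totalBudget L := by
  have hf := hL.frameOK hC
  have hst := hL.threads
  generalize hstk : C.threads p = st at hs hst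
  cases hs with
  | @rootBegin a d rest cell ha =>
    obtain ⟨Q, M, u, B, L, rfl, rfl⟩ := exists_eq_cons_of_map_frame hst.symm
    obtain ⟨⟨htask, hprog, hnot⟩, hphase⟩ := hL.shape.1
    have := two_le_attemptCost S M
    have hB : u * attemptCost S M + attemptCost S M ≤ B := hphase
    refine ⟨_, hL.replace_top (g' := ⟨⟨a, d, .rootLLX cell.version⟩, Q, M, u, B - 1⟩) rfl
      (Or.inl rfl) (fun _ _ hQ => hQ.2) ⟨⟨htask, hprog, hnot⟩, ?_, .self ha⟩, ?_⟩
    · simp only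
      omega
    · simp only [totalBudget_cons]
      omega
  | @rootFailed a d rest cell w ha hw =>
    obtain ⟨Q, M, u, B, L, rfl, rfl⟩ := exists_eq_cons_of_map_frame hst.symm
    have hphase := hL.shape.1.phase
    have := two_le_attemptCost S M
    obtain ⟨hB, hllx⟩ : u * attemptCost S M + attemptCost S M ≤ B + 1 ∧
      LLXOK D C.heap a d M u a w := hphase
    exact hL.restart (hllx cell ha hw) (by simp only; omega)
  | @rootFinalized a d rest cell w ha hfi =>
    obtain ⟨Q, M, u, B, L, rfl, rfl⟩ := exists_eq_cons_of_map_frame hst.symm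
    have hphase := hL.shape.1.phase
    have := two_le_attemptCost S M
    have hB : u * attemptCost S M + attemptCost S M ≤ B + 1 := hphase.1
    exact hL.escape (hC.heap.not_isDeferred_of_final ha hfi) (by simp only; omega)
  | @rootMismatch a d rest cell w ha hfi hd =>
    obtain ⟨Q, M, u, B, L, rfl, rfl⟩ := exists_eq_cons_of_map_frame hst.symm
    have hphase := hL.shape.1.phase
    have := two_le_attemptCost S M
    have hB : u * attemptCost S M + attemptCost S M ≤ B + 1 := hphase.1
    refine hL.escape ?_ (by simp only; omega)
    obtain ⟨cell', h1, h2⟩ := (hf _ List.mem_cons_self).cell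
    simp only at h1 h2
    rw [ha] at h1
    cases h1
    obtain ⟨⟨y, h3⟩, -⟩ := h2.resolve_left hd
    exact IsImmediate.not_isDeferred ⟨_, _, ha, h3⟩
  | @rootSuccess a d rest cell w ha hfi hd =>
    obtain ⟨Q, M, u, B, L, rfl, rfl⟩ := exists_eq_cons_of_map_frame hst.symm
    obtain ⟨⟨htask, hprog, hnot⟩, hphase⟩ := hL.shape.1
    have := two_le_attemptCost S M
    have hB : u * attemptCost S M + attemptCost S M ≤ B + 1 := hphase.1
    rw [Deferred.begin_eq]
    refine ⟨_, hL.replace_top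
      (g' := ⟨⟨a, d, .run [(a, cell.version)] d.env (d.code D)⟩, Q, M, u, B - 1⟩) rfl
      (Or.inl rfl) (fun _ _ hQ b hb => hQ.2 b (Or.inl (hb.elim id id)))
      ⟨⟨htask, hprog, hnot⟩, .start_begin ha htask (by simp only; omega)⟩, ?_⟩
    simp only [totalBudget_cons]
    omega
  | @alloc a d rest R m env x k =>
    obtain ⟨Q, M, u, B, L, rfl, rfl⟩ := exists_eq_cons_of_map_frame hst.symm
    exact hL.alloc hC
  | @strictBegin a d rest R m env x k cell hx =>
    obtain ⟨Q, M, u, B, L, rfl, rfl⟩ := exists_eq_cons_of_map_frame hst.symm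
    obtain ⟨⟨htask, hprog, hnot⟩, n, rem, hex, hen, hB⟩ := hL.shape.1
    have h2 := hen.two_le hex.pos
    simp only at hB
    refine ⟨_, hL.replace_top
      (g' := ⟨⟨a, d, .childLLX R env (.readStrict x k) cell.version⟩, Q, M, u, B - 1⟩) rfl
      (Or.inl rfl) (fun _ _ hQ => hQ.2) ⟨⟨htask, hprog, hnot⟩, n, rem, hex, hen, ?_, ?_⟩, ?_⟩
    · simp only
      omega
    · rintro x' ⟨⟩
      exact .self hx
    · simp only [totalBudget_cons]
      omega
  | @strictFailed a d rest R m env x k w cell hx hw =>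
    obtain ⟨Q, M, u, B, L, rfl, rfl⟩ := exists_eq_cons_of_map_frame hst.symm
    obtain ⟨-, n, rem, hex, hen, hB, hllx⟩ := hL.shape.1
    have h2 := hen.two_le hex.pos
    simp only at hB
    exact hL.restart (hllx x rfl cell hx hw) (by simp only; omega)
  | @strictImm a d rest R m env x k w cell y hx hy =>
    obtain ⟨Q, M, u, B, L, rfl, rfl⟩ := exists_eq_cons_of_map_frame hst.symm
    obtain ⟨⟨htask, hprog, hnot⟩, n, rem, hex, hen, hB, -⟩ := hL.shape.1
    simp only at hB htask hprog hnot
    obtain ⟨e, r, he, hso⟩ := hex.sound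
    cases hso with
    | @strict _ _ _ _ _ c val ts _ n hex₁ hl hk =>
      obtain ⟨ts', h1, h2⟩ := (he x).imm_inv hx hy
      rw [hex₁] at h1
      cases h1
      have hunit := le_unitCost S M
      have hrem : n * unitCost S M + 2 ≤ rem := by
        rcases hen with h3 | ⟨_, _, -, -, h3⟩
        · have h4 : n * unitCost S M + 1 * unitCost S M ≤ rem := Nat.add_mul _ _ _ ▸ h3
          omega
        · simpa using h3
      have hi : IsImmediate C.heap (env x) := ⟨_, _, hx, hy⟩
      refine ⟨_, hL.replace_top (g' := ⟨⟨a, d, .run (R.add (env x) cell)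
        (Fin.append env y.children) (k y.tag y.value cell.final)⟩, Q, M, u, B - 1⟩) rfl
        (Or.inl rfl) (fun Q' hQ' hQ b hb => ?_) ⟨⟨htask, hprog, hnot⟩, n, n * unitCost S M,
          ⟨?_, ⟨_, r, ?_, hk cell.final⟩, hex.lazyOK.strict hx hy _, ?_⟩, Or.inl le_rfl, ?_⟩, ?_⟩
      · rcases hb with hb | hb
        · exact hQ.2 b (Or.inl hb)
        · rcases mem_range_append hb with hb | hb
          · exact hQ.2 b (Or.inr hb)
          · exact hQ'.imm_children hx hy (hQ.2 _ (Or.inr ⟨x, rfl⟩)) b hb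
      · obtain ⟨l, h3, h4⟩ := hex.follows
        have h5 : l + (n + 1) ≤ codeBound S M := h4
        exact ⟨l + 1, h3.strict hx hy, show l + 1 + n ≤ codeBound S M by omega⟩
      · exact forall_append (R := fun b (w : Value S) => Denotes D C.heap (.addr b) w.1 w.2) he h2
      · exact EntryOK.add hex.entries hx fun h3 => absurd h3 hi.not_isDeferred
      · simp only
        omega
      · simp only [totalBudget_cons]
        omega
  | @strictSubsumed a d rest R m env x k w cell d₁ hx hd hfi =>
    -- Cells are finalized only when they become immediate, so this event cannot occur.
    exact absurd ⟨_, _, hx, hd⟩ (hC.heap.not_isDeferred_of_final hx hfi)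
  | @strictForce a d rest R m env x k w cell d₁ hx hd hfi =>
    obtain ⟨Q, M, u, B, L, rfl, rfl⟩ := exists_eq_cons_of_map_frame hst.symm
    obtain ⟨⟨htask, hprog, hnot⟩, n, rem, hex, hen, hB, -⟩ := hL.shape.1
    simp only at hB htask hprog hnot
    obtain ⟨e, r, he, hso⟩ := hex.sound
    have hdef : IsDeferred C.heap (env x) := ⟨_, _, hx, hd⟩
    have hlt : (e x).2 < M := by cases hso with | strict hex₁ hl hk => exact hl
    have hn := hex.pos
    have hunit : unitCost S M = forceBound S M + 4 := rfl
    have hrem : (n - 1) * unitCost S M + unitCost S M ≤ rem := by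
      rcases hen with h3 | ⟨x', k', h3, h4, -⟩
      · calc (n - 1) * unitCost S M + unitCost S M = (n - 1 + 1) * unitCost S M := by ring
          _ ≤ rem := by rwa [Nat.sub_add_cancel hn]
      · cases h3
        exact absurd hdef h4.not_isDeferred
    -- The unit for this instruction is `forceBound S M + 4`: the nested force, two steps for the
    -- LLX that found the child deferred, and two that the caller keeps for reading it again.
    have hcost : forceBound S ((e x).2 + 1) ≤ forceBound S M := forceBound_mono S hlt
    have ht₁ := (he x).taskSound hx hd
    obtain ⟨hi₁, hi₂⟩ := List.forall_mem_cons.1 hL.isolated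
    obtain ⟨ha₁, ha₂⟩ := List.pairwise_cons.1 hL.above
    refine ⟨⟨⟨env x, d₁, .start⟩, ∅, (e x).2, codeBound S (e x).2 + maxArity S + 1,
      forceBound S ((e x).2 + 1)⟩ :: ⟨⟨a, d, .run R env (.readStrict x k)⟩, Q, M, u,
        u * attemptCost S M + ((n - 1) * unitCost S M + 2)⟩ :: L,
      ⟨by simp, ?_, ?_, ht₁.topOK, ⟨⟨htask, hprog, hnot⟩, ?_⟩, hL.shape.2⟩, ?_⟩
    · refine List.forall_mem_cons.2 ⟨Isolated.empty _ p, List.forall_mem_cons.2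
        ⟨hi₁.update _, fun g hg => (hi₂ g hg).update _⟩⟩
    · refine List.pairwise_cons.2 ⟨?_, List.pairwise_cons.2 ⟨ha₁, ha₂⟩⟩
      refine List.forall_mem_cons.2 ⟨⟨fun h1 => hi₁.heap.deferred hx hd h1,
        fun _ => Set.empty_subset _⟩, fun g hg => ⟨fun h1 => ?_, fun _ => Set.empty_subset _⟩⟩
      exact (hi₂ g hg).heap.deferred hx hd h1
    · exact ⟨m, R, env, x, k, n, rfl, rfl, hex, Or.inl hdef, le_rfl⟩
    · simp only [totalBudget_cons]
      omega
  | @lazyBegin a d rest R m env x k cell hx =>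
    obtain ⟨Q, M, u, B, L, rfl, rfl⟩ := exists_eq_cons_of_map_frame hst.symm
    obtain ⟨⟨htask, hprog, hnot⟩, n, rem, hex, hen, hB⟩ := hL.shape.1
    have h2 := hen.two_le hex.pos
    simp only at hB
    refine ⟨_, hL.replace_top
      (g' := ⟨⟨a, d, .childLLX R env (.readLazy x k) cell.version⟩, Q, M, u, B - 1⟩) rfl
      (Or.inl rfl) (fun _ _ hQ => hQ.2) ⟨⟨htask, hprog, hnot⟩, n, rem, hex, hen, ?_, ?_⟩, ?_⟩
    · simp only
      omega
    · rintro x' ⟨⟩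
      exact .self hx
    · simp only [totalBudget_cons]
      omega
  | @lazyFailed a d rest R m env x k w cell hx hw =>
    obtain ⟨Q, M, u, B, L, rfl, rfl⟩ := exists_eq_cons_of_map_frame hst.symm
    obtain ⟨-, n, rem, hex, hen, hB, hllx⟩ := hL.shape.1
    have h2 := hen.two_le hex.pos
    simp only at hB
    exact hL.restart (hllx x rfl cell hx hw) (by simp only; omega)
  | @lazyDone a d rest R m env x k w cell hx =>
    obtain ⟨Q, M, u, B, L, rfl, rfl⟩ := exists_eq_cons_of_map_frame hst.symm
    obtain ⟨⟨htask, hprog, hnot⟩, n, rem, hex, hen, hB, -⟩ := hL.shape.1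
    simp only at hB htask hprog hnot
    obtain ⟨e, r, he, hso⟩ := hex.sound
    cases hso with
    | @lazy _ _ _ _ _ _ n hk =>
      have hunit := le_unitCost S M
      have hrem : (n + 1) * unitCost S M ≤ rem := by
        rcases hen with h3 | ⟨_, _, h3, -⟩
        · exact h3
        · cases h3
      rw [Nat.add_mul] at hrem
      refine ⟨_, hL.replace_top (g' := ⟨⟨a, d, .run (R.add (env x) cell) env
        (k cell.alreadySnapshot)⟩, Q, M, u, B - 1⟩) rfl (Or.inl rfl) (fun _ _ hQ => hQ.2)
        ⟨⟨htask, hprog, hnot⟩, n, n * unitCost S M, ⟨?_, ⟨e, r, he, hk _⟩, hex.lazyOK.lazy _, ?_⟩,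
          Or.inl le_rfl, ?_⟩, ?_⟩
      · obtain ⟨l, h3, h4⟩ := hex.follows
        have h5 : l + (n + 1) ≤ codeBound S M := h4
        exact ⟨l + 1, h3.lazy hx, show l + 1 + n ≤ codeBound S M by omega⟩
      · exact EntryOK.add hex.entries hx fun _ => hex.lazyOK.target
      · simp only
        omega
      · simp only [totalBudget_cons]
        omega
  | @scxSuccess a d rest R m env x cell ha hR =>
    obtain ⟨Q, M, u, B, L, rfl, rfl⟩ := exists_eq_cons_of_map_frame hst.symm
    exact hL.scx hC ha hR
  | @scxFailed a d rest R m env x hR =>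
    obtain ⟨Q, M, u, B, L, rfl, rfl⟩ := exists_eq_cons_of_map_frame hst.symm
    obtain ⟨-, n, rem, hex, hen, hB⟩ := hL.shape.1
    have h2 := hen.two_le hex.pos
    simp only at hB
    refine hL.restart ?_ (by simp only; omega)
    -- A failed SCX exhibits an outdated entry, and by `EntryOK` such an entry comes with a smaller
    -- potential.
    simp only [ReadSet.Valid, not_forall, not_exists, not_and] at hR
    obtain ⟨en, h3, h4⟩ := hR
    obtain ⟨cell, h5, h6, -⟩ := hex.entries en h3
    exact h6.resolve_left (h4 cell h5)

/-- The node that the outermost activation forces. -/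
def Stack.outermost : Stack S → Option Addr
  | [] => none
  | [fr] => some fr.addr
  | _ :: fr :: rest => Stack.outermost (fr :: rest)

theorem Stack.outermost_cons (fr fr' : Frame S) (rest : Stack S) (h : fr.addr = fr'.addr) :
    Stack.outermost (fr :: rest) = Stack.outermost (fr' :: rest) := by
  cases rest <;> simp [Stack.outermost, h]

/-- The stack becomes empty only by an SCX on the outermost node or by an escape from it, and a node
from which an activation escapes is immediate already. -/
theorem ForceStep.outermost {h h' : Heap S} {st st' : Stack S} {e : Event}
    (hs : ForceStep D h st e h' st') (hh : HeapOK ord h) (hf : ∀ fr ∈ st, FrameOK D ord h fr)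
    {n : Addr} (hn : Stack.outermost st = some n) :
    (st' = [] → IsImmediate h' n) ∧ (st' ≠ [] → Stack.outermost st' = some n) := by
  have escape : ∀ {fr : Frame S} {rest : Stack S}, Stack.outermost (fr :: rest) = some n →
      ¬ IsDeferred h fr.addr → fr.addr < h.length →
      (rest.escape = [] → IsImmediate h n) ∧
        (rest.escape ≠ [] → Stack.outermost rest.escape = some n) := by
    intro fr rest h1 h2 h3
    cases rest with
    | nil =>
      refine ⟨fun _ => ?_, fun h4 => absurd rfl h4⟩
      cases h1
      obtain ⟨cell, h5⟩ := List.getElem?_of_lt h3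
      cases h6 : cell.content with
      | imm y => exact ⟨_, _, h5, h6⟩
      | deferred d => exact absurd ⟨_, _, h5, h6⟩ h2
    | cons fr' rest =>
      refine ⟨fun h4 => absurd h4 (List.cons_ne_nil _ _), fun _ => ?_⟩
      rw [← h1]
      exact Stack.outermost_cons _ _ _ rfl
  have same : ∀ {fr fr' : Frame S} {rest : Stack S}, Stack.outermost (fr :: rest) = some n →
      fr'.addr = fr.addr → (fr' :: rest = [] → IsImmediate h' n) ∧
        (fr' :: rest ≠ [] → Stack.outermost (fr' :: rest) = some n) := by
    intro fr fr' rest h1 h2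
    exact ⟨fun h3 => absurd h3 (List.cons_ne_nil _ _),
      fun _ => (Stack.outermost_cons _ _ _ h2).trans h1⟩
  cases hs with
  | rootFinalized ha hfi =>
    exact escape hn (hh.not_isDeferred_of_final ha hfi) (lt_length_of_getElem? ha)
  | rootMismatch ha hfi hd =>
    refine escape hn ?_ (lt_length_of_getElem? ha)
    obtain ⟨cell', h1, h2⟩ := (hf _ List.mem_cons_self).cell
    simp only at h1 h2
    rw [ha] at h1
    cases h1
    obtain ⟨⟨y, h3⟩, -⟩ := h2.resolve_left hd
    exact IsImmediate.not_isDeferred ⟨_, _, ha, h3⟩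
  | strictSubsumed hx hd hfi =>
    exact absurd ⟨_, _, hx, hd⟩ (hh.not_isDeferred_of_final hx hfi)
  | strictForce hx hd hfi =>
    refine ⟨fun h1 => absurd h1 (List.cons_ne_nil _ _), fun _ => ?_⟩
    rw [← hn, Stack.outermost]
    exact Stack.outermost_cons _ _ _ rfl
  | @scxSuccess a d _ R m env x cell ha hR =>
    cases st' with
    | nil =>
      refine ⟨fun _ => ?_, fun h4 => absurd rfl h4⟩
      cases hn
      exact ⟨_, x.map env, List.getElem?_set_self (lt_length_of_getElem? ha), rfl⟩
    | cons fr' rest => exact ⟨fun h4 => absurd h4 (List.cons_ne_nil _ _), fun _ => hn⟩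
  | _ => exact same hn rfl

/-! ### Step bounds along whole executions -/

theorem ConfigOK.evolves (hC : ConfigOK D ord C) {q : Fin P} {e : Event}
    (hs : Step D C q e C') : Evolves C.heap C'.heap := by
  cases hs with
  | force hs =>
    rcases hs.change (hC.frames q) with h1 | ⟨c, h1⟩ | ⟨fr, hfr, Q, y, h1⟩
    · simp only [h1]
      exact .refl _
    · simp only [h1]
      exact .append _ _
    · exact h1.evolves
  | invoke hp ha hc hd => exact .refl _
  | post hp hx => exact .append _ _

/-- The thread `p` is executing, or has finished, an execution of `force` on the node `n`, in which
it takes at most `N` more steps. -/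
structure Forcing (D : SeqDef S) (C : Config S P) (p : Fin P) (n : Addr) (N : ℕ) : Prop where
  config : ∃ ord, ConfigOK D ord C
  stack : ∃ L, StackInv D C p L ∧ totalBudget L ≤ N
  finished : C.threads p = [] → IsImmediate C.heap n
  running : C.threads p ≠ [] → Stack.outermost (C.threads p) = some n

theorem Forcing.step_other {n : Addr} {N : ℕ} (hF : Forcing D C p n N) {q : Fin P} (hq : q ≠ p)
    {e : Event} (hs : Step D C q e C') : Forcing D C' p n N := by
  obtain ⟨⟨ord, hC⟩, ⟨L, hL, hN⟩, hfin, hrun⟩ := hF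
  have hL' := hL.step_other hC hq hs
  have hst : C'.threads p = C.threads p := hL'.threads.trans hL.threads.symm
  refine ⟨hC.step hs, ⟨L, hL', hN⟩, fun h1 => ?_, fun h1 => ?_⟩
  · exact (hfin (hst ▸ h1)).evolves (hC.evolves hs)
  · rw [hst] at h1 ⊢
    exact hrun h1

theorem Forcing.step_self {n : Addr} {N : ℕ} (hF : Forcing D C p n N) {e : Event}
    (he : e.isClient = false) (hs : Step D C p e C') : ∃ N' < N, Forcing D C' p n N' := by
  obtain ⟨⟨ord, hC⟩, ⟨L, hL, hN⟩, hfin, hrun⟩ := hF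
  have hC' := hC.step hs
  cases hs with
  | invoke hp ha hc hd => cases he
  | post hp hx => cases he
  | @force _ h' st' hs =>
    obtain ⟨L', hL', hlt⟩ := hL.step_self hC hs
    have hne : C.threads p ≠ [] := by
      intro h1
      rw [h1] at hs
      cases hs
    obtain ⟨h1, h2⟩ := hs.outermost hC.heap (hC.frames p) (hrun hne)
    refine ⟨totalBudget L', hlt.trans_le hN, hC', ⟨L', hL', le_rfl⟩, ?_, ?_⟩
    · simpa using h1
    · simpa using h2

theorem Forcing.exec {n : Addr} {tr : List (Fin P × Event)} (ht : Exec D C tr C') :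
    ∀ {N : ℕ}, Forcing D C p n N → (∀ s ∈ tr, s.1 = p → s.2.isClient = false) →
      ∃ N', stepsOf p tr + N' ≤ N ∧ Forcing D C' p n N' := by
  induction ht with
  | nil => exact fun {N} hF _ => ⟨N, by simp [stepsOf], hF⟩
  | @cons C C₁ C₂ q e tr hs ht ih =>
    intro N hF htr
    obtain ⟨h1, h2⟩ := List.forall_mem_cons.1 htr
    by_cases hq : q = p
    · subst hq
      obtain ⟨N₁, h3, h4⟩ := hF.step_self (h1 rfl) hs
      obtain ⟨N', h5, h6⟩ := ih h4 h2
      refine ⟨N', ?_, h6⟩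
      simp only [stepsOf, List.countP_cons, decide_true, if_true] at h5 ⊢
      omega
    · obtain ⟨N', h5, h6⟩ := ih (hF.step_other hq hs) h2
      refine ⟨N', ?_, h6⟩
      simpa [stepsOf, List.countP_cons, hq] using h5

theorem failuresOf_le_stepsOf (p : Fin P) (tr : List (Fin P × Event)) :
    failuresOf p tr ≤ stepsOf p tr :=
  List.countP_mono_left fun _ _ h => (Bool.and_eq_true_iff.1 h).1

theorem Forcing.invoke (hC : ConfigOK D ord C) {n : Addr} {r : SeqTree S} {T : ℕ}
    (hs : Step D C p (.invoke n) C') (hT : SeqCost D C.heap n r T) :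
    Forcing D C' p n (forceBound S (T + 1)) := by
  have hC' := hC.step hs
  cases hs with
  | @invoke _ cell d hp ha hc hd =>
    refine ⟨hC', ⟨[⟨⟨n, d, .start⟩, ∅, T, codeBound S T + maxArity S + 1, forceBound S (T + 1)⟩],
      ⟨by simp, ?_, by simp, (hT.denotes.taskSound hc hd).topOK, trivial⟩, ?_⟩, ?_, ?_⟩
    · simpa using Isolated.empty _ p
    · simp [totalBudget]
    · simp
    · simp [Stack.outermost]
  | force hs =>
    generalize C.threads p = st at hs
    cases hs

end Main

theorem mainTheorem5 (S : TreeSig.{u, v}) (D : SeqDef S) (P : ℕ) :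
    ∃ f : ℕ → ℕ,
      ∀ (tr₀ : List (Fin P × Event)) (C₀ C : Config S P) (p : Fin P) (n : Addr)
        (r : SeqTree S) (T : ℕ),
        Exec D (Config.initial S P) tr₀ C₀ →
        Step D C₀ p (.invoke n) C →
        SeqCost D C₀.heap n r T →
        ∀ (tr : List (Fin P × Event)) (C' : Config S P),
          Exec D C tr C' →
          (∀ s ∈ tr, s.1 = p → s.2.isClient = false) →
          stepsOf p tr ≤ f T ∧
          failuresOf p tr ≤ f T ∧
          (C'.threads p ≠ [] → ∃ (e : Event) (C'' : Config S P), Step D C' p e C'') ∧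
          (C'.threads p = [] →
            ∃ (cell : Cell S) (y : Imm S Addr),
              C'.heap[n]? = some cell ∧ cell.content = .imm y) := by
  -- The forced node has level `T`, and `forceBound S M` covers levels strictly below `M`. The bound
  -- depends only on the tree type and on `T`.
  refine ⟨fun T => forceBound S (T + 1), ?_⟩
  intro tr₀ C₀ C p n r T h₀ hinv hT tr C' htr hcl
  obtain ⟨ord, hC₀⟩ := (ConfigOK.initial S D P).exec h₀
  obtain ⟨N', h1, h2⟩ := Forcing.exec htr (Forcing.invoke hC₀ hinv hT) hcl
  obtain ⟨ord', hC'⟩ := h2.config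
  have h3 : stepsOf p tr ≤ forceBound S (T + 1) := (Nat.le_add_right _ _).trans h1
  exact ⟨h3, (failuresOf_le_stepsOf p tr).trans h3, hC'.enabled, h2.finished⟩
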